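/- **Proposition 1.3.** Let $(W,\lambda)$ be a Liouville manifold: $W$ is a finite-dimensional smooth manifold without boundary, $\lambda$ is a smooth one-form on $W$ with $d\lambda$ symplectic, and the end of $W$ is the positive half of the symplectization of a compact contact manifold $(Y,\alpha)$, i.e. there is a diffeomorphism $\Phi$ from $Y\times(0,\infty)$ onto an open subset of $W$ with $\Phi^*\lambda=e^{s}\alpha$ such that, for every $S>0$, $\Phi(Y\times[S,\infty))$ is closed in $W$ and $\Phi(Y\times(S,\infty))$ has compact complement. (Then $(Y,\ker\alpha)$, cooriented by $\alpha$, is called the ideal contact boundary of $W$.) Let $W'=W\times\mathbb{C}$ be the $1$-stabilization, with the one-form $\lambda'=\lambda+\tfrac12(x\,dy-y\,dx)$, where $z=x+iy$ is the coordinate on $\mathbb{C}$. Then $(W',\lambda')$ is a Liouville manifold, and for every presentation $\Phi':Y'\times(0,\infty)\to W'$ of its ideal contact boundary $(Y',\ker\alpha')$ as above there is an extensible positive loop of contactomorphisms of $Y'$, that is, a smooth loop $(\varphi_t)_{t\in\mathbb{R}/\mathbb{Z}}$ of contactomorphisms of $(Y',\ker\alpha')$ with $\varphi_0=\mathrm{id}$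 such that 1. (positive) $\alpha'\big(\tfrac{d}{dt}\varphi_t(y)\big)>0$ for all $t$ and all $y\in Y'$; 2. (extensible) there is a smooth loop $(\psi_t)_{t\in\mathbb{R}/\mathbb{Z}}$ of diffeomorphisms of $W'$ with $\psi_0=\mathrm{id}$ that preserve $d\lambda'$, whose generator $X_t$ satisfies $d\lambda'(X_t,\cdot)=-dH_t$ for a smooth family of functions $H_t:W'\to\mathbb{R}$, and which preserve, outside of a compact set independent of $t$, the Liouville vector field $Z'$ (defined by $d\lambda'(Z',\cdot)=\lambda'$), such that $\varphi_t$ is the ideal restriction of $\psi_t$ for every $t$: there are $S\ge 0$ and $g:Y'\to\mathbb{R}$ (depending on $t$) with $s+g(y)>0$ and $\psi_t(\Phi'(y,s))=\Phi'(\varphi_t(y),s+g(y))$ for all $y\in Y'$ and $s>S$. -/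

import Mathlib

open scoped Manifold ContDiff
open Set

universe u

/-- A (not necessarily smooth) differential one-form on the manifold `M`. -/
abbrev OneForm {E : Type*} [NormedAddCommGroup E] [NormedSpace ℝ E]
    {H : Type*} [TopologicalSpace H] (I : ModelWithCorners ℝ E H)
    (M : Type*) [TopologicalSpace M] [ChartedSpace H M] : Type _ :=
  (x : M) → TangentSpace I x →L[ℝ] ℝ

namespace OneForm

section Basic

variable {E : Type*} [NormedAddCommGroup E] [NormedSpace ℝ E]
  {H : Type*} [TopologicalSpace H] {I : ModelWithCorners ℝ E H}
  {M : Type*} [TopologicalSpace M] [ChartedSpace H M]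
  {E' : Type*} [NormedAddCommGroup E'] [NormedSpace ℝ E']
  {H' : Type*} [TopologicalSpace H'] {J : ModelWithCorners ℝ E' H'}
  {N : Type*} [TopologicalSpace N] [ChartedSpace H' N]

/-- A one-form is smooth if it is a smooth function on the total space of the tangent bundle. -/
def Smooth [IsManifold I ∞ M] (lam : OneForm I M) : Prop :=
  ContMDiff I.tangent 𝓘(ℝ, ℝ) ∞ (fun v : TangentBundle I M => lam v.1 v.2)

/-- The pullback `f^* lam` of a one-form. -/
noncomputable def pullback (f : M → N) (lam : OneForm J N) : OneForm I M :=
  fun x => (lam (f x)).comp (mfderiv I J f x)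

/-- The one-form `lam` read in the preferred chart at `x₀`, a one-form on (an open subset of) the
model vector space. -/
noncomputable def inChart (lam : OneForm I M) (x₀ : M) : E → (E →L[ℝ] ℝ) :=
  fun e => (lam ((extChartAt I x₀).symm e)).comp
    (mfderiv 𝓘(ℝ, E) I (extChartAt I x₀).symm e)

/-- The exterior derivative: `lam.d x u v` is `(d lam)_x (u, v)` for a smooth one-form on a
manifold without boundary. It is computed in the preferred chart at `x`, which is also the chart
through which Mathlib identifies `TangentSpace I x` with the model vector space `E`. -/
noncomputable def d (lam : OneForm I M) (x : M) (u v : TangentSpace I x) : ℝ :=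
  fderiv ℝ (lam.inChart x) (extChartAt I x x) u v
    - fderiv ℝ (lam.inChart x) (extChartAt I x x) v u

/-- `d lam` is nondegenerate at every point (so it is a symplectic form). -/
def NondegenerateD (lam : OneForm I M) : Prop :=
  ∀ (x : M) (u : TangentSpace I x), (∀ v : TangentSpace I x, lam.d x u v = 0) → u = 0

/-- `al` is a contact form: `al` is smooth and vanishes nowhere, and `d al` is nondegenerate on
the hyperplane field `ker al`. -/
structure IsContact [IsManifold I ∞ M] (al : OneForm I M) : Prop where
  smooth : al.Smooth
  ne_zero : ∀ x, al x ≠ 0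
  nondegenerate : ∀ (x : M) (u : TangentSpace I x), al x u = 0 →
    (∀ v : TangentSpace I x, al x v = 0 → al.d x u v = 0) → u = 0

/-- `z` is the value at `x` of the Liouville vector field of `lam`, that is,
`d lam (z, ·) = lam` at `x`. -/
def IsLiouvilleVector (lam : OneForm I M) (x : M) (z : TangentSpace I x) : Prop :=
  ∀ v : TangentSpace I x, lam.d x z v = lam x v

end Basic

/-- The one-form `(1/2) (x dy - y dx)` on `ℂ`. -/
noncomputable def stdComplex : OneForm 𝓘(ℝ, ℂ) ℂ :=
  fun z => ((1 / 2 : ℝ) • (z.re • Complex.imCLM - z.im • Complex.reCLM) : ℂ →L[ℝ] ℝ)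

/-- The one-form `lam + (1/2) (x dy - y dx)` on `M × ℂ`. -/
noncomputable def stabilization {E : Type*} [NormedAddCommGroup E] [NormedSpace ℝ E]
    {H : Type*} [TopologicalSpace H] {I : ModelWithCorners ℝ E H}
    {M : Type*} [TopologicalSpace M] [ChartedSpace H M] (lam : OneForm I M) :
    OneForm (I.prod 𝓘(ℝ, ℂ)) (M × ℂ) :=
  pullback (I := I.prod 𝓘(ℝ, ℂ)) (J := I) (Prod.fst : M × ℂ → M) lam
    + pullback (I := I.prod 𝓘(ℝ, ℂ)) (J := 𝓘(ℝ, ℂ)) (Prod.snd : M × ℂ → ℂ) stdComplex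

end OneForm

/-- A convex end of `(W, lam)` modelled on the contact manifold `(Y, al)`: an identification,
respecting the Liouville forms, of the positive half `(Y × (0, ∞), exp s • al)` of the
symplectization with an open subset of `W`, such that the parts `Y × [S, ∞)` are closed in `W` and
the parts `Y × (S, ∞)` have compact complement (so `W` is a compact piece with boundary `Y × {S}`
with the cylinder `Y × [S, ∞)` attached, for every `S > 0`). It exhibits `(Y, ker al)`, cooriented by `al`, as the ideal contact boundary of `(W, lam)`. -/
structure ConvexEnd {E : Type*} [NormedAddCommGroup E] [NormedSpace ℝ E]
    {H : Type*} [TopologicalSpace H] {I : ModelWithCorners ℝ E H}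
    {W : Type*} [TopologicalSpace W] [ChartedSpace H W]
    {E' : Type*} [NormedAddCommGroup E'] [NormedSpace ℝ E']
    {H' : Type*} [TopologicalSpace H'] {J : ModelWithCorners ℝ E' H'}
    {Y : Type*} [TopologicalSpace Y] [ChartedSpace H' Y]
    (lam : OneForm I W) (al : OneForm J Y) where
  /-- The identification of the end. Only its values on `Y × (0, ∞)` matter, where it is an
  injective local diffeomorphism, that is, a diffeomorphism onto an open subset. -/
  emb : Y × ℝ → W
  isLocalDiffeomorphOn : IsLocalDiffeomorphOn (J.prod 𝓘(ℝ, ℝ)) I ∞ emb (univ ×ˢ Ioi 0)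
  injOn : InjOn emb (univ ×ˢ Ioi 0)
  pullback_eq : ∀ (y : Y) (s : ℝ), 0 < s →
    OneForm.pullback (I := J.prod 𝓘(ℝ, ℝ)) (J := I) emb lam (y, s)
      = Real.exp s •
        OneForm.pullback (I := J.prod 𝓘(ℝ, ℝ)) (J := J) (Prod.fst : Y × ℝ → Y) al (y, s)
  isClosed_image : ∀ S : ℝ, 0 < S → IsClosed (emb '' (univ ×ˢ Ici S))
  isCompact_compl : ∀ S : ℝ, 0 < S → IsCompact (emb '' (univ ×ˢ Ioi S))ᶜ

/-- `(W, lam)` is a Liouville manifold: `lam` is a smooth one-form with `d lam` symplectic, and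
the end of `W` is the positive half of the symplectization of a compact contact manifold. -/
structure IsLiouvilleManifold {E : Type*} [NormedAddCommGroup E] [NormedSpace ℝ E]
    {H : Type*} [TopologicalSpace H] {I : ModelWithCorners ℝ E H}
    {W : Type u} [TopologicalSpace W] [ChartedSpace H W] [IsManifold I ∞ W]
    (lam : OneForm I W) : Prop where
  smooth : lam.Smooth
  nondegenerate : lam.NondegenerateD
  convex : ∃ (m : ℕ) (Y : Type u) (_ : TopologicalSpace Y)
    (_ : ChartedSpace (EuclideanSpace ℝ (Fin m)) Y) (_ : IsManifold (𝓡 m) ∞ Y)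
    (_ : T2Space Y) (_ : CompactSpace Y) (al : OneForm (𝓡 m) Y),
    al.IsContact ∧ Nonempty (ConvexEnd lam al)

section Loops

variable {E : Type*} [NormedAddCommGroup E] [NormedSpace ℝ E]
  {H : Type*} [TopologicalSpace H] {I : ModelWithCorners ℝ E H}
  {W : Type*} [TopologicalSpace W] [ChartedSpace H W]
  {E' : Type*} [NormedAddCommGroup E'] [NormedSpace ℝ E']
  {H' : Type*} [TopologicalSpace H'] {J : ModelWithCorners ℝ E' H'}
  {Y : Type*} [TopologicalSpace Y] [ChartedSpace H' Y]

/-- The velocity at time `t` of the curve `τ ↦ f τ x`. -/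
noncomputable def isotopyVelocity (f : ℝ → W → W) (t : ℝ) (x : W) : TangentSpace I (f t x) :=
  mfderiv 𝓘(ℝ, ℝ) I (fun τ : ℝ => f τ x) t (1 : ℝ)

/-- A smooth loop of diffeomorphisms (parametrized by `ℝ / ℤ`) based at the identity. -/
structure IsSmoothLoop (f : ℝ → (W ≃ₘ⟮I, I⟯ W)) : Prop where
  smooth : ContMDiff (𝓘(ℝ, ℝ).prod I) I ∞ (fun p : ℝ × W => f p.1 p.2)
  periodic : ∀ t, f (t + 1) = f t
  zero : f 0 = Diffeomorph.refl I W ∞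

/-- A loop of contact-at-infinity Hamiltonian diffeomorphisms of `(W, lam)` based at the identity:
a smooth loop of diffeomorphisms that preserve `d lam`, whose generator `X_t` is dual with respect
to `d lam` to the exact one-form `-dH_t`, and which commute with the Liouville flow (preserve the
Liouville vector field) outside of a compact set. -/
structure IsContactAtInfinityHamiltonianLoop (lam : OneForm I W)
    (psi : ℝ → (W ≃ₘ⟮I, I⟯ W)) : Prop extends IsSmoothLoop psi where
  symplectic : ∀ (t : ℝ) (x : W) (u v : TangentSpace I x),
    lam.d (psi t x) (mfderiv I I (psi t) x u) (mfderiv I I (psi t) x v) = lam.d x u v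
  hamiltonian : ∃ h : ℝ → W → ℝ,
    ContMDiff (𝓘(ℝ, ℝ).prod I) 𝓘(ℝ, ℝ) ∞ (fun p : ℝ × W => h p.1 p.2) ∧
    ∀ (t : ℝ) (x : W) (v : TangentSpace I (psi t x)),
      lam.d (psi t x) (isotopyVelocity (I := I) (fun τ => psi τ) t x) v
        = -(mfderiv I 𝓘(ℝ, ℝ) (h t) (psi t x) v : ℝ)
  equivariant : ∃ K : Set W, IsCompact K ∧ ∀ (t : ℝ), ∀ x ∉ K, ∀ z : TangentSpace I x,
    lam.IsLiouvilleVector x z → lam.IsLiouvilleVector (psi t x) (mfderiv I I (psi t) x z)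

/-- A smooth loop, based at the identity, of contactomorphisms of `(Y, ker al)`. -/
structure IsContactLoop (al : OneForm J Y) (phi : ℝ → (Y ≃ₘ⟮J, J⟯ Y)) : Prop
    extends IsSmoothLoop phi where
  contact : ∀ (t : ℝ) (y : Y) (v : TangentSpace J y),
    al (phi t y) (mfderiv J J (phi t) y v) = 0 ↔ al y v = 0

/-- All curves `t ↦ phi t y` are positively transverse to the contact distribution `ker al`,
cooriented by `al`. -/
def IsPositiveLoop (al : OneForm J Y) (phi : ℝ → (Y ≃ₘ⟮J, J⟯ Y)) : Prop :=
  ∀ (t : ℝ) (y : Y), 0 < al (phi t y) (isotopyVelocity (I := J) (fun τ => phi τ) t y)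

/-- The self-map `phi` of `Y` is the ideal restriction of the self-map `psi` of `W`: far out
in the end, `psi` maps the Liouville trajectory over `y` to the one over `phi y`, by a
translation of the symplectization coordinate. -/
def ConvexEnd.IsIdealRestriction {lam : OneForm I W} {al : OneForm J Y} (e : ConvexEnd lam al)
    (psi : W → W) (phi : Y → Y) : Prop :=
  ∃ (S : ℝ) (g : Y → ℝ), 0 ≤ S ∧ ∀ (y : Y) (s : ℝ), S < s →
    0 < s + g y ∧ psi (e.emb (y, s)) = e.emb (phi y, s + g y)

/-- A loop in `Y` is extensible if it is the ideal restriction of a contact-at-infinity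
Hamiltonian loop. -/
def ConvexEnd.IsExtensible {lam : OneForm I W} {al : OneForm J Y} (e : ConvexEnd lam al)
    (phi : ℝ → (Y ≃ₘ⟮J, J⟯ Y)) : Prop :=
  ∃ psi : ℝ → (W ≃ₘ⟮I, I⟯ W), IsContactAtInfinityHamiltonianLoop lam psi ∧
    ∀ t, e.IsIdealRestriction (psi t) (phi t)

end Loops

/-!
The idea is that rotating the plane factor of the stabilization is a loop of Hamiltonian
diffeomorphisms whose Hamiltonian is nonnegative, and that it can be made positive at infinity by
composing it with a conjugate of itself.

*The stabilization is a Liouville manifold.* The Liouville flow of a manifold with a convex end is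
complete and translates the symplectization coordinate `s` (`ConvexEnd.exists_liouvilleFlow`); times
the flow `z ↦ e^(t/2) z` it is the Liouville flow of the stabilization. It is transverse to a level
set `Σ` of the function `|z|² + h`, where `h ≥ 0` is supported in the end and is a function of `s`,
increasing where it is positive. The sublevel set is compact and every trajectory is in it at very
negative times, so `Σ` is a compact contact hypersurface beyond which the manifold is half a
symplectization (`isLiouvilleManifold_of_isSmoothFlow`, `IsLiouvilleManifold.stabilization`).

*The loop.* Let `ρ_t` be the rotation of the plane factor by the angle `2πt`. It preserves the
Liouville form, and its Hamiltonian `Q = π|z|²` vanishes exactly on `W × {0}`,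
which is in general not compact.
There is a symplectomorphism `g` of the stabilization, preserving the Liouville form off a compact
set, such that `W × {0}` and `g (W × {0})` are disjoint off a compact set (`exists_displacement`):
over the collar of the end it twists the plane about the point `e^(s/2)` by an angle that depends on
the distance from this point in units of `e^(s/2)`, thereby moving `0`, and it follows the Reeb flow
for a time chosen so that the Liouville form changes only by an exact form
(`CollarTwist.liouvilleForm_change`), which vanishes where the twist is scale invariant. The loop
`psi_t = ρ_t g ρ_t g⁻¹` starts at the identity and has the Hamiltonian `Q + Q ∘ (ρ_t g)⁻¹`, which is
positive off a compact set. As `psi_t` preserves the Liouville form there, the Liouville form of the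
velocity of `psi_t` equals the Hamiltonian (`exists_positive_hamiltonianLoop`).

*Restriction.* At infinity `psi_t` commutes with the Liouville flow, so in any presentation of the
end it acts by `(y, s) ↦ (phi_t y, s + g_t y)`, with `phi_t` and `g_t` smooth
(`ConvexEnd.exists_idealRestriction`). That it preserves the Liouville form makes `phi_t` a
contactomorphism, and positivity of the Liouville form on the velocity of `psi_t` makes the loop
positive (`ConvexEnd.exists_extensible_positiveLoop`).

The analysis underneath is the naturality of the exterior derivative (`OneForm.d_pullback`), smooth
dependence of flows on initial conditions, by the implicit function theorem in a space of
continuous functions (`exists_contDiffAt_localFlow`, `exists_isSmoothFlow`), smoothness of the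
vector field dual to a one-form (`OneForm.exists_dualVectorField`), and slice charts of regular
level sets (`exists_sliceChart`).

The tangent spaces `TangentSpace I x` are copies of the model space `E` that carry no norm. Linear
algebra at a point is therefore stated for `E`, usually in an auxiliary `key`, and then applied to
tangent vectors.
-/

set_option linter.unusedSectionVars false

/-! ### The exterior derivative of one-forms -/

namespace OneForm

section Calculus

open Filter Topology

variable {E : Type*} [NormedAddCommGroup E] [NormedSpace ℝ E]
  {H : Type*} [TopologicalSpace H] {I : ModelWithCorners ℝ E H}
  {M : Type*} [TopologicalSpace M] [ChartedSpace H M]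
  {E' : Type*} [NormedAddCommGroup E'] [NormedSpace ℝ E']
  {H' : Type*} [TopologicalSpace H'] {J : ModelWithCorners ℝ E' H'}
  {N : Type*} [TopologicalSpace N] [ChartedSpace H' N]
  {E'' : Type*} [NormedAddCommGroup E''] [NormedSpace ℝ E'']
  {H'' : Type*} [TopologicalSpace H''] {K : ModelWithCorners ℝ E'' H''}
  {P : Type*} [TopologicalSpace P] [ChartedSpace H'' P]

theorem pullback_apply (f : M → N) (lam : OneForm J N) (x : M) (v : TangentSpace I x) :
    pullback (I := I) f lam x v = lam (f x) (mfderiv I J f x v) := rfl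

/-- All tangent spaces are the model space `E`, so covectors at different base points are compared
in `E →L[ℝ] ℝ`. -/
theorem congr_point (lam : OneForm J N) {a b : N} (h : a = b) :
    (lam a : E' →L[ℝ] ℝ) = lam b := by
  subst h; rfl

theorem pullback_congr {f g : M → N} (lam : OneForm J N) {x : M} (h : f =ᶠ[𝓝 x] g) :
    (pullback (I := I) f lam x : E →L[ℝ] ℝ) = pullback (I := I) g lam x := by
  have h1 : (mfderiv I J f x : E →L[ℝ] E') = mfderiv I J g x := h.mfderiv_eq
  have h2 : (lam (f x) : E' →L[ℝ] ℝ) = lam (g x) := lam.congr_point h.eq_of_nhds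
  change (lam (f x) : E' →L[ℝ] ℝ).comp (mfderiv I J f x : E →L[ℝ] E')
    = (lam (g x) : E' →L[ℝ] ℝ).comp (mfderiv I J g x : E →L[ℝ] E')
  rw [h1, h2]
  rfl

theorem pullback_comp {f : M → N} {g : N → P} (lam : OneForm K P) {x : M}
    (hg : MDifferentiableAt J K g (f x)) (hf : MDifferentiableAt I J f x) :
    pullback (I := I) (g ∘ f) lam x = pullback f (pullback (I := J) g lam) x := by
  ext v
  simp only [pullback_apply]
  rw [mfderiv_comp x hg hf]
  rfl

/-- The coordinate expression of a one-form depends only on its germ. -/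
theorem inChart_congr {lam mu : OneForm I M} [I.Boundaryless] {x : M}
    (h : ∀ᶠ y in 𝓝 x, lam y = mu y) :
    lam.inChart x =ᶠ[𝓝 (extChartAt I x x)] mu.inChart x := by
  have hc : Tendsto (extChartAt I x).symm (𝓝 (extChartAt I x x)) (𝓝 x) := by
    have := (continuousAt_extChartAt_symm (I := I) x).tendsto
    rwa [extChartAt_to_inv] at this
  filter_upwards [hc.eventually h] with e he
  unfold inChart
  rw [he]

theorem d_congr {lam mu : OneForm I M} [I.Boundaryless] {x : M}
    (h : ∀ᶠ y in 𝓝 x, lam y = mu y) (u v : TangentSpace I x) : lam.d x u v = mu.d x u v := by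
  unfold d
  rw [(inChart_congr h).fderiv_eq]

theorem d_swap (lam : OneForm I M) (x : M) (u v : TangentSpace I x) :
    lam.d x u v = - lam.d x v u := by
  unfold d; ring

theorem d_self (lam : OneForm I M) (x : M) (u : TangentSpace I x) : lam.d x u u = 0 := by
  unfold d; ring

theorem d_add_left (lam : OneForm I M) (x : M) (u u' v : TangentSpace I x) :
    lam.d x (u + u') v = lam.d x u v + lam.d x u' v := by
  have key : ∀ (T : E →L[ℝ] E →L[ℝ] ℝ) (a b c : E), T (a + b) c - T c (a + b)
      = T a c - T c a + (T b c - T c b) := by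
    intro T a b c
    rw [map_add, map_add, add_apply]
    ring
  exact key _ u u' v

theorem d_smul_left (lam : OneForm I M) (x : M) (c : ℝ) (u v : TangentSpace I x) :
    lam.d x (c • u) v = c * lam.d x u v := by
  have key : ∀ (T : E →L[ℝ] E →L[ℝ] ℝ) (c : ℝ) (a b : E), T (c • a) b - T b (c • a)
      = c * (T a b - T b a) := by
    intro T c a b
    rw [map_smul, map_smul, smul_apply, smul_eq_mul, smul_eq_mul]
    ring
  exact key _ c u v

theorem d_add_right (lam : OneForm I M) (x : M) (u v v' : TangentSpace I x) :
    lam.d x u (v + v') = lam.d x u v + lam.d x u v' := by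
  rw [d_swap, d_add_left, d_swap lam x v, d_swap lam x v']; ring

theorem d_smul_right (lam : OneForm I M) (x : M) (c : ℝ) (u v : TangentSpace I x) :
    lam.d x u (c • v) = c * lam.d x u v := by
  rw [d_swap, d_smul_left, d_swap lam x v]; ring

theorem d_add {lam mu : OneForm I M} {x : M}
    (h1 : DifferentiableAt ℝ (lam.inChart x) (extChartAt I x x))
    (h2 : DifferentiableAt ℝ (mu.inChart x) (extChartAt I x x)) (u v : TangentSpace I x) :
    (lam + mu).d x u v = lam.d x u v + mu.d x u v := by
  have h : (lam + mu).inChart x = lam.inChart x + mu.inChart x := by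
    funext e; exact ContinuousLinearMap.add_comp _ _ _
  have key : ∀ (S T : E →L[ℝ] E →L[ℝ] ℝ) (a b : E), (S + T) a b - (S + T) b a
      = S a b - S b a + (T a b - T b a) := by
    intro S T a b
    simp only [add_apply]
    ring
  unfold d
  rw [h, fderiv_add h1 h2]
  exact key _ _ u v

theorem inChart_normedSpace (lam : OneForm 𝓘(ℝ, E) E) (x : E) :
    lam.inChart x = fun e => (lam e : E →L[ℝ] ℝ) := by
  funext e
  have h1 : (mfderiv 𝓘(ℝ, E) 𝓘(ℝ, E) (extChartAt 𝓘(ℝ, E) x).symm e : E →L[ℝ] E)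
      = ContinuousLinearMap.id ℝ E := by
    have : ((extChartAt 𝓘(ℝ, E) x).symm : E → E) = id := by
      rw [extChartAt_model_space_eq_id]; rfl
    rw [this]; exact mfderiv_id
  change (lam e : E →L[ℝ] ℝ).comp (mfderiv 𝓘(ℝ, E) 𝓘(ℝ, E) (extChartAt 𝓘(ℝ, E) x).symm e
    : E →L[ℝ] E) = _
  rw [h1]; rfl

theorem extChartAt_normedSpace_self (x : E) : extChartAt 𝓘(ℝ, E) x x = x := by
  rw [extChartAt_model_space_eq_id]; rfl

/-- On a normed space the exterior derivative is the antisymmetrized Fréchet derivative. -/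
theorem d_normedSpace (lam : OneForm 𝓘(ℝ, E) E) (x u v : E) :
    lam.d x u v = fderiv ℝ (F := E →L[ℝ] ℝ) lam x u v - fderiv ℝ (F := E →L[ℝ] ℝ) lam x v u := by
  unfold d
  rw [inChart_normedSpace, extChartAt_normedSpace_self]

/-- The local formula behind the naturality of the exterior derivative: the second derivative of
`f` drops out by symmetry. -/
theorem fderiv_comp_fderiv_antisymm {f : E → E'} {om : E' → (E' →L[ℝ] ℝ)} {x : E}
    (hf : ContDiffAt ℝ ∞ f x) (hom : DifferentiableAt ℝ om (f x)) (u v : E) :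
    fderiv ℝ (fun e => (om (f e)).comp (fderiv ℝ f e)) x u v
      - fderiv ℝ (fun e => (om (f e)).comp (fderiv ℝ f e)) x v u
    = fderiv ℝ om (f x) (fderiv ℝ f x u) (fderiv ℝ f x v)
      - fderiv ℝ om (f x) (fderiv ℝ f x v) (fderiv ℝ f x u) := by
  have hfd : DifferentiableAt ℝ f x := hf.differentiableAt (by simp)
  have hf' : DifferentiableAt ℝ (fderiv ℝ f) x :=
    (hf.fderiv_right (m := 1) (by norm_cast)).differentiableAt (by simp)
  have hc : HasFDerivAt (fun e => om (f e)) ((fderiv ℝ om (f x)).comp (fderiv ℝ f x)) x :=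
    hom.hasFDerivAt.comp x hfd.hasFDerivAt
  have h := hc.clm_comp hf'.hasFDerivAt
  have hs : IsSymmSndFDerivAt ℝ f x :=
    (hf.of_le (m := 2) (by norm_cast)).isSymmSndFDerivAt (by simp)
  rw [h.fderiv]
  simp only [add_apply, ContinuousLinearMap.comp_apply,
    ContinuousLinearMap.compL_apply, ContinuousLinearMap.flip_apply]
  rw [hs.eq u v]
  ring

/-- The coordinate expression of a pullback is the pullback of the coordinate expression by the map
read in the preferred charts. -/
theorem inChart_pullback [I.Boundaryless] [J.Boundaryless] [IsManifold I ∞ M] [IsManifold J ∞ N]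
    {f : M → N} {lam : OneForm J N} {x : M} (hf : ContMDiffAt I J ∞ f x) :
    (pullback (I := I) f lam).inChart x =ᶠ[𝓝 (extChartAt I x x)]
      fun e => (lam.inChart (f x) (writtenInExtChartAt I J x f e)).comp
        (fderiv ℝ (writtenInExtChartAt I J x f) e) := by
  have hc : Tendsto (extChartAt I x).symm (𝓝 (extChartAt I x x)) (𝓝 x) := by
    have := (continuousAt_extChartAt_symm (I := I) x).tendsto
    rwa [extChartAt_to_inv] at this
  have h1 : ∀ᶠ y in 𝓝 x, f y ∈ (extChartAt J (f x)).source :=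
    hf.continuousAt.eventually (extChartAt_source_mem_nhds (f x))
  have h2 : ∀ᶠ y in 𝓝 x, MDifferentiableAt I J f y := by
    have h3 := (contMDiffAt_iff_contMDiffAt_nhds (by simp)).1 (hf.of_le (m := 1) (by norm_cast))
    filter_upwards [h3] with y hy using hy.mdifferentiableAt (by simp)
  filter_upwards [(hc.eventually h1).eventually_nhds, hc.eventually h2,
    extChartAt_target_mem_nhds (I := I) x] with e he1 he2 he3
  have hsymm : MDifferentiableAt 𝓘(ℝ, E) I (extChartAt I x).symm e :=
    ((contMDiffOn_extChartAt_symm (n := ∞) x).contMDiffAt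
      ((isOpen_extChartAt_target x).mem_nhds he3)).mdifferentiableAt (by simp)
  have hsrc := he1.self_of_nhds
  have hmem : writtenInExtChartAt I J x f e ∈ (extChartAt J (f x)).target :=
    (extChartAt J (f x)).map_source hsrc
  have hsymm' : MDifferentiableAt 𝓘(ℝ, E') J (extChartAt J (f x)).symm
      (writtenInExtChartAt I J x f e) :=
    ((contMDiffOn_extChartAt_symm (n := ∞) (f x)).contMDiffAt
      ((isOpen_extChartAt_target (f x)).mem_nhds hmem)).mdifferentiableAt (by simp)
  have hφ : MDifferentiableAt J 𝓘(ℝ, E') (extChartAt J (f x)) (f ((extChartAt I x).symm e)) :=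
    (contMDiffAt_extChartAt' (n := ∞) (by simpa using hsrc)).mdifferentiableAt (by simp)
  have hw : MDifferentiableAt 𝓘(ℝ, E) 𝓘(ℝ, E') (writtenInExtChartAt I J x f) e := by
    have h5 := MDifferentiableAt.comp (I := 𝓘(ℝ, E)) (I' := J) (I'' := 𝓘(ℝ, E')) e
      (f := f ∘ (extChartAt I x).symm) (g := extChartAt J (f x)) hφ
      (MDifferentiableAt.comp e he2 hsymm)
    exact h5
  have hcongr : (f ∘ (extChartAt I x).symm) =ᶠ[𝓝 e]
      ((extChartAt J (f x)).symm ∘ writtenInExtChartAt I J x f) := by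
    filter_upwards [he1] with e' he'
    exact ((extChartAt J (f x)).left_inv he').symm
  have e1 : (pullback (I := I) f lam).inChart x e
      = (pullback (I := 𝓘(ℝ, E)) (f ∘ (extChartAt I x).symm) lam e : E →L[ℝ] ℝ) :=
    (pullback_comp lam he2 hsymm).symm
  rw [e1, pullback_congr lam hcongr]
  have e2 : (pullback (I := 𝓘(ℝ, E)) ((extChartAt J (f x)).symm ∘ writtenInExtChartAt I J x f)
      lam e : E →L[ℝ] ℝ) = _ := pullback_comp (f := writtenInExtChartAt I J x f) lam hsymm' hw
  rw [e2]
  change (lam.inChart (f x) (writtenInExtChartAt I J x f e)).comp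
      (mfderiv 𝓘(ℝ, E) 𝓘(ℝ, E') (writtenInExtChartAt I J x f) e : E →L[ℝ] E') = _
  rw [mfderiv_eq_fderiv]
  rfl

theorem contDiffAt_writtenInExtChartAt [I.Boundaryless] {f : M → N} {x : M}
    (hf : ContMDiffAt I J ∞ f x) :
    ContDiffAt ℝ ∞ (writtenInExtChartAt I J x f) (extChartAt I x x) := by
  have h := (contMDiffAt_iff.1 hf).2
  rw [I.range_eq_univ, contDiffWithinAt_univ] at h
  exact h

theorem mfderiv_eq_fderiv_written [I.Boundaryless] {f : M → N} {x : M}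
    (hf : MDifferentiableAt I J f x) :
    (mfderiv I J f x : E →L[ℝ] E') = fderiv ℝ (writtenInExtChartAt I J x f) (extChartAt I x x) := by
  rw [hf.mfderiv, I.range_eq_univ, fderivWithin_univ]

theorem writtenInExtChartAt_self {f : M → N} {x : M} :
    writtenInExtChartAt I J x f (extChartAt I x x) = extChartAt J (f x) (f x) := by
  simp [writtenInExtChartAt]

/-- Naturality of the exterior derivative under pullback. -/
theorem d_pullback [I.Boundaryless] [J.Boundaryless] [IsManifold I ∞ M] [IsManifold J ∞ N]
    {f : M → N} {lam : OneForm J N} {x : M} (hf : ContMDiffAt I J ∞ f x)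
    (hlam : DifferentiableAt ℝ (lam.inChart (f x)) (extChartAt J (f x) (f x)))
    (u v : TangentSpace I x) :
    (pullback (I := I) f lam).d x u v
      = lam.d (f x) (mfderiv I J f x u) (mfderiv I J f x v) := by
  have hm := mfderiv_eq_fderiv_written (hf.mdifferentiableAt (by simp))
  rw [← writtenInExtChartAt_self (I := I) (f := f)] at hlam
  have := fderiv_comp_fderiv_antisymm (contDiffAt_writtenInExtChartAt hf) hlam u v
  unfold d
  rw [(inChart_pullback (lam := lam) hf).fderiv_eq]
  rw [writtenInExtChartAt_self] at this
  refine this.trans ?_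
  rw [← hm]
  rfl

theorem differentiableAt_inChart_pullback [I.Boundaryless] [J.Boundaryless] [IsManifold I ∞ M]
    [IsManifold J ∞ N] {f : M → N} {lam : OneForm J N} {x : M} (hf : ContMDiffAt I J ∞ f x)
    (hlam : DifferentiableAt ℝ (lam.inChart (f x)) (extChartAt J (f x) (f x))) :
    DifferentiableAt ℝ ((pullback (I := I) f lam).inChart x) (extChartAt I x x) := by
  rw [(inChart_pullback (lam := lam) hf).differentiableAt_iff]
  rw [← writtenInExtChartAt_self (I := I) (f := f)] at hlam
  have h1 := contDiffAt_writtenInExtChartAt hf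
  exact (hlam.comp _ (h1.differentiableAt (by simp))).clm_comp
    ((h1.fderiv_right (m := 1) (by norm_cast)).differentiableAt (by simp))

/-- The differential of a function, as a one-form. -/
noncomputable def differential (I : ModelWithCorners ℝ E H) (f : M → ℝ) : OneForm I M :=
  fun x => mfderiv I 𝓘(ℝ, ℝ) f x

theorem differential_eq_pullback (f : M → ℝ) :
    differential I f = pullback (I := I) (J := 𝓘(ℝ, ℝ)) f
      (fun _ => (ContinuousLinearMap.id ℝ ℝ : ℝ →L[ℝ] ℝ)) := rfl

theorem differentiableAt_inChart_const (c : E →L[ℝ] ℝ) (x : E) :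
    DifferentiableAt ℝ (inChart (I := 𝓘(ℝ, E)) (fun _ : E => c) x) (extChartAt 𝓘(ℝ, E) x x) := by
  have h : inChart (I := 𝓘(ℝ, E)) (fun _ : E => c) x = fun _ => c := inChart_normedSpace _ x
  rw [h]
  exact differentiableAt_const c

theorem differentiableAt_inChart_differential [I.Boundaryless] [IsManifold I ∞ M] {f : M → ℝ}
    {x : M} (hf : ContMDiffAt I 𝓘(ℝ, ℝ) ∞ f x) :
    DifferentiableAt ℝ ((differential I f).inChart x) (extChartAt I x x) :=
  differentiableAt_inChart_pullback (lam := fun _ => (ContinuousLinearMap.id ℝ ℝ : ℝ →L[ℝ] ℝ)) hf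
    (differentiableAt_inChart_const _ _)

theorem d_differential [I.Boundaryless] [IsManifold I ∞ M] {f : M → ℝ}
    {x : M} (hf : ContMDiffAt I 𝓘(ℝ, ℝ) ∞ f x) (u v : TangentSpace I x) :
    (differential I f).d x u v = 0 := by
  rw [differential_eq_pullback, d_pullback hf (differentiableAt_inChart_const _ _)]
  refine (d_normedSpace _ _ _ _).trans ?_
  rw [fderiv_fun_const]
  exact sub_zero (0 : ℝ)

theorem inChart_smul (f : M → ℝ) (lam : OneForm I M) (x : M) :
    inChart (fun y => f y • lam y) x = fun e => f ((extChartAt I x).symm e) • lam.inChart x e := by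
  funext e
  exact ContinuousLinearMap.smul_comp _ _ _

/-- The Leibniz rule `d (f • lam) = df ∧ lam + f • d lam`. -/
theorem d_smul [I.Boundaryless] {f : M → ℝ} {lam : OneForm I M} {x : M}
    (hf : MDifferentiableAt I 𝓘(ℝ, ℝ) f x)
    (hlam : DifferentiableAt ℝ (lam.inChart x) (extChartAt I x x)) (u v : TangentSpace I x) :
    d (fun y => f y • lam y) x u v = f x * lam.d x u v
      + differential I f x u * lam.inChart x (extChartAt I x x) v
      - differential I f x v * lam.inChart x (extChartAt I x x) u := by
  have h1 : DifferentiableAt ℝ (fun e => f ((extChartAt I x).symm e)) (extChartAt I x x) := by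
    have := hf.differentiableWithinAt_writtenInExtChartAt
    rw [I.range_eq_univ, differentiableWithinAt_univ] at this
    exact this
  have h2 : (differential I f x : E →L[ℝ] ℝ)
      = fderiv ℝ (fun e => f ((extChartAt I x).symm e)) (extChartAt I x x) :=
    mfderiv_eq_fderiv_written hf
  have key : ∀ (c : ℝ) (T : E →L[ℝ] E →L[ℝ] ℝ) (p l : E →L[ℝ] ℝ) (a b : E),
      (c • T + p.smulRight l) a b - (c • T + p.smulRight l) b a
      = c * (T a b - T b a) + p a * l b - p b * l a := by
    intro c T p l a b
    simp only [add_apply, smul_apply, ContinuousLinearMap.smulRight_apply, smul_eq_mul]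
    ring
  unfold d
  have h3 := (h1.hasFDerivAt.smul hlam.hasFDerivAt).fderiv
  rw [inChart_smul, h2]
  change fderiv ℝ ((fun e => f ((extChartAt I x).symm e)) • lam.inChart x) (extChartAt I x x) u v
    - fderiv ℝ ((fun e => f ((extChartAt I x).symm e)) • lam.inChart x) (extChartAt I x x) v u = _
  rw [h3]
  simp only [extChartAt_to_inv]
  exact key _ _ _ _ u v

/-- At the base point the preferred chart is the identification `TangentSpace I x = E`. -/
theorem mfderiv_extChartAt_symm_self [IsManifold I ∞ M] [I.Boundaryless] (x : M) :
    (mfderiv 𝓘(ℝ, E) I (extChartAt I x).symm (extChartAt I x x) : E →L[ℝ] E)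
      = ContinuousLinearMap.id ℝ E := by
  have hs : MDifferentiableAt 𝓘(ℝ, E) I (extChartAt I x).symm (extChartAt I x x) :=
    ((contMDiffOn_extChartAt_symm (n := ∞) x).contMDiffAt
      (extChartAt_target_mem_nhds x)).mdifferentiableAt (by simp)
  rw [mfderiv_eq_fderiv_written hs]
  have : writtenInExtChartAt 𝓘(ℝ, E) I (extChartAt I x x) (extChartAt I x).symm
      =ᶠ[𝓝 (extChartAt I x x)] id := by
    filter_upwards [extChartAt_target_mem_nhds (I := I) x] with e he
    have h3 : (extChartAt I x).symm (extChartAt I x x) = x := extChartAt_to_inv x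
    simp only [writtenInExtChartAt, h3, extChartAt_model_space_eq_id, PartialEquiv.refl_symm,
      PartialEquiv.refl_coe, Function.comp_id, Function.comp_apply, id]
    exact (extChartAt I x).right_inv he
  refine (this.fderiv_eq).trans fderiv_id

theorem inChart_self [IsManifold I ∞ M] [I.Boundaryless] (lam : OneForm I M) (x : M) :
    lam.inChart x (extChartAt I x x) = (lam x : E →L[ℝ] ℝ) := by
  have h2 := lam.congr_point (extChartAt_to_inv (I := I) x)
  change (lam _ : E →L[ℝ] ℝ).comp (mfderiv 𝓘(ℝ, E) I (extChartAt I x).symm (extChartAt I x x)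
    : E →L[ℝ] E) = _
  rw [mfderiv_extChartAt_symm_self, h2]; rfl

variable [IsManifold I ∞ M] [IsManifold J ∞ N]

theorem Smooth.pullback {f : M → N} {lam : OneForm J N} (hlam : lam.Smooth)
    (hf : ContMDiff I J ∞ f) : (OneForm.pullback (I := I) f lam).Smooth :=
  ContMDiff.comp (I' := J.tangent) hlam (hf.contMDiff_tangentMap (by simp))

theorem Smooth.add {lam mu : OneForm I M} (h1 : lam.Smooth) (h2 : mu.Smooth) :
    (lam + mu).Smooth := ContMDiff.add h1 h2

theorem Smooth.contDiffAt_inChart [FiniteDimensional ℝ E] [I.Boundaryless] {lam : OneForm I M}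
    (hlam : lam.Smooth) (x : M) {e : E} (he : e ∈ (extChartAt I x).target) :
    ContDiffAt ℝ ∞ (lam.inChart x) e := by
  have ho := isOpen_extChartAt_target (I := I) x
  suffices h : ContDiffOn ℝ ∞ (lam.inChart x) (extChartAt I x).target from
    h.contDiffAt (ho.mem_nhds he)
  rw [contDiffOn_clm_apply]
  intro v
  rw [← contMDiffOn_iff_contDiffOn]
  have hu : UniqueMDiffOn 𝓘(ℝ, E) (extChartAt I x).target := ho.uniqueMDiffOn
  have h1 := (contMDiffOn_extChartAt_symm (n := ∞) (I := I) x).contMDiffOn_tangentMapWithin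
    (m := ∞) (by simp) hu
  have h2 : ContMDiff 𝓘(ℝ, E) 𝓘(ℝ, E).tangent ∞
      (fun e => (⟨e, v⟩ : TangentBundle 𝓘(ℝ, E) E)) := by
    intro e
    rw [Bundle.contMDiffAt_totalSpace]
    refine ⟨contMDiffAt_id, ?_⟩
    simpa using contMDiffAt_const
  have h3 := (ContMDiff.comp_contMDiffOn (I' := I.tangent) hlam
    (h1.comp (h2.contMDiffOn (s := (extChartAt I x).target)) (fun e he => he)))
  refine h3.congr ?_
  intro e he
  simp only [Function.comp, tangentMapWithin]
  rw [mfderivWithin_of_isOpen ho he]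
  rfl

theorem Smooth.differentiableAt_inChart [FiniteDimensional ℝ E] [I.Boundaryless]
    {lam : OneForm I M} (hlam : lam.Smooth) (x : M) :
    DifferentiableAt ℝ (lam.inChart x) (extChartAt I x x) :=
  (hlam.contDiffAt_inChart x (mem_extChartAt_target x)).differentiableAt (by simp)

end Calculus

end OneForm

/-! ### Smooth dependence on initial conditions -/

section Nemytskii

open Filter Topology

variable {K : Type*} [TopologicalSpace K] [CompactSpace K]
  {E : Type*} [NormedAddCommGroup E] [NormedSpace ℝ E]
  {F : Type*} [NormedAddCommGroup F] [NormedSpace ℝ F]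

/-- Pointwise application of a continuous family of operators to a continuous family of vectors,
as a bounded linear map into operators between spaces of continuous functions. -/
noncomputable def ContinuousMap.pointwiseApply (K : Type*) [TopologicalSpace K] [CompactSpace K]
    (E : Type*) [NormedAddCommGroup E] [NormedSpace ℝ E]
    (F : Type*) [NormedAddCommGroup F] [NormedSpace ℝ F] :
    C(K, E →L[ℝ] F) →L[ℝ] C(K, E) →L[ℝ] C(K, F) :=
  LinearMap.mkContinuous₂
    (LinearMap.mk₂ ℝ (fun (A : C(K, E →L[ℝ] F)) (h : C(K, E)) =>
        (⟨fun k => A k (h k), by fun_prop⟩ : C(K, F)))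
      (fun A B h => by ext k; rfl) (fun c A h => by ext k; rfl)
      (fun A h h' => by ext k; exact map_add (A k) _ _)
      (fun c A h => by ext k; exact map_smul (A k) _ _)) 1
    (fun A h => by
      rw [one_mul]
      refine (ContinuousMap.norm_le _ (by positivity)).2 fun k => ?_
      exact ((A k).le_opNorm (h k)).trans
        (mul_le_mul (A.norm_coe_le_norm k) (h.norm_coe_le_norm k) (norm_nonneg (h k))
          (norm_nonneg A)))

/-- Postcomposition with a `C^1` map is differentiable on the space of continuous functions. -/
theorem ContinuousMap.hasFDerivAt_comp_left {f : E → F} {f' : E → E →L[ℝ] F}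
    (hf : Continuous f) (hf' : Continuous f') (h : ∀ x, HasFDerivAt f (f' x) x) (g : C(K, E)) :
    HasFDerivAt (fun g : C(K, E) => (ContinuousMap.mk f hf).comp g)
      (ContinuousMap.pointwiseApply K E F ((ContinuousMap.mk f' hf').comp g)) g := by
  rw [hasFDerivAt_iff_isLittleO_nhds_zero, Asymptotics.isLittleO_iff]
  intro c hc
  have hcomp : IsCompact (range g) := isCompact_range g.continuous
  have hu := hcomp.uniformContinuousAt_of_continuousAt f' (fun a _ => hf'.continuousAt)
    (Metric.dist_mem_uniformity hc)
  obtain ⟨δ, hδ, hδ'⟩ := Metric.mem_uniformity_dist.1 hu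
  filter_upwards [Metric.ball_mem_nhds (0 : C(K, E)) hδ] with v hv
  rw [mem_ball_zero_iff] at hv
  refine (ContinuousMap.norm_le _ (by positivity)).2 fun k => ?_
  have hvk : ‖v k‖ < δ := (v.norm_coe_le_norm k).trans_lt hv
  have key := (convex_ball (g k) δ).norm_image_sub_le_of_norm_hasFDerivWithin_le' (f := f)
    (f' := f') (φ := f' (g k)) (C := c) (x := g k) (y := g k + v k)
    (fun x _ => (h x).hasFDerivWithinAt)
    (fun x hx => by
      have := hδ' (a := g k) (b := x) (by rwa [dist_comm]) ⟨k, rfl⟩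
      simp only [dist_eq_norm, mem_ofPred_eq] at this
      rw [norm_sub_rev]; exact this.le)
    (Metric.mem_ball_self hδ) (by simpa [Metric.mem_ball, dist_eq_norm] using hvk)
  rw [add_sub_cancel_left] at key
  exact key.trans (mul_le_mul_of_nonneg_left (v.norm_coe_le_norm k) hc.le)

end Nemytskii

/-- Postcomposition with a `C^n` map is `C^n` on the space of continuous functions. The two normed
spaces share a universe because the induction replaces `F` by `E →L[ℝ] F`. -/
theorem ContinuousMap.contDiff_comp_left {K : Type*} [TopologicalSpace K] [CompactSpace K]
    {E : Type u} [NormedAddCommGroup E] [NormedSpace ℝ E] (n : ℕ) :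
    ∀ {F : Type u} [NormedAddCommGroup F] [NormedSpace ℝ F] {f : E → F} (hf : ContDiff ℝ n f),
      ContDiff ℝ n (fun g : C(K, E) => (ContinuousMap.mk f hf.continuous).comp g) := by
  induction n with
  | zero =>
    intro F _ _ f hf
    exact contDiff_zero.2 (ContinuousMap.continuous_postcomp _)
  | succ n ih =>
    intro F _ _ f hf
    obtain ⟨f', hf', h⟩ := contDiff_succ_iff_hasFDerivAt.1 (by exact_mod_cast hf)
    have hgoal := (contDiff_succ_iff_hasFDerivAt (𝕜 := ℝ) (n := n)
      (f := fun g : C(K, E) => (ContinuousMap.mk f hf.continuous).comp g)).2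
      ⟨fun g => ContinuousMap.pointwiseApply K E F
        ((ContinuousMap.mk f' hf'.continuous).comp g),
        ContDiff.comp (g := ⇑(ContinuousMap.pointwiseApply K E F))
          (ContinuousLinearMap.contDiff _) (ih hf'),
        fun g => ContinuousMap.hasFDerivAt_comp_left hf.continuous hf'.continuous h g⟩
    exact_mod_cast hgoal

section LocalFlow

open Filter Topology

variable {E : Type*} [NormedAddCommGroup E] [NormedSpace ℝ E]

/-- The interval on which trajectories are parametrized, with the time `1` in its interior. -/
abbrev FlowInterval : Type := Icc (-2 : ℝ) 2

/-- The primitive vanishing at time `0`, as a bounded operator on continuous functions. -/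
noncomputable def primitiveCLM (E : Type*) [NormedAddCommGroup E] [NormedSpace ℝ E] :
    C(FlowInterval, E) →L[ℝ] C(FlowInterval, E) :=
  LinearMap.mkContinuous
    { toFun := fun g => ⟨fun s => ∫ τ in (0 : ℝ)..s, g (projIcc (-2) 2 (by norm_num) τ), by
        have h : Continuous fun τ : ℝ => g (projIcc (-2) 2 (by norm_num) τ) :=
          g.continuous.comp continuous_projIcc
        exact (intervalIntegral.continuous_primitive (fun a b => h.intervalIntegrable a b) 0).comp
          continuous_subtype_val⟩
      map_add' := fun g h => by
        ext s
        have hg : Continuous fun τ : ℝ => g (projIcc (-2) 2 (by norm_num) τ) :=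
          g.continuous.comp continuous_projIcc
        have hh : Continuous fun τ : ℝ => h (projIcc (-2) 2 (by norm_num) τ) :=
          h.continuous.comp continuous_projIcc
        exact intervalIntegral.integral_add (hg.intervalIntegrable _ _) (hh.intervalIntegrable _ _)
      map_smul' := fun c g => by
        ext s
        exact intervalIntegral.integral_smul _ _ } 2
    (fun g => by
      refine (ContinuousMap.norm_le _ (by positivity)).2 fun s => ?_
      have h := intervalIntegral.norm_integral_le_of_norm_le_const (a := 0) (b := (s : ℝ))
        (C := ‖g‖) (f := fun τ => g (projIcc (-2) 2 (by norm_num) τ))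
        (fun τ _ => g.norm_coe_le_norm _)
      refine h.trans ?_
      rw [mul_comm]
      gcongr
      rw [sub_zero, abs_le]
      exact s.2)

theorem primitiveCLM_apply (g : C(FlowInterval, E)) (s : FlowInterval) :
    primitiveCLM E g s = ∫ τ in (0 : ℝ)..s, g (projIcc (-2) 2 (by norm_num) τ) := rfl

/-- **Smooth dependence on initial conditions**, local form: for a vector field `f` that is smooth
on a neighbourhood `U` of `x₀`, the trajectories `s ↦ ψ (x, t) s` of `t • f` starting at `x`
exist on `(-2, 2)` for `(x, t)` near `(x₀, 0)`, and the time-one value is `C^n` in `(x, t)`.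
By rescaling of time this value is the flow of `f` at time `t`. The trajectories are found by
applying the implicit function theorem to the integral equation in the space of continuous
functions. -/
theorem exists_contDiffAt_localFlow [FiniteDimensional ℝ E] {f : E → E} {U : Set E} {x₀ : E}
    (hU : IsOpen U) (hx₀ : x₀ ∈ U) (hf : ContDiffOn ℝ ∞ f U) (n : ℕ) :
    ∃ ψ : E × ℝ → ℝ → E, ∀ᶠ p in 𝓝 (x₀, (0 : ℝ)), ContDiffAt ℝ n (fun q => ψ q 1) p ∧
      ψ p 0 = p.1 ∧ ∀ s ∈ Ioo (-2 : ℝ) 2, ψ p s ∈ U ∧ HasDerivAt (ψ p) (p.2 • f (ψ p s)) s := by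
  have : CompleteSpace E := FiniteDimensional.complete ℝ E
  obtain ⟨r, hr, hrU⟩ := Metric.isOpen_iff.1 hU x₀ hx₀
  -- cut off `f` to make it globally smooth
  let χ : ContDiffBump x₀ := ⟨r / 3, r / 2, by positivity, by linarith⟩
  have hf1 : ContDiff ℝ ∞ (fun x => χ x • f x) := by
    rw [contDiff_iff_contDiffAt]
    intro x
    by_cases hx : x ∈ U
    · exact χ.contDiff.contDiffAt.smul (hf.contDiffAt (hU.mem_nhds hx))
    · have h0 : (fun x => χ x • f x) =ᶠ[𝓝 x] fun _ => 0 := by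
        have : x ∉ Metric.closedBall x₀ (r / 2) := fun h => hx (hrU
          (Metric.closedBall_subset_ball (by linarith) h))
        filter_upwards [Metric.isClosed_closedBall.isOpen_compl.mem_nhds this] with y hy
        have : χ y = 0 := χ.zero_of_le_dist (by
          simp only [mem_compl_iff, Metric.mem_closedBall, not_le] at hy; exact hy.le)
        rw [this, zero_smul]
      exact contDiffAt_const.congr_of_eventuallyEq h0
  set f1 : E → E := fun x => χ x • f x with hf1def
  have hf1c : Continuous f1 := hf1.continuous
  let N : C(FlowInterval, E) → C(FlowInterval, E) := fun g => (ContinuousMap.mk f1 hf1c).comp g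
  have hN : ContDiff ℝ ∞ N := contDiff_infty.2 fun k =>
    ContinuousMap.contDiff_comp_left k (hf1.of_le (by exact_mod_cast le_top))
  let c : E →L[ℝ] C(FlowInterval, E) := ContinuousLinearMap.const ℝ FlowInterval
  -- the integral equation `g = x + t ∫ f1 ∘ g` for the unknown trajectory `g`
  let Φ : (E × ℝ) × C(FlowInterval, E) → C(FlowInterval, E) :=
    fun q => q.2 - c q.1.1 - q.1.2 • primitiveCLM E (N q.2)
  have hΦ : ContDiff ℝ ∞ Φ := by
    refine (contDiff_snd.sub (c.contDiff.comp (contDiff_fst.comp contDiff_fst))).sub ?_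
    exact (contDiff_snd.comp contDiff_fst).smul
      ((primitiveCLM E).contDiff.comp (hN.comp contDiff_snd))
  let u : (E × ℝ) × C(FlowInterval, E) := ((x₀, 0), c x₀)
  have hΦu : Φ u = 0 := by simp [Φ, u]
  -- at `t = 0` the equation is `g = x`, so its partial derivative in `g` is the identity
  have hinv : (fderiv ℝ Φ u ∘L .inr ℝ (E × ℝ) C(FlowInterval, E)).IsInvertible := by
    have h1 : HasFDerivAt (fun g => Φ ((x₀, 0), g))
        (fderiv ℝ Φ u ∘L .inr ℝ (E × ℝ) C(FlowInterval, E)) (c x₀) :=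
      (hΦ.differentiable (by simp) u).hasFDerivAt.comp (c x₀) (hasFDerivAt_prodMk_right _ _)
    have h2 : (fun g => Φ ((x₀, 0), g)) = fun g => g - c x₀ := by
      funext g; simp [Φ]
    rw [h2] at h1
    rw [h1.unique ((hasFDerivAt_id _).sub_const _)]
    exact ⟨ContinuousLinearEquiv.refl ℝ _, rfl⟩
  have hcd : ContDiffAt ℝ ∞ Φ u := hΦ.contDiffAt
  let G := hcd.implicitFunction (by simp) hinv
  have hG1 : G (x₀, 0) = c x₀ := hcd.implicitFunction_apply_self (by simp) hinv
  have hG2 : ∀ᶠ p in 𝓝 (x₀, (0 : ℝ)), Φ (p, G p) = 0 := by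
    have := hcd.eventually_apply_implicitFunction (by simp) hinv
    rw [hΦu] at this
    exact this
  have hG3 : ContDiffAt ℝ ∞ G (x₀, 0) := hcd.contDiffAt_implicitFunction (by simp) hinv
  have hG4 : ∀ᶠ p in 𝓝 (x₀, (0 : ℝ)), ContDiffAt ℝ n G p :=
    (hG3.of_le (m := n) (by exact_mod_cast le_top)).eventually (by simp)
  have hG5 : ∀ᶠ p in 𝓝 (x₀, (0 : ℝ)), G p ∈ Metric.ball (c x₀) (r / 3) :=
    hG3.continuousAt.eventually (by
      rw [hG1]; exact Metric.ball_mem_nhds _ (by positivity))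
  let ψ : E × ℝ → ℝ → E := fun p s => G p (projIcc (-2) 2 (by norm_num) s)
  refine ⟨ψ, ?_⟩
  filter_upwards [hG2, hG4, hG5] with p h2 h4 h5
  have hψ : ∀ s ∈ Icc (-2 : ℝ) 2, ψ p s = p.1 + p.2 • ∫ τ in (0 : ℝ)..s, f1 (ψ p τ) := by
    intro s hs
    have h6 := congrArg (fun g : C(FlowInterval, E) => g (projIcc (-2) 2 (by norm_num) s)) h2
    simp only [Φ, ContinuousMap.sub_apply, ContinuousMap.smul_apply, primitiveCLM_apply,
      ContinuousMap.zero_apply, projIcc_of_mem _ hs] at h6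
    have h7 : G p ⟨s, hs⟩ = p.1 + p.2 • ∫ τ in (0 : ℝ)..s, f1 (ψ p τ) := by
      rw [sub_sub, sub_eq_zero] at h6
      exact h6
    simp only [ψ, projIcc_of_mem _ hs]
    exact h7
  have hball : ∀ s, ψ p s ∈ Metric.ball x₀ (r / 3) := by
    intro s
    rw [Metric.mem_ball] at h5 ⊢
    exact (ContinuousMap.dist_apply_le_dist (f := G p) (g := c x₀)
      (projIcc (-2) 2 (by norm_num) s)).trans_lt h5
  refine ⟨?_, ?_, ?_⟩
  · exact (ContinuousMap.evalCLM ℝ (projIcc (-2 : ℝ) 2 (by norm_num) 1)).contDiff.contDiffAt.comp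
      p h4
  · rw [hψ 0 (by norm_num)]; simp
  · intro s hs
    refine ⟨hrU (Metric.ball_subset_ball (by linarith) (hball s)), ?_⟩
    have hcont : Continuous fun τ => f1 (ψ p τ) :=
      hf1c.comp ((G p).continuous.comp continuous_projIcc)
    have hd : HasDerivAt (fun s => p.1 + p.2 • ∫ τ in (0 : ℝ)..s, f1 (ψ p τ))
        (p.2 • f1 (ψ p s)) s :=
      ((hcont.integral_hasStrictDerivAt 0 s).hasDerivAt.const_smul p.2).const_add p.1
    have hfe : f1 (ψ p s) = f (ψ p s) := by
      have : χ (ψ p s) = 1 := χ.one_of_mem_closedBall (Metric.ball_subset_closedBall (hball s))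
      simp only [hf1def, this, one_smul]
    rw [hfe] at hd
    refine hd.congr_of_eventuallyEq ?_
    filter_upwards [Ioo_mem_nhds hs.1 hs.2] with τ hτ using hψ τ (Ioo_subset_Icc_self hτ)

end LocalFlow

/-! ### Flows of vector fields on manifolds -/

section Flow

open Filter Topology

variable {E : Type*} [NormedAddCommGroup E] [NormedSpace ℝ E] [FiniteDimensional ℝ E]
  {H : Type*} [TopologicalSpace H] {I : ModelWithCorners ℝ E H} [I.Boundaryless]
  {M : Type*} [TopologicalSpace M] [ChartedSpace H M] [IsManifold I ∞ M]

/-- A smooth vector field read in the preferred chart at `x₀`. -/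
noncomputable def vectorFieldInChart (X : (x : M) → TangentSpace I x) (x₀ : M) (e : E) : E :=
  mfderiv I 𝓘(ℝ, E) (extChartAt I x₀) ((extChartAt I x₀).symm e) (X ((extChartAt I x₀).symm e))

theorem contDiffOn_vectorFieldInChart {X : (x : M) → TangentSpace I x}
    (hX : ContMDiff I I.tangent ∞ (fun x => (⟨x, X x⟩ : TangentBundle I M))) (x₀ : M) :
    ContDiffOn ℝ ∞ (vectorFieldInChart X x₀) (extChartAt I x₀).target := by
  have ho := isOpen_extChartAt_source (I := I) x₀
  have h1 := (contMDiffOn_extChartAt (n := ∞) (I := I) (x := x₀)).contMDiffOn_tangentMapWithin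
    (m := ∞) (by simp) (by
      have := ho.uniqueMDiffOn (I := I)
      simpa using this)
  have h2 : ContMDiffOn 𝓘(ℝ, E) I.tangent ∞
      (fun e => (⟨(extChartAt I x₀).symm e, X ((extChartAt I x₀).symm e)⟩ : TangentBundle I M))
      (extChartAt I x₀).target := hX.comp_contMDiffOn (contMDiffOn_extChartAt_symm (n := ∞) x₀)
  have h3 := h1.comp h2 (fun e he => by
    have := (extChartAt I x₀).map_target he
    simpa using this)
  have h4 := (contMDiff_snd_tangentBundle_modelSpace (n := ∞) E 𝓘(ℝ, E)).comp_contMDiffOn h3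
  rw [← contMDiffOn_iff_contDiffOn]
  refine h4.congr fun e he => ?_
  have he' := (extChartAt I x₀).map_target he
  simp only [Function.comp, tangentMapWithin, vectorFieldInChart]
  rw [mfderivWithin_of_isOpen (chartAt H x₀).open_source (by simpa using he')]

theorem mfderiv_extChartAt_symm_vectorFieldInChart (X : (x : M) → TangentSpace I x) (x₀ : M) {e : E}
    (he : e ∈ (extChartAt I x₀).target) :
    (mfderiv 𝓘(ℝ, E) I (extChartAt I x₀).symm e : E →L[ℝ] E) (vectorFieldInChart (E := E) X x₀ e)
      = X ((extChartAt I x₀).symm e) := by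
  have h := mfderivWithin_extChartAt_symm_comp_mfderiv_extChartAt (I := I) he
  rw [I.range_eq_univ, mfderivWithin_univ] at h
  exact DFunLike.congr_fun h (X ((extChartAt I x₀).symm e))

/-- The local flow in the form of `exists_contDiffAt_localFlow`: near `(0, x₀)`, the point
`Ψ (t, x) 1` is the value at time `1` of the trajectory of `t • X` starting at `x`, and it is `C^n`
in `(t, x)`. -/
theorem exists_localFlow {X : (x : M) → TangentSpace I x}
    (hX : ContMDiff I I.tangent ∞ (fun x => (⟨x, X x⟩ : TangentBundle I M))) (x₀ : M) (n : ℕ) :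
    ∃ Ψ : ℝ × M → ℝ → M, ∀ᶠ p in 𝓝 ((0 : ℝ), x₀),
      ContMDiffAt (𝓘(ℝ, ℝ).prod I) I n (fun q => Ψ q 1) p ∧ Ψ p 0 = p.2 ∧
      IsMIntegralCurveOn (Ψ p) (p.1 • X) (Ioo (-2) 2) := by
  have ho := isOpen_extChartAt_target (I := I) x₀
  obtain ⟨ψ, hψ⟩ := exists_contDiffAt_localFlow ho (mem_extChartAt_target x₀)
    (contDiffOn_vectorFieldInChart hX x₀) n
  let c : ℝ × M → E × ℝ := fun p => (extChartAt I x₀ p.2, p.1)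
  have hc : Tendsto c (𝓝 ((0 : ℝ), x₀)) (𝓝 (extChartAt I x₀ x₀, 0)) := by
    have : ContinuousAt c ((0 : ℝ), x₀) := by
      refine ContinuousAt.prodMk ?_ continuousAt_fst
      exact (continuousAt_extChartAt (I := I) x₀).comp (f := Prod.snd) continuousAt_snd
    exact this
  have hsrc : ∀ᶠ p : ℝ × M in 𝓝 ((0 : ℝ), x₀), p.2 ∈ (chartAt H x₀).source :=
    continuousAt_snd.eventually ((chartAt H x₀).open_source.mem_nhds (mem_chart_source H x₀))
  refine ⟨fun p s => (extChartAt I x₀).symm (ψ (c p) s), ?_⟩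
  filter_upwards [hc.eventually hψ, hsrc] with p hp hp2
  obtain ⟨hp3, hp4, hp5⟩ := hp
  refine ⟨?_, ?_, ?_⟩
  · have h1 : ContMDiffAt (𝓘(ℝ, ℝ).prod I) 𝓘(ℝ, E × ℝ) n c p := by
      refine ContMDiffAt.prodMk_space ?_ contMDiffAt_fst
      exact ((contMDiffAt_extChartAt' (n := ∞) hp2).of_le (by exact_mod_cast le_top)).comp p
        contMDiffAt_snd
    have h2 : ContMDiffAt 𝓘(ℝ, E) I n (extChartAt I x₀).symm (ψ (c p) 1) :=
      ((contMDiffOn_extChartAt_symm (n := ∞) x₀).contMDiffAt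
        (ho.mem_nhds (hp5 1 (by norm_num)).1)).of_le (by exact_mod_cast le_top)
    exact ContMDiffAt.comp (I' := 𝓘(ℝ, E)) p h2 (hp3.contMDiffAt.comp p h1)
  · simp only [hp4, c]
    exact (extChartAt I x₀).left_inv (by simpa using hp2)
  · intro s hs
    obtain ⟨h1, h2⟩ := hp5 s hs
    have h3 : MDifferentiableAt 𝓘(ℝ, E) I (extChartAt I x₀).symm (ψ (c p) s) :=
      ((contMDiffOn_extChartAt_symm (n := ∞) x₀).contMDiffAt (ho.mem_nhds h1)).mdifferentiableAt
        (by simp)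
    have h4 := HasMFDerivAt.comp s h3.hasMFDerivAt h2.hasFDerivAt.hasMFDerivAt
    have h5 : (mfderiv 𝓘(ℝ, E) I (extChartAt I x₀).symm (ψ (c p) s) : E →L[ℝ] E).comp
        (ContinuousLinearMap.toSpanSingleton ℝ (p.1 • vectorFieldInChart X x₀ (ψ (c p) s)))
        = (1 : ℝ →L[ℝ] ℝ).smulRight ((p.1 • X) ((extChartAt I x₀).symm (ψ (c p) s)) : E) := by
      have key : ∀ (D : E →L[ℝ] E) (v w : E) (a : ℝ), D v = w →
          D.comp (ContinuousLinearMap.toSpanSingleton ℝ (a • v))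
            = (1 : ℝ →L[ℝ] ℝ).smulRight (a • w) := by
        rintro D v w a rfl
        ext
        simp
      exact key _ _ _ p.1 (mfderiv_extChartAt_symm_vectorFieldInChart X x₀ h1)
    have h8 : HasMFDerivAt 𝓘(ℝ, ℝ) I (fun s => (extChartAt I x₀).symm (ψ (c p) s)) s
        ((1 : ℝ →L[ℝ] ℝ).smulRight ((p.1 • X) ((extChartAt I x₀).symm (ψ (c p) s)) : E)) := by
      rw [← h5]; exact h4
    exact h8.hasMFDerivWithinAt

theorem exists_uniform_isMIntegralCurveOn {X : (x : M) → TangentSpace I x}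
    (hX : ContMDiff I I.tangent ∞ (fun x => (⟨x, X x⟩ : TangentBundle I M))) (x₀ : M) :
    ∃ ε > (0 : ℝ), ∀ᶠ x in 𝓝 x₀, ∃ γ : ℝ → M, γ 0 = x ∧ IsMIntegralCurveOn γ X (Ioo (-ε) ε) := by
  obtain ⟨Ψ, hΨ⟩ := exists_localFlow hX x₀ 0
  rw [nhds_prod_eq] at hΨ
  obtain ⟨s, hs, t, ht, hst⟩ := Filter.mem_prod_iff.1 hΨ
  obtain ⟨δ, hδ, hδs⟩ := Metric.mem_nhds_iff.1 hs
  have hε : 0 < δ / 2 := by positivity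
  have hmem : δ / 2 ∈ s := hδs (by
    rw [Metric.mem_ball, Real.dist_eq, sub_zero, abs_of_pos hε]; linarith)
  refine ⟨δ / 2, hε, ?_⟩
  filter_upwards [ht] with x hx
  obtain ⟨-, h0, h1⟩ := hst (mk_mem_prod hmem hx)
  refine ⟨Ψ (δ / 2, x) ∘ (· * (δ / 2)⁻¹), by simpa using h0, ?_⟩
  have h2 := h1.comp_mul (δ / 2)⁻¹
  rw [inv_smul_smul₀ hε.ne'] at h2
  refine h2.mono fun t ht => ?_
  have hlt : |t * (δ / 2)⁻¹| < 1 := by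
    rw [abs_mul, abs_inv, abs_of_pos hε, ← div_eq_mul_inv, div_lt_one hε]
    exact abs_lt.2 ht
  have := abs_lt.1 hlt
  exact ⟨by linarith [this.1], by linarith [this.2]⟩

/-- On a compact set of initial points, integral curves exist for a uniform time. -/
theorem IsCompact.exists_uniform_isMIntegralCurveOn {X : (x : M) → TangentSpace I x}
    (hX : ContMDiff I I.tangent ∞ (fun x => (⟨x, X x⟩ : TangentBundle I M))) {K : Set M}
    (hK : IsCompact K) :
    ∃ ε > (0 : ℝ), ∀ x ∈ K, ∃ γ : ℝ → M, γ 0 = x ∧ IsMIntegralCurveOn γ X (Ioo (-ε) ε) := by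
  refine hK.induction_on (p := fun K => ∃ ε > (0 : ℝ), ∀ x ∈ K, ∃ γ : ℝ → M, γ 0 = x ∧
    IsMIntegralCurveOn γ X (Ioo (-ε) ε)) ⟨1, one_pos, fun x hx => hx.elim⟩ ?_ ?_ ?_
  · rintro s t hst ⟨ε, hε, h⟩
    exact ⟨ε, hε, fun x hx => h x (hst hx)⟩
  · rintro s t ⟨ε, hε, h⟩ ⟨ε', hε', h'⟩
    refine ⟨min ε ε', lt_min hε hε', fun x hx => ?_⟩
    rcases hx with hx | hx
    · obtain ⟨γ, h0, h1⟩ := h x hx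
      exact ⟨γ, h0, h1.mono (Ioo_subset_Ioo (neg_le_neg (min_le_left _ _)) (min_le_left _ _))⟩
    · obtain ⟨γ, h0, h1⟩ := h' x hx
      exact ⟨γ, h0, h1.mono (Ioo_subset_Ioo (neg_le_neg (min_le_right _ _)) (min_le_right _ _))⟩
  · intro x _
    obtain ⟨ε, hε, h⟩ := _root_.exists_uniform_isMIntegralCurveOn hX x
    exact ⟨_, mem_nhdsWithin_of_mem_nhds h, ε, hε, fun y hy => hy⟩

variable [T2Space M]

/-- `φ` is a smooth global flow on `M` generated by the vector field `X`. -/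
structure IsSmoothFlow (X : (x : M) → TangentSpace I x) (φ : ℝ → M → M) : Prop where
  contMDiff : ContMDiff (𝓘(ℝ, ℝ).prod I) I ∞ (fun p : ℝ × M => φ p.1 p.2)
  zero : ∀ x, φ 0 x = x
  add : ∀ s t x, φ (s + t) x = φ s (φ t x)
  isMIntegralCurve : ∀ x, IsMIntegralCurve (fun t => φ t x) X

/-- A smooth vector field whose integral curves exist for a uniform time generates a smooth
global flow. -/
theorem exists_isSmoothFlow {X : (x : M) → TangentSpace I x}
    (hX : ContMDiff I I.tangent ∞ (fun x => (⟨x, X x⟩ : TangentBundle I M))) {ε : ℝ} (hε : 0 < ε)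
    (h : ∀ x : M, ∃ γ : ℝ → M, γ 0 = x ∧ IsMIntegralCurveOn γ X (Ioo (-ε) ε)) :
    ∃ φ : ℝ → M → M, IsSmoothFlow X φ := by
  have hX1 : ContMDiff I I.tangent 1 (fun x => (⟨x, X x⟩ : TangentBundle I M)) :=
    hX.of_le (by simp)
  choose γ hγ0 hγ using fun x => exists_isMIntegralCurve_of_isMIntegralCurveOn hX1 hε h x
  have hadd : ∀ s t x, γ x (s + t) = γ (γ x t) s := by
    intro s t x
    have h1 := (hγ x).comp_add t
    have h2 := isMIntegralCurve_Ioo_eq_of_contMDiff_boundaryless (t₀ := 0) hX1 h1 (hγ (γ x t))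
      (by simp [hγ0])
    exact congrFun h2 s
  refine ⟨fun t x => γ x t, ?_, hγ0, hadd, hγ⟩
  rw [← contMDiffOn_univ, contMDiffOn_infty]
  intro n
  rw [contMDiffOn_univ]
  -- near time zero the flow is the smooth local flow
  have hloc : ∀ y : M, ∀ᶠ p in 𝓝 ((0 : ℝ), y),
      ContMDiffAt (𝓘(ℝ, ℝ).prod I) I n (fun q : ℝ × M => γ q.2 q.1) p := by
    intro y
    obtain ⟨Ψ, hΨ⟩ := exists_localFlow hX y n
    filter_upwards [hΨ.eventually_nhds] with p hp
    have heq : (fun q : ℝ × M => γ q.2 q.1) =ᶠ[𝓝 p] fun q => Ψ q 1 := by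
      filter_upwards [hp] with q hq
      obtain ⟨-, hq0, hq1⟩ := hq
      have h1 := (hγ q.2).comp_mul q.1
      have hXq : ContMDiff I I.tangent 1
          (fun x => (⟨x, (q.1 • X) x⟩ : TangentBundle I M)) :=
        ContMDiff.const_smul_section (s := X) hX1
      have h2 := isMIntegralCurveOn_Ioo_eqOn_of_contMDiff_boundaryless (t₀ := 0)
        (a := -2) (b := 2) (by norm_num) hXq (h1.isMIntegralCurveOn _) hq1
        (by simp [hγ0, hq0])
      have h3 := h2 (show (1 : ℝ) ∈ Ioo (-2) 2 by norm_num)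
      simpa using h3
    exact hp.self_of_nhds.1.congr_of_eventuallyEq heq
  intro p
  obtain ⟨t₀, x₀⟩ := p
  -- the set of times `t` such that the flow is smooth at `(t, x₀)` is open and closed
  let S : Set ℝ := {t | ContMDiffAt (𝓘(ℝ, ℝ).prod I) I n (fun q : ℝ × M => γ q.2 q.1) (t, x₀)}
  have hcurve : Continuous (γ x₀) := (hγ x₀).continuous
  -- around every time, smoothness at one time propagates to all nearby times
  have hprop : ∀ s, ∃ δ > (0 : ℝ), ∀ s₁ s₂, |s₁ - s| < δ → |s₂ - s| < δ → s₁ ∈ S → s₂ ∈ S := by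
    intro s
    have h1 := hloc (γ x₀ s)
    have h2 : ContinuousAt (fun q : ℝ × ℝ => (q.2 - q.1, γ x₀ q.1)) (s, s) := by fun_prop
    have h3 := h2.eventually (show ∀ᶠ p in 𝓝 (s - s, γ x₀ s),
      ContMDiffAt (𝓘(ℝ, ℝ).prod I) I n (fun q : ℝ × M => γ q.2 q.1) p by rwa [sub_self])
    obtain ⟨δ, hδ, hball⟩ := Metric.eventually_nhds_iff_ball.1 h3
    refine ⟨δ, hδ, fun s₁ s₂ hs₁ hs₂ hS => ?_⟩
    have h4 := hball (s₁, s₂) (by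
      rw [Metric.mem_ball, Prod.dist_eq, Real.dist_eq, Real.dist_eq]
      exact max_lt hs₁ hs₂)
    have h5 : ContMDiffAt (𝓘(ℝ, ℝ).prod I) I n (fun q : ℝ × M => γ q.2 s₁) (s₂, x₀) := by
      have h6 : ContMDiffAt (𝓘(ℝ, ℝ).prod I) (𝓘(ℝ, ℝ).prod I) n
          (fun q : ℝ × M => (s₁, q.2)) (s₂, x₀) := contMDiffAt_const.prodMk contMDiffAt_snd
      exact ContMDiffAt.comp (s₂, x₀) (g := fun q : ℝ × M => γ q.2 q.1)
        (f := fun q : ℝ × M => (s₁, q.2)) hS h6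
    have h7 : ContMDiffAt (𝓘(ℝ, ℝ).prod I) (𝓘(ℝ, ℝ).prod I) n
        (fun q : ℝ × M => (q.1 - s₁, γ q.2 s₁)) (s₂, x₀) := by
      refine ContMDiffAt.prodMk ?_ h5
      have h8 : ContMDiff 𝓘(ℝ, ℝ) 𝓘(ℝ, ℝ) n (fun t : ℝ => t - s₁) :=
        (contDiff_id.sub contDiff_const).contMDiff
      exact h8.contMDiffAt.comp (s₂, x₀) contMDiffAt_fst
    have h9 := ContMDiffAt.comp (s₂, x₀) (g := fun q : ℝ × M => γ q.2 q.1) h4 h7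
    refine h9.congr_of_eventuallyEq (Eventually.of_forall fun q => ?_)
    simp only [Function.comp, ← hadd, sub_add_cancel]
  have hopen : IsOpen S := by
    rw [Metric.isOpen_iff]
    intro s hs
    obtain ⟨δ, hδ, hp⟩ := hprop s
    exact ⟨δ, hδ, fun s₂ hs₂ => hp s s₂ (by simpa using hδ) (by simpa [Real.dist_eq] using hs₂) hs⟩
  have hclosed : IsClosed S := by
    rw [← closure_subset_iff_isClosed]
    intro s hs
    obtain ⟨δ, hδ, hp⟩ := hprop s
    obtain ⟨s₁, hs₁, hd⟩ := Metric.mem_closure_iff.1 hs δ hδ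
    exact hp s₁ s (by rwa [dist_comm, Real.dist_eq] at hd) (by simpa using hδ) hs₁
  have h0 : (0 : ℝ) ∈ S := (hloc x₀).self_of_nhds
  have huniv : S = univ := IsClopen.eq_univ ⟨hclosed, hopen⟩ ⟨0, h0⟩
  have hmem : t₀ ∈ S := by rw [huniv]; trivial
  exact hmem

end Flow

/-! ### Vector fields dual to a one-form -/

namespace OneForm

section DualVectorField

open Filter Topology

variable {E : Type*} [NormedAddCommGroup E] [NormedSpace ℝ E] [FiniteDimensional ℝ E]
  {H : Type*} [TopologicalSpace H] {I : ModelWithCorners ℝ E H} [I.Boundaryless]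
  {M : Type*} [TopologicalSpace M] [ChartedSpace H M] [IsManifold I ∞ M]

theorem contMDiffAt_extChartAt_symm_of_mem (x₀ : M) {e : E} (he : e ∈ (extChartAt I x₀).target) :
    ContMDiffAt 𝓘(ℝ, E) I ∞ (extChartAt I x₀).symm e :=
  (contMDiffOn_extChartAt_symm (n := ∞) x₀).contMDiffAt
    ((isOpen_extChartAt_target x₀).mem_nhds he)

/-- The exterior derivative computed in an arbitrary preferred chart. -/
theorem d_extChartAt_symm {lam : OneForm I M} (hlam : lam.Smooth) (x₀ : M) {e : E}
    (he : e ∈ (extChartAt I x₀).target) (u v : E) :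
    fderiv ℝ (lam.inChart x₀) e u v - fderiv ℝ (lam.inChart x₀) e v u
      = lam.d ((extChartAt I x₀).symm e)
        ((mfderiv 𝓘(ℝ, E) I (extChartAt I x₀).symm e : E →L[ℝ] E) u)
        ((mfderiv 𝓘(ℝ, E) I (extChartAt I x₀).symm e : E →L[ℝ] E) v) := by
  have h := d_pullback (contMDiffAt_extChartAt_symm_of_mem x₀ he)
    (hlam.differentiableAt_inChart _) u v
  rw [d_normedSpace] at h
  exact h

theorem exists_equiv_mfderiv_extChartAt_symm (x₀ : M) {e : E}
    (he : e ∈ (extChartAt I x₀).target) :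
    ∃ L : E ≃L[ℝ] E,
      (mfderiv 𝓘(ℝ, E) I (extChartAt I x₀).symm e : E →L[ℝ] E) = (L : E →L[ℝ] E) := by
  have h := isInvertible_mfderivWithin_extChartAt_symm (I := I) he
  rw [I.range_eq_univ, mfderivWithin_univ] at h
  obtain ⟨L, hL⟩ := h
  exact ⟨(L : E ≃L[ℝ] E), hL.symm⟩

/-- The bilinear form `d lam + ε lam ⊗ lam` in the preferred chart at `x₀`. -/
noncomputable def chartForm (lam : OneForm I M) (ε : ℝ) (x₀ : M) (e : E) : E →L[ℝ] E →L[ℝ] ℝ :=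
  fderiv ℝ (lam.inChart x₀) e - (fderiv ℝ (lam.inChart x₀) e).flip
    + ε • (lam.inChart x₀ e).smulRight (lam.inChart x₀ e)

theorem chartForm_apply {lam : OneForm I M} (hlam : lam.Smooth) (ε : ℝ) (x₀ : M) {e : E}
    (he : e ∈ (extChartAt I x₀).target) (u v : E) :
    lam.chartForm ε x₀ e u v
      = lam.d ((extChartAt I x₀).symm e)
        ((mfderiv 𝓘(ℝ, E) I (extChartAt I x₀).symm e : E →L[ℝ] E) u)
        ((mfderiv 𝓘(ℝ, E) I (extChartAt I x₀).symm e : E →L[ℝ] E) v)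
      + ε * (lam.inChart x₀ e u * lam.inChart x₀ e v) := by
  rw [← d_extChartAt_symm hlam x₀ he]
  simp [chartForm]

theorem contDiffOn_chartForm {lam : OneForm I M} (hlam : lam.Smooth) (ε : ℝ) (x₀ : M) :
    ContDiffOn ℝ ∞ (lam.chartForm ε x₀) (extChartAt I x₀).target := by
  rw [contDiffOn_clm_apply]
  intro u
  rw [contDiffOn_clm_apply]
  intro v e he
  have h1 := hlam.contDiffAt_inChart x₀ he
  have h2 : ContDiffAt ℝ ∞ (fderiv ℝ (lam.inChart x₀)) e := h1.fderiv_right (by simp)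
  have h3 : ∀ a b : E, ContDiffAt ℝ ∞ (fun e => fderiv ℝ (lam.inChart x₀) e a b) e := fun a b =>
    (h2.clm_apply contDiffAt_const).clm_apply contDiffAt_const
  have h4 : ∀ a : E, ContDiffAt ℝ ∞ (fun e => lam.inChart x₀ e a) e := fun a =>
    h1.clm_apply contDiffAt_const
  have h5 := ((h3 u v).sub (h3 v u)).add (contDiffAt_const (c := ε).mul ((h4 u).mul (h4 v)))
  refine (h5.congr_of_eventuallyEq (Eventually.of_forall fun e' => ?_)).contDiffWithinAt
  simp [chartForm]

/-- If the bilinear form `d lam + ε lam ⊗ lam` is nondegenerate, the vector field dual to `lam`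
with respect to it is smooth. For `ε = 0` this is the Liouville vector field, for `ε = 1` the Reeb
vector field. -/
theorem exists_dualVectorField {lam : OneForm I M} (hlam : lam.Smooth) (ε : ℝ)
    (hinj : ∀ (x : M) (u : TangentSpace I x),
      (∀ v : TangentSpace I x, lam.d x u v + ε * (lam x u * lam x v) = 0) → u = 0) :
    ∃ X : (x : M) → TangentSpace I x,
      ContMDiff I I.tangent ∞ (fun x => (⟨x, X x⟩ : TangentBundle I M)) ∧
      ∀ (x : M) (v : TangentSpace I x),
        lam.d x (X x) v + ε * (lam x (X x) * lam x v) = lam x v := by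
  -- the solution of the linear equation in a chart
  let Y : M → E → E := fun x₀ e => (lam.chartForm ε x₀ e).inverse (lam.inChart x₀ e)
  let D : M → E → E →L[ℝ] E := fun x₀ e => mfderiv 𝓘(ℝ, E) I (extChartAt I x₀).symm e
  have hinv : ∀ x₀, ∀ e ∈ (extChartAt I x₀).target,
      ∃ T : E ≃L[ℝ] (E →L[ℝ] ℝ), (T : E →L[ℝ] (E →L[ℝ] ℝ)) = lam.chartForm ε x₀ e := by
    intro x₀ e he
    obtain ⟨L, hL⟩ := exists_equiv_mfderiv_extChartAt_symm (I := I) x₀ he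
    have hi : Function.Injective (lam.chartForm ε x₀ e) := by
      rw [injective_iff_map_eq_zero]
      intro u hu
      have h1 : D x₀ e u = 0 := by
        refine hinj ((extChartAt I x₀).symm e) _ fun w => ?_
        have h2 := DFunLike.congr_fun hu (L.symm w)
        rw [chartForm_apply hlam ε x₀ he] at h2
        have h3 : D x₀ e (L.symm w) = w := by
          have : (D x₀ e) = (L : E →L[ℝ] E) := hL
          rw [this]; exact L.apply_symm_apply w
        change lam.d _ (D x₀ e u) (D x₀ e (L.symm w))
          + ε * (lam _ (D x₀ e u) * lam _ (D x₀ e (L.symm w))) = 0 at h2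
        rw [h3] at h2
        exact h2
      have h4 : L u = 0 := by
        have : (D x₀ e) = (L : E →L[ℝ] E) := hL
        rw [this] at h1; exact h1
      exact (map_eq_zero_iff L L.injective).1 h4
    have hdim : Module.finrank ℝ E = Module.finrank ℝ (E →L[ℝ] ℝ) := by
      rw [← (LinearMap.toContinuousLinearMap (𝕜 := ℝ) (E := E) (F' := ℝ)).finrank_eq]
      exact (Subspace.dual_finrank_eq (K := ℝ) (V := E)).symm
    exact ⟨(LinearEquiv.ofInjectiveOfFinrankEq _ hi hdim).toContinuousLinearEquiv, by ext; rfl⟩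
  have hY : ∀ x₀, ∀ e ∈ (extChartAt I x₀).target, ∀ v : TangentSpace I ((extChartAt I x₀).symm e),
      lam.d ((extChartAt I x₀).symm e) (D x₀ e (Y x₀ e)) v
        + ε * (lam ((extChartAt I x₀).symm e) (D x₀ e (Y x₀ e)) * lam ((extChartAt I x₀).symm e) v)
        = lam ((extChartAt I x₀).symm e) v := by
    intro x₀ e he v
    obtain ⟨L, hL⟩ := exists_equiv_mfderiv_extChartAt_symm (I := I) x₀ he
    obtain ⟨T, hT⟩ := hinv x₀ e he
    have hv : D x₀ e (L.symm v) = v := by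
      have : (D x₀ e) = (L : E →L[ℝ] E) := hL
      rw [this]; exact L.apply_symm_apply v
    have h1 : lam.chartForm ε x₀ e (Y x₀ e) = lam.inChart x₀ e := by
      simp only [Y]
      rw [← hT, ContinuousLinearMap.inverse_equiv]
      exact T.apply_symm_apply _
    have h2 := DFunLike.congr_fun h1 (L.symm (v : E))
    rw [chartForm_apply hlam ε x₀ he] at h2
    change lam.d _ (D x₀ e (Y x₀ e)) (D x₀ e (L.symm v))
      + ε * (lam _ (D x₀ e (Y x₀ e)) * lam _ (D x₀ e (L.symm v)))
        = lam _ (D x₀ e (L.symm v)) at h2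
    rw [hv] at h2
    exact h2
  have hex : ∀ x : M, ∃ w : TangentSpace I x, ∀ v : TangentSpace I x,
      lam.d x w v + ε * (lam x w * lam x v) = lam x v := by
    intro x
    have h := hY x (extChartAt I x x) (mem_extChartAt_target x)
    rw [extChartAt_to_inv] at h
    exact ⟨_, h⟩
  have huniq : ∀ (x : M) (w w' : TangentSpace I x),
      (∀ v, lam.d x w v + ε * (lam x w * lam x v) = lam x v) →
      (∀ v, lam.d x w' v + ε * (lam x w' * lam x v) = lam x v) → w = w' := by
    intro x w w' h h'
    have h1 : w + (-1 : ℝ) • w' = 0 := by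
      refine hinj x _ fun v => ?_
      rw [d_add_left, d_smul_left, map_add, map_smul, smul_eq_mul]
      linear_combination h v - h' v
    have h2 : w = w' := by
      rw [neg_one_smul, ← sub_eq_add_neg, sub_eq_zero] at h1
      exact h1
    exact h2
  choose X hX using hex
  refine ⟨X, ?_, hX⟩
  intro x₀
  have ho := isOpen_extChartAt_target (I := I) x₀
  have hYs : ContDiffOn ℝ ∞ (Y x₀) (extChartAt I x₀).target := by
    intro e he
    obtain ⟨T, hT⟩ := hinv x₀ e he
    have h1 : ContDiffAt ℝ ∞ (lam.chartForm ε x₀) e :=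
      (contDiffOn_chartForm hlam ε x₀).contDiffAt (ho.mem_nhds he)
    have h2 : ContDiffAt ℝ ∞ ContinuousLinearMap.inverse (lam.chartForm ε x₀ e) := by
      rw [← hT]
      exact contDiffAt_map_inverse T
    exact ((h2.comp e h1).clm_apply (hlam.contDiffAt_inChart x₀ he)).contDiffWithinAt
  have h1 := (contMDiffOn_extChartAt_symm (n := ∞) (I := I) x₀).contMDiffOn_tangentMapWithin
    (m := ∞) (by simp) ho.uniqueMDiffOn
  have h2 : ContMDiffOn 𝓘(ℝ, E) 𝓘(ℝ, E).tangent ∞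
      (fun e => (⟨e, Y x₀ e⟩ : TangentBundle 𝓘(ℝ, E) E)) (extChartAt I x₀).target := by
    intro e he
    exact contMDiffWithinAt_vectorSpace_iff_contDiffWithinAt.2 (hYs e he)
  have h3 := h1.comp h2 (fun e he => he)
  have h4 : ContMDiffOn 𝓘(ℝ, E) I.tangent ∞
      (fun e => (⟨(extChartAt I x₀).symm e, X ((extChartAt I x₀).symm e)⟩ : TangentBundle I M))
      (extChartAt I x₀).target := by
    refine h3.congr fun e he => ?_
    simp only [Function.comp, tangentMapWithin]
    rw [mfderivWithin_of_isOpen ho he]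
    congr 1
    exact huniq _ _ _ (hX _) (hY x₀ e he)
  have h5 := (h4.contMDiffAt (extChartAt_target_mem_nhds (I := I) x₀)).comp x₀
    (contMDiffAt_extChartAt (n := ∞) (I := I) (x := x₀))
  refine h5.congr_of_eventuallyEq ?_
  filter_upwards [extChartAt_source_mem_nhds (I := I) x₀] with x hx
  simp only [Function.comp]
  rw [(extChartAt I x₀).left_inv hx]

variable [T2Space M]

/-- A flow whose generator `X` satisfies `d lam (X, ·) = c lam` and `lam X = const` rescales `lam`
exponentially with rate `c`. -/
theorem isSmoothFlow_pullback {lam : OneForm I M} (hlam : lam.Smooth)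
    {X : (x : M) → TangentSpace I x} {φ : ℝ → M → M} (hφ : IsSmoothFlow X φ) {c k : ℝ}
    (hk : ∀ x, lam x (X x) = k)
    (hc : ∀ (x : M) (v : TangentSpace I x), lam.d x (X x) v = c * lam x v)
    (t : ℝ) (x : M) (v : TangentSpace I x) :
    lam (φ t x) (mfderiv I I (φ t) x v) = Real.exp (c * t) * lam x v := by
  -- In the coordinates `F (t, ε) = φ_t (γ ε)`, with `γ` a curve of velocity `v`, the function
  -- `Q t = (F^* lam)_(t, 0) (∂_ε)` satisfies `Q' = d (F^* lam) (∂_t, ∂_ε) = c Q`, because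
  -- `(F^* lam) (∂_t) = k` is constant.
  let v' : E := v
  have ho := isOpen_extChartAt_target (I := I) x
  let γ : ℝ → E := fun ε => extChartAt I x x + ε • v'
  have hγ : ContDiff ℝ ∞ γ := by fun_prop
  let U : Set ℝ := γ ⁻¹' (extChartAt I x).target
  have hU : IsOpen U := ho.preimage hγ.continuous
  have h0U : (0 : ℝ) ∈ U := by simp [U, γ]
  let F : ℝ × ℝ → M := fun p => φ p.1 ((extChartAt I x).symm (γ p.2))
  have hφt : ∀ t, ContMDiff I I ∞ (φ t) := fun t =>
    hφ.contMDiff.comp (contMDiff_const.prodMk contMDiff_id)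
  have hσ : ∀ ε ∈ U, ContMDiffAt 𝓘(ℝ, ℝ) I ∞ (fun ε => (extChartAt I x).symm (γ ε)) ε :=
    fun ε hε => (contMDiffAt_extChartAt_symm_of_mem x hε).comp ε hγ.contMDiff.contMDiffAt
  have hF : ∀ p : ℝ × ℝ, p.2 ∈ U → ContMDiffAt 𝓘(ℝ, ℝ × ℝ) I ∞ F p := by
    intro p hp
    have h1 : ContMDiffAt 𝓘(ℝ, ℝ × ℝ) (𝓘(ℝ, ℝ).prod I) ∞
        (fun p : ℝ × ℝ => (p.1, (extChartAt I x).symm (γ p.2))) p :=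
      ContMDiffAt.prodMk contDiff_fst.contMDiff.contMDiffAt
        (ContMDiffAt.comp (I' := 𝓘(ℝ, ℝ)) (f := Prod.snd) p (hσ p.2 hp)
        contDiff_snd.contMDiff.contMDiffAt)
    exact hφ.contMDiff.contMDiffAt.comp p h1
  let μ : OneForm 𝓘(ℝ, ℝ × ℝ) (ℝ × ℝ) := pullback F lam
  have hμd : ∀ p : ℝ × ℝ, p.2 ∈ U → DifferentiableAt ℝ (F := ℝ × ℝ →L[ℝ] ℝ) μ p := by
    intro p hp
    have h := differentiableAt_inChart_pullback (hF p hp) (hlam.differentiableAt_inChart (F p))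
    rw [inChart_normedSpace, extChartAt_normedSpace_self] at h
    exact h
  -- the partial derivatives of `F`
  have hF1 : ∀ p : ℝ × ℝ, p.2 ∈ U →
      (mfderiv 𝓘(ℝ, ℝ × ℝ) I F p : ℝ × ℝ →L[ℝ] E) (1, 0) = X (F p) := by
    intro p hp
    have h1 : HasMFDerivAt 𝓘(ℝ, ℝ) 𝓘(ℝ, ℝ × ℝ) (fun t : ℝ => (t, p.2)) p.1
        (ContinuousLinearMap.inl ℝ ℝ ℝ) := (hasFDerivAt_prodMk_left p.1 p.2).hasMFDerivAt
    have h2 := HasMFDerivAt.comp p.1 (g := F)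
      ((hF p hp).mdifferentiableAt (by simp)).hasMFDerivAt h1
    have h3 := hasMFDerivAt_unique h2 (hφ.isMIntegralCurve ((extChartAt I x).symm (γ p.2)) p.1)
    have h4 := DFunLike.congr_fun h3 (1 : ℝ)
    refine Eq.trans ?_ (h4.trans ?_)
    · rfl
    · exact one_smul ℝ (X (F p) : E)
  have hF2 : ∀ t : ℝ, (mfderiv 𝓘(ℝ, ℝ × ℝ) I F (t, 0) : ℝ × ℝ →L[ℝ] E) (0, 1)
      = mfderiv I I (φ t) x v := by
    intro t
    have h1 : HasMFDerivAt 𝓘(ℝ, ℝ) 𝓘(ℝ, ℝ × ℝ) (fun ε : ℝ => (t, ε)) 0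
        (ContinuousLinearMap.inr ℝ ℝ ℝ) := (hasFDerivAt_prodMk_right t (0 : ℝ)).hasMFDerivAt
    have h2 := HasMFDerivAt.comp (0 : ℝ) (g := F)
      ((hF (t, 0) h0U).mdifferentiableAt (by simp)).hasMFDerivAt h1
    have hγ0 : γ 0 = extChartAt I x x := by simp [γ]
    have hx0 : (extChartAt I x).symm (γ 0) = x := by rw [hγ0, extChartAt_to_inv]
    have h3 : HasMFDerivAt 𝓘(ℝ, ℝ) 𝓘(ℝ, E) γ 0 (ContinuousLinearMap.toSpanSingleton ℝ v') := by
      have h5 : HasDerivAt γ v' 0 := by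
        have := ((hasDerivAt_id (0 : ℝ)).smul_const v').const_add (extChartAt I x x)
        simpa [γ] using this
      exact h5.hasFDerivAt.hasMFDerivAt
    have h4 : HasMFDerivAt 𝓘(ℝ, E) I (extChartAt I x).symm (γ 0) (ContinuousLinearMap.id ℝ E) := by
      have h5 := ((contMDiffAt_extChartAt_symm_of_mem (I := I) x
        (mem_extChartAt_target x)).mdifferentiableAt (by simp)).hasMFDerivAt
      have h6 := mfderiv_extChartAt_symm_self (I := I) x
      rw [hγ0, ← h6]
      exact h5
    have h5 := HasMFDerivAt.comp (0 : ℝ) h4 h3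
    have h6 : HasMFDerivAt I I (φ t) ((extChartAt I x).symm (γ 0))
        (mfderiv I I (φ t) x : E →L[ℝ] E) := by
      rw [hx0]
      exact ((hφt t).contMDiffAt.mdifferentiableAt (by simp)).hasMFDerivAt
    have h7 := HasMFDerivAt.comp (0 : ℝ) h6 h5
    have h8 := hasMFDerivAt_unique h2 h7
    have h9 := DFunLike.congr_fun h8 (1 : ℝ)
    refine Eq.trans ?_ (h9.trans ?_)
    · rfl
    · exact congrArg (mfderiv I I (φ t) x : E →L[ℝ] E) (one_smul ℝ v')
  have hμ1 : ∀ p : ℝ × ℝ, p.2 ∈ U → (μ p : ℝ × ℝ →L[ℝ] ℝ) (1, 0) = k := by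
    intro p hp
    have h1 : (μ p : ℝ × ℝ →L[ℝ] ℝ) (1, 0) = (lam (F p) : E →L[ℝ] ℝ)
        ((mfderiv 𝓘(ℝ, ℝ × ℝ) I F p : ℝ × ℝ →L[ℝ] E) (1, 0)) := rfl
    rw [h1, hF1 p hp]
    exact hk _
  let Q : ℝ → ℝ := fun t => (μ (t, 0) : ℝ × ℝ →L[ℝ] ℝ) (0, 1)
  have hQ : ∀ t, Q t = lam (φ t x) (mfderiv I I (φ t) x v) := by
    intro t
    have h1 : Q t = (lam (F (t, 0)) : E →L[ℝ] ℝ)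
        ((mfderiv 𝓘(ℝ, ℝ × ℝ) I F (t, 0) : ℝ × ℝ →L[ℝ] E) (0, 1)) := rfl
    have h2 : F (t, 0) = φ t x := by simp [F, γ]
    rw [h1, hF2 t, lam.congr_point h2]
    rfl
  have hQd : ∀ t, HasDerivAt Q (c * Q t) t := by
    intro t
    have h1 : HasFDerivAt (F := ℝ × ℝ →L[ℝ] ℝ) μ
        (fderiv ℝ (F := ℝ × ℝ →L[ℝ] ℝ) μ (t, 0)) (t, 0) := (hμd (t, 0) h0U).hasFDerivAt
    have h2 : HasDerivAt Q (fderiv ℝ (F := ℝ × ℝ →L[ℝ] ℝ) μ (t, 0) (1, 0) (0, 1)) t := by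
      have h3 : HasDerivAt (fun s : ℝ => (s, (0 : ℝ))) ((1 : ℝ), (0 : ℝ)) t :=
        (hasDerivAt_id t).prodMk (hasDerivAt_const t 0)
      have h4 := h1.comp_hasDerivAt t h3
      have h5 := h4.clm_apply (hasDerivAt_const t ((0 : ℝ), (1 : ℝ)))
      exact h5.congr_deriv (by rw [map_zero, add_zero])
    have h3 : fderiv ℝ (F := ℝ × ℝ →L[ℝ] ℝ) μ (t, 0) (0, 1) (1, 0) = 0 := by
      have h4 : HasDerivAt (fun s : ℝ => (t, s)) ((0 : ℝ), (1 : ℝ)) 0 :=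
        (hasDerivAt_const 0 t).prodMk (hasDerivAt_id 0)
      have h5 := (h1.comp_hasDerivAt (0 : ℝ) h4).clm_apply
        (hasDerivAt_const 0 ((1 : ℝ), (0 : ℝ)))
      have h6 : HasDerivAt (fun s : ℝ => (μ (t, s) : ℝ × ℝ →L[ℝ] ℝ) (1, 0)) 0 0 := by
        refine (hasDerivAt_const (0 : ℝ) k).congr_of_eventuallyEq ?_
        filter_upwards [hU.mem_nhds h0U] with s hs using hμ1 (t, s) hs
      have h7 := h5.unique h6
      rwa [map_zero, add_zero] at h7
    have h4 : μ.d (t, 0) ((1, 0) : ℝ × ℝ) ((0, 1) : ℝ × ℝ) = c * Q t := by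
      refine (d_pullback (hF (t, 0) h0U) (hlam.differentiableAt_inChart _) _ _).trans ?_
      have h5 := hF1 (t, 0) h0U
      have h6 := hc (F (t, 0)) ((mfderiv 𝓘(ℝ, ℝ × ℝ) I F (t, 0) : ℝ × ℝ →L[ℝ] E) (0, 1))
      rw [← h5] at h6
      exact h6
    rw [d_normedSpace, h3, sub_zero] at h4
    rw [← h4]
    exact h2
  have hconst : ∀ t, Real.exp (-(c * t)) * Q t = Q 0 := by
    intro t
    have hd : ∀ t, HasDerivAt (fun t => Real.exp (-(c * t)) * Q t) 0 t := by
      intro t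
      have h1 : HasDerivAt (fun t => Real.exp (-(c * t))) (Real.exp (-(c * t)) * -(c * 1)) t :=
        (((hasDerivAt_id t).const_mul c).neg).exp
      have h2 := h1.mul (hQd t)
      convert! h2 using 1
      ring
    have := is_const_of_deriv_eq_zero (fun t => (hd t).differentiableAt) (fun t => (hd t).deriv) t 0
    simpa using this
  have hQ0 : Q 0 = lam x v := by
    rw [hQ 0]
    have h1 : φ 0 = id := by funext y; exact hφ.zero y
    have h2 : (mfderiv I I (φ 0) x : E →L[ℝ] E) = ContinuousLinearMap.id ℝ E := by
      rw [h1]; exact mfderiv_id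
    have h3 := lam.congr_point (hφ.zero x)
    change (lam (φ 0 x) : E →L[ℝ] ℝ) ((mfderiv I I (φ 0) x : E →L[ℝ] E) v) = _
    rw [h2, h3]; rfl
  rw [← hQ t, ← hQ0, ← hconst t, ← mul_assoc, ← Real.exp_add]
  simp

end DualVectorField

end OneForm

/-! ### The inverse function theorem and regular level sets -/

section InverseFunction

open Filter Topology

variable {E : Type*} [NormedAddCommGroup E] [NormedSpace ℝ E]
  {H : Type*} [TopologicalSpace H] {I : ModelWithCorners ℝ E H}
  {M : Type*} [TopologicalSpace M] [ChartedSpace H M]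
  {E' : Type*} [NormedAddCommGroup E'] [NormedSpace ℝ E']
  {H' : Type*} [TopologicalSpace H'] {J : ModelWithCorners ℝ E' H'}
  {N : Type*} [TopologicalSpace N] [ChartedSpace H' N]

theorem PartialDiffeomorph.symm_apply_apply (Φ : PartialDiffeomorph I J M N ∞) {x : M}
    (hx : x ∈ Φ.source) : Φ.symm (Φ x) = x := Φ.left_inv' hx

theorem PartialDiffeomorph.apply_symm_apply (Φ : PartialDiffeomorph I J M N ∞) {y : N}
    (hy : y ∈ Φ.target) : Φ (Φ.symm y) = y := Φ.right_inv' hy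

theorem PartialDiffeomorph.apply_mem_target (Φ : PartialDiffeomorph I J M N ∞) {x : M}
    (hx : x ∈ Φ.source) : Φ x ∈ Φ.target := Φ.map_source' hx

theorem PartialDiffeomorph.symm_apply_mem_source (Φ : PartialDiffeomorph I J M N ∞) {y : N}
    (hy : y ∈ Φ.target) : Φ.symm y ∈ Φ.source := Φ.map_target' hy

theorem PartialDiffeomorph.contMDiffAt (Φ : PartialDiffeomorph I J M N ∞) {x : M}
    (hx : x ∈ Φ.source) : ContMDiffAt I J ∞ Φ x :=
  Φ.contMDiffOn_toFun.contMDiffAt (Φ.open_source.mem_nhds hx)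

theorem PartialDiffeomorph.contMDiffAt_symm (Φ : PartialDiffeomorph I J M N ∞) {y : N}
    (hy : y ∈ Φ.target) : ContMDiffAt J I ∞ Φ.symm y :=
  Φ.contMDiffOn_invFun.contMDiffAt (Φ.open_target.mem_nhds hy)

theorem IsLocalDiffeomorphAt.congr {f g : M → N} {x : M} (h : IsLocalDiffeomorphAt I J ∞ f x)
    (hfg : g =ᶠ[𝓝 x] f) : IsLocalDiffeomorphAt I J ∞ g x := by
  obtain ⟨Φ, hx, he⟩ := h
  obtain ⟨s, hs, hso, hxs⟩ := eventually_nhds_iff.1 hfg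
  let e := Φ.toOpenPartialHomeomorph.restrOpen s hso
  have hes : e.source = Φ.source ∩ s := rfl
  have het : e.target ⊆ Φ.target := fun y hy => hy.1
  exact ⟨{ toPartialEquiv := e.toPartialEquiv
           open_source := e.open_source
           open_target := e.open_target
           contMDiffOn_toFun := Φ.contMDiffOn_toFun.mono (by rw [hes]; exact inter_subset_left)
           contMDiffOn_invFun := Φ.contMDiffOn_invFun.mono het }, ⟨hx, hxs⟩,
    fun y hy => (hs y hy.2).trans (he hy.1)⟩

variable [FiniteDimensional ℝ E] [FiniteDimensional ℝ E'] [I.Boundaryless] [J.Boundaryless]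
  [IsManifold I ∞ M] [IsManifold J ∞ N]

/-- The preferred chart as a partial diffeomorphism onto its image in the model vector space. -/
noncomputable def extChartDiffeo (I : ModelWithCorners ℝ E H) [I.Boundaryless] {M : Type*}
    [TopologicalSpace M] [ChartedSpace H M] [IsManifold I ∞ M] (x : M) :
    PartialDiffeomorph I 𝓘(ℝ, E) M E ∞ where
  toPartialEquiv := extChartAt I x
  open_source := isOpen_extChartAt_source x
  open_target := isOpen_extChartAt_target x
  contMDiffOn_toFun := by
    have h := contMDiffOn_extChartAt (n := ∞) (I := I) (x := x)
    rwa [← extChartAt_source I] at h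
  contMDiffOn_invFun := contMDiffOn_extChartAt_symm x

/-- The inverse function theorem in normed spaces. The source of the local inverse is shrunk to
points where the derivative is invertible, so that the inverse is smooth on its whole domain. -/
theorem isLocalDiffeomorphAt_of_hasFDerivAt {f : E → E'} {a : E} {U : Set E} (hU : IsOpen U)
    (ha : a ∈ U) (hf : ContDiffOn ℝ ∞ f U) {f' : E ≃L[ℝ] E'}
    (hf' : HasFDerivAt f (f' : E →L[ℝ] E') a) :
    IsLocalDiffeomorphAt 𝓘(ℝ, E) 𝓘(ℝ, E') ∞ f a := by
  have : CompleteSpace E := FiniteDimensional.complete ℝ E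
  have hfa : ContDiffAt ℝ ∞ f a := hf.contDiffAt (hU.mem_nhds ha)
  let Φ := hfa.toOpenPartialHomeomorph f hf' (by simp)
  have hc : ContinuousOn (fderiv ℝ f) U := hf.continuousOn_fderiv_of_isOpen hU (by simp)
  let V : Set E := U ∩ fderiv ℝ f ⁻¹' range ((↑) : (E ≃L[ℝ] E') → E →L[ℝ] E')
  have hV : IsOpen V := hc.isOpen_inter_preimage hU ContinuousLinearEquiv.isOpen
  have haV : a ∈ V := ⟨ha, f', hf'.fderiv.symm⟩
  let e := Φ.restrOpen V hV
  refine ⟨{ toPartialEquiv := e.toPartialEquiv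
            open_source := e.open_source
            open_target := e.open_target
            contMDiffOn_toFun := ?_
            contMDiffOn_invFun := ?_ },
    ⟨hfa.mem_toOpenPartialHomeomorph_source hf' (by simp), haV⟩, fun y _ => rfl⟩
  · exact (hf.mono fun y hy => hy.2.1).contMDiffOn
  · intro y hy
    have hy' : e.symm y ∈ V := (e.map_target hy).2
    obtain ⟨L, hL⟩ := hy'.2
    have h1 : ContDiffAt ℝ ∞ f (e.symm y) := hf.contDiffAt (hU.mem_nhds hy'.1)
    have h2 : HasFDerivAt f (L : E →L[ℝ] E') (e.symm y) := by
      rw [hL]; exact (h1.differentiableAt (by simp)).hasFDerivAt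
    exact (e.contDiffAt_symm hy h2 h1).contMDiffAt.contMDiffWithinAt

/-- The inverse function theorem for maps between manifolds without boundary. -/
theorem isLocalDiffeomorphAt_of_bijective_mfderiv {f : M → N} {x : M}
    (hf : ∀ᶠ y in 𝓝 x, ContMDiffAt I J ∞ f y) (hbij : Function.Bijective (mfderiv I J f x)) :
    IsLocalDiffeomorphAt I J ∞ f x := by
  have hc : Tendsto (extChartAt I x).symm (𝓝 (extChartAt I x x)) (𝓝 x) := by
    have := (continuousAt_extChartAt_symm (I := I) x).tendsto
    rwa [extChartAt_to_inv] at this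
  have hfx := hf.self_of_nhds
  have hsrc : ∀ᶠ y in 𝓝 x, f y ∈ (extChartAt J (f x)).source :=
    hfx.continuousAt.eventually (extChartAt_source_mem_nhds (f x))
  have hU : ∀ᶠ e in 𝓝 (extChartAt I x x),
      ContDiffAt ℝ ∞ (writtenInExtChartAt I J x f) e := by
    filter_upwards [hc.eventually hf, hc.eventually hsrc,
      extChartAt_target_mem_nhds (I := I) x] with e h1 h2 h3
    have h4 : ContMDiffAt J 𝓘(ℝ, E') ∞ (extChartAt J (f x)) (f ((extChartAt I x).symm e)) :=
      contMDiffAt_extChartAt' (by simpa using h2)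
    have h5 : ContMDiffAt 𝓘(ℝ, E) 𝓘(ℝ, E') ∞
        (extChartAt J (f x) ∘ (f ∘ (extChartAt I x).symm)) e :=
      ContMDiffAt.comp (I' := J) e h4
        (h1.comp e (OneForm.contMDiffAt_extChartAt_symm_of_mem x h3))
    exact h5.contDiffAt
  obtain ⟨U, hU1, hUo, hUx⟩ := eventually_nhds_iff.1 hU
  have hmd := OneForm.mfderiv_eq_fderiv_written (hfx.mdifferentiableAt (by simp))
  have hbij' : Function.Bijective
      (fderiv ℝ (writtenInExtChartAt I J x f) (extChartAt I x x)) := by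
    rw [← hmd]; exact hbij
  let L : E ≃L[ℝ] E' := (LinearEquiv.ofBijective
    (fderiv ℝ (writtenInExtChartAt I J x f) (extChartAt I x x)).toLinearMap
    hbij').toContinuousLinearEquiv
  have hL : HasFDerivAt (writtenInExtChartAt I J x f) (L : E →L[ℝ] E') (extChartAt I x x) :=
    ((hU1 _ hUx).differentiableAt (by simp)).hasFDerivAt
  have h1 : IsLocalDiffeomorphAt I 𝓘(ℝ, E) ∞ (extChartAt I x) x :=
    ⟨extChartDiffeo I x, mem_extChartAt_source x, fun _ _ => rfl⟩
  have h2 : IsLocalDiffeomorphAt 𝓘(ℝ, E) 𝓘(ℝ, E') ∞ (writtenInExtChartAt I J x f)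
      (extChartAt I x x) :=
    isLocalDiffeomorphAt_of_hasFDerivAt hUo hUx (fun e he => (hU1 e he).contDiffWithinAt) hL
  have h3 : IsLocalDiffeomorphAt 𝓘(ℝ, E') J ∞ (extChartAt J (f x)).symm
      (writtenInExtChartAt I J x f (extChartAt I x x)) := by
    rw [OneForm.writtenInExtChartAt_self]
    exact ⟨(extChartDiffeo J (f x)).symm, mem_extChartAt_target (f x), fun _ _ => rfl⟩
  refine ((h1.comp _ _ h2).comp _ _ h3).congr ?_
  filter_upwards [hsrc, extChartAt_source_mem_nhds (I := I) x] with y hy hy'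
  simp only [Function.comp, writtenInExtChartAt]
  rw [(extChartAt I x).left_inv hy', (extChartAt J (f x)).left_inv hy]

end InverseFunction

section LevelSet

open Filter Topology

variable {E : Type*} [NormedAddCommGroup E] [NormedSpace ℝ E]
  {H : Type*} [TopologicalSpace H] {I : ModelWithCorners ℝ E H}
  {M : Type*} [TopologicalSpace M] [ChartedSpace H M]
  {V : Type*} [NormedAddCommGroup V] [NormedSpace ℝ V] {F : M → ℝ} {c : ℝ}

/-- A partial diffeomorphism whose first component is `F`, restricted to the level set
`{F = c}`: the second component is a chart. The inverse takes the junk value `x₀` off the target. -/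
noncomputable def levelChart (x₀ : {x : M // F x = c})
    (Ψ : PartialDiffeomorph I 𝓘(ℝ, ℝ × V) M (ℝ × V) ∞) (hΨ : ∀ y ∈ Ψ.source, (Ψ y).1 = F y) :
    OpenPartialHomeomorph {x : M // F x = c} V where
  toFun y := (Ψ y.1).2
  invFun u := open scoped Classical in
    if h : (c, u) ∈ Ψ.target then ⟨Ψ.symm (c, u), by
      rw [← hΨ _ (Ψ.symm_apply_mem_source h), Ψ.apply_symm_apply h]⟩ else x₀
  source := {y | y.1 ∈ Ψ.source}
  target := {u | (c, u) ∈ Ψ.target}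
  map_source' y hy := by
    have h : (c, (Ψ y.1).2) = Ψ y.1 := Prod.ext (by rw [hΨ _ hy, y.2]) rfl
    change (c, (Ψ y.1).2) ∈ Ψ.target
    rw [h]
    exact Ψ.apply_mem_target hy
  map_target' u hu := by
    have hu' : (c, u) ∈ Ψ.target := hu
    rw [dif_pos hu']
    exact Ψ.symm_apply_mem_source hu'
  left_inv' y hy := by
    have h : (c, (Ψ y.1).2) = Ψ y.1 := Prod.ext (by rw [hΨ _ hy, y.2]) rfl
    have hu' : (c, (Ψ y.1).2) ∈ Ψ.target := by rw [h]; exact Ψ.apply_mem_target hy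
    rw [dif_pos hu']
    refine Subtype.ext ?_
    change Ψ.symm (c, (Ψ y.1).2) = y.1
    rw [h]
    exact Ψ.symm_apply_apply hy
  right_inv' u hu := by
    have hu' : (c, u) ∈ Ψ.target := hu
    rw [dif_pos hu']
    change (Ψ (Ψ.symm (c, u))).2 = u
    rw [Ψ.apply_symm_apply hu']
  open_source := Ψ.open_source.preimage continuous_subtype_val
  open_target := Ψ.open_target.preimage (by fun_prop)
  continuousOn_toFun := by
    have h : ContinuousOn Ψ Ψ.source := Ψ.contMDiffOn_toFun.continuousOn
    exact continuous_snd.comp_continuousOn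
      (h.comp continuous_subtype_val.continuousOn fun y hy => hy)
  continuousOn_invFun := by
    rw [continuousOn_iff_continuous_domRestrict, continuous_induced_rng]
    have h : ContinuousOn Ψ.symm Ψ.target := Ψ.contMDiffOn_invFun.continuousOn
    have h2 : ContinuousOn (fun u : V => Ψ.symm (c, u)) {u | (c, u) ∈ Ψ.target} :=
      h.comp (by fun_prop) fun u hu => hu
    rw [continuousOn_iff_continuous_domRestrict] at h2
    refine h2.congr fun u => ?_
    have hu' : (c, u.1) ∈ Ψ.target := u.2
    simp [dif_pos hu']

theorem levelChart_apply (x₀ : {x : M // F x = c})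
    (Ψ : PartialDiffeomorph I 𝓘(ℝ, ℝ × V) M (ℝ × V) ∞) (hΨ : ∀ y ∈ Ψ.source, (Ψ y).1 = F y)
    (y : {x : M // F x = c}) : levelChart x₀ Ψ hΨ y = (Ψ y.1).2 := rfl

theorem levelChart_symm_apply (x₀ : {x : M // F x = c})
    (Ψ : PartialDiffeomorph I 𝓘(ℝ, ℝ × V) M (ℝ × V) ∞) (hΨ : ∀ y ∈ Ψ.source, (Ψ y).1 = F y)
    {u : V} (hu : (c, u) ∈ Ψ.target) : ((levelChart x₀ Ψ hΨ).symm u).1 = Ψ.symm (c, u) := by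
  change (@dite _ ((c, u) ∈ Ψ.target) (Classical.propDecidable _) _ _ :
    {x : M // F x = c}).1 = _
  rw [dif_pos hu]

/-- The charts of a regular level set, from a family of slice charts of the ambient manifold. -/
@[reducible] noncomputable def levelChartedSpace
    (Ψ : {x : M // F x = c} → PartialDiffeomorph I 𝓘(ℝ, ℝ × V) M (ℝ × V) ∞)
    (hmem : ∀ x, x.1 ∈ (Ψ x).source) (hΨ : ∀ x, ∀ y ∈ (Ψ x).source, (Ψ x y).1 = F y) :
    ChartedSpace V {x : M // F x = c} where
  atlas := range fun x => levelChart x (Ψ x) (hΨ x)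
  chartAt x := levelChart x (Ψ x) (hΨ x)
  mem_chart_source x := hmem x
  chart_mem_atlas x := ⟨x, rfl⟩

/-- The slice charts of a regular level set have smooth transition maps. -/
theorem isManifold_levelSet
    (Ψ : {x : M // F x = c} → PartialDiffeomorph I 𝓘(ℝ, ℝ × V) M (ℝ × V) ∞)
    (hmem : ∀ x, x.1 ∈ (Ψ x).source) (hΨ : ∀ x, ∀ y ∈ (Ψ x).source, (Ψ x y).1 = F y) :
    letI := levelChartedSpace Ψ hmem hΨ
    IsManifold 𝓘(ℝ, V) ∞ {x : M // F x = c} := by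
  let _ := levelChartedSpace Ψ hmem hΨ
  refine isManifold_of_contDiffOn _ _ _ ?_
  rintro _ _ ⟨x, rfl⟩ ⟨x', rfl⟩ u hu
  obtain ⟨⟨hu1, hu2⟩, -⟩ := hu
  have hu1' : (c, u) ∈ (Ψ x).target := hu1
  have hu2' : ((levelChart x (Ψ x) (hΨ x)).symm u).1 ∈ (Ψ x').source := hu2
  rw [levelChart_symm_apply _ _ _ hu1'] at hu2'
  have h1 : ContMDiffAt 𝓘(ℝ, V) 𝓘(ℝ, ℝ × V) ∞ (fun u : V => (c, u)) u :=
    (contDiff_const.prodMk contDiff_id).contMDiff.contMDiffAt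
  have h2 := ((Ψ x').contMDiffAt hu2').comp u
    (((Ψ x).contMDiffAt_symm hu1').comp (f := fun u : V => (c, u)) u h1)
  have h3 : ContDiffAt ℝ ∞ (fun u => (Ψ x' ((Ψ x).symm (c, u))).2) u :=
    contDiff_snd.contDiffAt.comp u h2.contDiffAt
  refine (h3.congr_of_eventuallyEq ?_).contDiffWithinAt
  have ho : IsOpen {u : V | (c, u) ∈ (Ψ x).target} := (levelChart x (Ψ x) (hΨ x)).open_target
  filter_upwards [ho.mem_nhds hu1'] with w hw
  change (Ψ x' ((levelChart x (Ψ x) (hΨ x)).symm w).1).2 = _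
  rw [levelChart_symm_apply _ _ _ hw]

/-- A regular level set is a submanifold: the inclusion is smooth, and its derivative is injective
with values in the kernel of the differential of the defining function. -/
theorem contMDiff_levelSet_val [IsManifold I ∞ M] [FiniteDimensional ℝ V]
    (hF : ContMDiff I 𝓘(ℝ, ℝ) ∞ F)
    (Ψ : {x : M // F x = c} → PartialDiffeomorph I 𝓘(ℝ, ℝ × V) M (ℝ × V) ∞)
    (hmem : ∀ x, x.1 ∈ (Ψ x).source) (hΨ : ∀ x, ∀ y ∈ (Ψ x).source, (Ψ x y).1 = F y) :
    letI := levelChartedSpace Ψ hmem hΨ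
    ContMDiff 𝓘(ℝ, V) I ∞ (Subtype.val : {x : M // F x = c} → M) ∧
    ∀ x : {x : M // F x = c},
      Function.Injective (mfderiv 𝓘(ℝ, V) I (Subtype.val : {x : M // F x = c} → M) x) ∧
      ∀ v, mfderiv I 𝓘(ℝ, ℝ) F x.1
        (mfderiv 𝓘(ℝ, V) I (Subtype.val : {x : M // F x = c} → M) x v) = 0 := by
  let _ := levelChartedSpace Ψ hmem hΨ
  have := isManifold_levelSet Ψ hmem hΨ
  have hval : ContMDiff 𝓘(ℝ, V) I ∞ (Subtype.val : {x : M // F x = c} → M) := by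
    intro x
    have hx : (c, (Ψ x x.1).2) = Ψ x x.1 := Prod.ext (by rw [hΨ x _ (hmem x), x.2]) rfl
    have h1 : ContMDiffAt 𝓘(ℝ, V) 𝓘(ℝ, V) ∞ (levelChart x (Ψ x) (hΨ x)) x :=
      contMDiffAt_extChartAt (I := 𝓘(ℝ, V)) (x := x)
    have h2 : ContMDiffAt 𝓘(ℝ, V) 𝓘(ℝ, ℝ × V) ∞ (fun u : V => (c, u))
        (levelChart x (Ψ x) (hΨ x) x) :=
      (contDiff_const.prodMk contDiff_id).contMDiff.contMDiffAt
    have h3 : ContMDiffAt 𝓘(ℝ, ℝ × V) I ∞ (Ψ x).symm (c, levelChart x (Ψ x) (hΨ x) x) := by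
      rw [levelChart_apply, hx]
      exact (Ψ x).contMDiffAt_symm ((Ψ x).apply_mem_target (hmem x))
    have h4 := ContMDiffAt.comp x h3 (ContMDiffAt.comp x h2 h1)
    refine h4.congr_of_eventuallyEq ?_
    have ho : IsOpen {y : {x : M // F x = c} | y.1 ∈ (Ψ x).source} :=
      (levelChart x (Ψ x) (hΨ x)).open_source
    filter_upwards [ho.mem_nhds (hmem x)] with y hy
    have hy' : (c, (Ψ x y.1).2) = Ψ x y.1 := Prod.ext (by rw [hΨ x _ hy, y.2]) rfl
    simp only [Function.comp, levelChart_apply]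
    rw [hy', (Ψ x).symm_apply_apply hy]
  refine ⟨hval, fun x => ⟨?_, ?_⟩⟩
  · -- the chart of the level set factors through the inclusion
    have h1 : MDifferentiableAt 𝓘(ℝ, V) I (Subtype.val : {x : M // F x = c} → M) x :=
      hval.contMDiffAt.mdifferentiableAt (by simp)
    have h2 : MDifferentiableAt I 𝓘(ℝ, V) (fun y => (Ψ x y).2) x.1 :=
      ((contDiff_snd.contMDiff.contMDiffAt).comp x.1
        ((Ψ x).contMDiffAt (hmem x))).mdifferentiableAt (n := ∞) (by simp)
    have h3 := mfderiv_comp x h2 h1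
    have h4 : (mfderiv 𝓘(ℝ, V) 𝓘(ℝ, V) (extChartAt 𝓘(ℝ, V) x) x)
        = ContinuousLinearMap.id ℝ _ := mfderiv_extChartAt_self
    have h5 : ((fun y => (Ψ x y).2) ∘ (Subtype.val : {x : M // F x = c} → M))
        = extChartAt 𝓘(ℝ, V) x := rfl
    rw [h5, h4] at h3
    intro v w hvw
    have h6 := DFunLike.congr_fun h3 v
    have h7 := DFunLike.congr_fun h3 w
    exact h6.trans ((congrArg (mfderiv I 𝓘(ℝ, V) (fun y => (Ψ x y).2) x.1) hvw).trans h7.symm)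
  · intro v
    have h1 : MDifferentiableAt 𝓘(ℝ, V) I (Subtype.val : {x : M // F x = c} → M) x :=
      hval.contMDiffAt.mdifferentiableAt (by simp)
    have h2 : MDifferentiableAt I 𝓘(ℝ, ℝ) F x.1 := hF.contMDiffAt.mdifferentiableAt (by simp)
    have h3 := mfderiv_comp x h2 h1
    have h4 : F ∘ (Subtype.val : {x : M // F x = c} → M) = fun _ => c := by
      funext y; exact y.2
    rw [h4, mfderiv_const] at h3
    exact (DFunLike.congr_fun h3 v).symm

/-- A nonzero linear functional is the first component of a linear isomorphism onto `ℝ × V`. -/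
theorem exists_bijective_prod [FiniteDimensional ℝ E] [FiniteDimensional ℝ V] (l : E →L[ℝ] ℝ)
    (hl : l ≠ 0) (hdim : Module.finrank ℝ E = Module.finrank ℝ V + 1) :
    ∃ P : E →L[ℝ] V, Function.Bijective (l.prod P) := by
  have hl' : (l : Module.Dual ℝ E) ≠ 0 := fun h => hl (by
    ext e; exact DFunLike.congr_fun h e)
  obtain ⟨v, hv⟩ : ∃ v, l v = 1 := by
    obtain ⟨w, hw⟩ : ∃ w, l w ≠ 0 := by
      by_contra! h
      exact hl (by ext e; exact h e)
    exact ⟨(l w)⁻¹ • w, by rw [map_smul, smul_eq_mul, inv_mul_cancel₀ hw]⟩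
  have hker := Module.Dual.finrank_ker_add_one_of_ne_zero (f := (l : Module.Dual ℝ E)) hl'
  let κ : LinearMap.ker (l : E →ₗ[ℝ] ℝ) ≃ₗ[ℝ] V := LinearEquiv.ofFinrankEq _ _ (by
    have : Module.finrank ℝ (LinearMap.ker (l : E →ₗ[ℝ] ℝ)) + 1 = Module.finrank ℝ E := hker
    omega)
  let proj : E →ₗ[ℝ] LinearMap.ker (l : E →ₗ[ℝ] ℝ) :=
    LinearMap.codRestrict _ (LinearMap.id - (l : E →ₗ[ℝ] ℝ).smulRight v) (fun e => by
      simp [hv])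
  let P : E →L[ℝ] V := LinearMap.toContinuousLinearMap (κ.toLinearMap ∘ₗ proj)
  have hinj : Function.Injective (l.prod P) := by
    rw [injective_iff_map_eq_zero]
    intro e he
    have h1 : l e = 0 := congrArg Prod.fst he
    have h2 : κ (proj e) = 0 := congrArg Prod.snd he
    have h3 : proj e = 0 := (map_eq_zero_iff κ κ.injective).1 h2
    have h4 : e - l e • v = 0 := congrArg Subtype.val h3
    rwa [h1, zero_smul, sub_zero] at h4
  refine ⟨P, hinj, ?_⟩
  have hd : Module.finrank ℝ E = Module.finrank ℝ (ℝ × V) := by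
    rw [hdim, Module.finrank_prod, Module.finrank_self, add_comm]
  exact (LinearMap.injective_iff_surjective_of_finrank_eq_finrank
    (f := (l.prod P).toLinearMap) hd).1 hinj

/-- Around a regular point of `F` there is a chart with first component `F`. -/
theorem exists_sliceChart [FiniteDimensional ℝ E] [FiniteDimensional ℝ V] [I.Boundaryless]
    [IsManifold I ∞ M] (hdim : Module.finrank ℝ E = Module.finrank ℝ V + 1)
    (hF : ContMDiff I 𝓘(ℝ, ℝ) ∞ F) {x : M} (hx : mfderiv I 𝓘(ℝ, ℝ) F x ≠ 0) :
    ∃ Ψ : PartialDiffeomorph I 𝓘(ℝ, ℝ × V) M (ℝ × V) ∞, x ∈ Ψ.source ∧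
      ∀ y ∈ Ψ.source, (Ψ y).1 = F y := by
  obtain ⟨P, hP⟩ := exists_bijective_prod (E := E) (V := V)
    (mfderiv I 𝓘(ℝ, ℝ) F x : E →L[ℝ] ℝ) hx hdim
  let f : M → ℝ × V := fun y => (F y, P (extChartAt I x y))
  have hf : ∀ y ∈ (chartAt H x).source, ContMDiffAt I 𝓘(ℝ, ℝ × V) ∞ f y := by
    intro y hy
    exact ContMDiffAt.prodMk_space hF.contMDiffAt
      (P.contDiff.contMDiff.contMDiffAt.comp y (contMDiffAt_extChartAt' hy))
  have hd : (mfderiv I 𝓘(ℝ, ℝ × V) f x : E →L[ℝ] ℝ × V)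
      = (mfderiv I 𝓘(ℝ, ℝ) F x : E →L[ℝ] ℝ).prod P := by
    have h1 : HasMFDerivAt I 𝓘(ℝ, ℝ) F x (mfderiv I 𝓘(ℝ, ℝ) F x) :=
      (hF.contMDiffAt.mdifferentiableAt (by simp)).hasMFDerivAt
    have h2 : HasMFDerivAt I 𝓘(ℝ, E) (extChartAt I x) x
        (ContinuousLinearMap.id ℝ (TangentSpace I x)) := by
      rw [← mfderiv_extChartAt_self]
      exact ((contMDiffAt_extChartAt (n := ∞) (I := I) (x := x)).mdifferentiableAt
        (by simp)).hasMFDerivAt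
    have h3 := (P.hasFDerivAt (x := extChartAt I x x)).hasMFDerivAt.comp x h2
    have h4 : HasMFDerivAt I 𝓘(ℝ, ℝ × V) f x
        ((mfderiv I 𝓘(ℝ, ℝ) F x : E →L[ℝ] ℝ).prod P : E →L[ℝ] ℝ × V) :=
      ⟨h1.1.prodMk h3.1, h1.2.prodMk h3.2⟩
    exact h4.mfderiv
  have hloc : IsLocalDiffeomorphAt I 𝓘(ℝ, ℝ × V) ∞ f x := by
    refine isLocalDiffeomorphAt_of_bijective_mfderiv ?_ (by rw [hd]; exact hP)
    filter_upwards [(chartAt H x).open_source.mem_nhds (mem_chart_source H x)] with y hy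
      using hf y hy
  obtain ⟨Ψ, h1, h2⟩ := hloc
  exact ⟨Ψ, h1, fun y hy => by rw [← h2 hy]⟩

end LevelSet

/-! ### Derivatives of flows -/

section FlowDerivative

open Filter Topology

variable {E : Type*} [NormedAddCommGroup E] [NormedSpace ℝ E] [FiniteDimensional ℝ E]
  {H : Type*} [TopologicalSpace H] {I : ModelWithCorners ℝ E H} [I.Boundaryless]
  {M : Type*} [TopologicalSpace M] [ChartedSpace H M] [IsManifold I ∞ M]
  {E' : Type*} [NormedAddCommGroup E'] [NormedSpace ℝ E']
  {H' : Type*} [TopologicalSpace H'] {J : ModelWithCorners ℝ E' H'}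
  {N : Type*} [TopologicalSpace N] [ChartedSpace H' N]
  {X : (x : M) → TangentSpace I x} {φ : ℝ → M → M}

namespace IsSmoothFlow

theorem contMDiff_apply (hφ : IsSmoothFlow X φ) (t : ℝ) : ContMDiff I I ∞ (φ t) :=
  hφ.contMDiff.comp (contMDiff_const.prodMk contMDiff_id)

theorem neg_apply (hφ : IsSmoothFlow X φ) (t : ℝ) (x : M) : φ (-t) (φ t x) = x := by
  rw [← hφ.add, neg_add_cancel, hφ.zero]

theorem apply_neg (hφ : IsSmoothFlow X φ) (t : ℝ) (x : M) : φ t (φ (-t) x) = x := by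
  rw [← hφ.add, add_neg_cancel, hφ.zero]

theorem mfderiv_time (hφ : IsSmoothFlow X φ) (t : ℝ) (x : M) :
    mfderiv 𝓘(ℝ, ℝ) I (fun t => φ t x) t (1 : ℝ) = X (φ t x) := by
  have h := DFunLike.congr_fun (hφ.isMIntegralCurve x t).mfderiv (1 : ℝ)
  exact h.trans (one_smul ℝ (X (φ t x) : E))

theorem mfderiv_time_apply (hφ : IsSmoothFlow X φ) (t : ℝ) (x : M) (σ : ℝ) :
    mfderiv 𝓘(ℝ, ℝ) I (fun t => φ t x) t σ = σ • X (φ t x) :=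
  DFunLike.congr_fun (hφ.isMIntegralCurve x t).mfderiv σ

/-- A flow preserves its generator. -/
theorem mfderiv_generator (hφ : IsSmoothFlow X φ) (t : ℝ) (x : M) :
    mfderiv I I (φ t) x (X x) = X (φ t x) := by
  have h1 : (fun s => φ s (φ t x)) = φ t ∘ fun s => φ s x := by
    funext s
    change φ s (φ t x) = φ t (φ s x)
    rw [← hφ.add, ← hφ.add, add_comm]
  have h2 := hφ.mfderiv_time 0 (φ t x)
  rw [h1] at h2
  have h3 := mfderiv_comp_apply (I := 𝓘(ℝ, ℝ)) (I' := I) (I'' := I) (f := fun s => φ s x)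
    (g := φ t) (0 : ℝ) ((hφ.contMDiff_apply t).contMDiffAt.mdifferentiableAt (by simp))
    ((hφ.isMIntegralCurve x 0).mdifferentiableAt) (1 : ℝ)
  have h4 := h3.symm.trans h2
  have h5 := hφ.mfderiv_time 0 x
  have key : ∀ y, y = x → ∀ z : E, z = (X y : E) →
      (mfderiv I I (φ t) y : E →L[ℝ] E) z = (X (φ t (φ 0 x)) : E) →
      (mfderiv I I (φ t) x : E →L[ℝ] E) (X x) = (X (φ t (φ 0 x)) : E) := by
    rintro y rfl z rfl h; exact h
  have h6 := key (φ 0 x) (hφ.zero x) _ h5 (h4.trans (by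
    change (X (φ 0 (φ t x)) : E) = X (φ t (φ 0 x))
    rw [hφ.zero, hφ.zero]))
  refine h6.trans ?_
  rw [hφ.zero]

theorem mfderiv_injective (hφ : IsSmoothFlow X φ) (t : ℝ) (x : M) :
    Function.Injective (mfderiv I I (φ t) x) := by
  have h1 : φ (-t) ∘ φ t = id := by
    funext y; exact hφ.neg_apply t y
  have h2 : ∀ v : TangentSpace I x, mfderiv I I (φ (-t)) (φ t x) (mfderiv I I (φ t) x v) = v := by
    intro v
    refine (mfderiv_comp_apply x ((hφ.contMDiff_apply (-t)).contMDiffAt.mdifferentiableAt (by simp))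
      ((hφ.contMDiff_apply t).contMDiffAt.mdifferentiableAt (by simp)) v).symm.trans ?_
    rw [h1, mfderiv_id]; rfl
  intro v w hvw
  have h3 := h2 v
  rw [hvw] at h3
  exact h3.symm.trans (h2 w)

theorem hasDerivAt_comp (hφ : IsSmoothFlow X φ) {F : M → ℝ} (hF : ContMDiff I 𝓘(ℝ, ℝ) ∞ F)
    (t : ℝ) (x : M) :
    HasDerivAt (fun t => F (φ t x)) (mfderiv I 𝓘(ℝ, ℝ) F (φ t x) (X (φ t x))) t := by
  have h1 := HasMFDerivAt.comp t (g := F)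
    (hF.contMDiffAt.mdifferentiableAt (by simp)).hasMFDerivAt (hφ.isMIntegralCurve x t)
  have key : ∀ (D : E →L[ℝ] ℝ) (v : E) (g : ℝ → ℝ),
      HasFDerivAt g (D.comp ((1 : ℝ →L[ℝ] ℝ).smulRight v)) t → HasDerivAt g (D v) t := by
    intro D v g h
    refine h.hasDerivAt.congr_deriv ?_
    simp
  exact key _ _ _ h1.hasFDerivAt

/-- The derivative of `(y, s) ↦ φ_s (f y)`. -/
theorem mfderiv_flowOut (hφ : IsSmoothFlow X φ) {f : N → M} {y : N} (hf : ContMDiffAt J I ∞ f y)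
    (s : ℝ) (v : E') (σ : ℝ) :
    (mfderiv (J.prod 𝓘(ℝ, ℝ)) I (fun p : N × ℝ => φ p.2 (f p.1)) (y, s) : E' × ℝ →L[ℝ] E) (v, σ)
      = (mfderiv I I (φ s) (f y) : E →L[ℝ] E) ((mfderiv J I f y : E' →L[ℝ] E) v)
        + σ • (X (φ s (f y)) : E) := by
  have h1 : MDifferentiableAt (J.prod 𝓘(ℝ, ℝ)) I (fun p : N × ℝ => φ p.2 (f p.1)) (y, s) := by
    have h2 : ContMDiffAt (J.prod 𝓘(ℝ, ℝ)) (𝓘(ℝ, ℝ).prod I) ∞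
        (fun p : N × ℝ => (p.2, f p.1)) (y, s) :=
      contMDiffAt_snd.prodMk (ContMDiffAt.comp (y, s) (g := f) hf contMDiffAt_fst)
    exact (hφ.contMDiff.contMDiffAt.comp (y, s) h2).mdifferentiableAt (by simp)
  have h2 := mfderiv_prod_eq_add_apply (v := ((v, σ) : E' × ℝ)) h1
  refine h2.trans ?_
  have h3 := mfderiv_comp_apply y ((hφ.contMDiff_apply s).contMDiffAt.mdifferentiableAt (by simp))
    (hf.mdifferentiableAt (by simp)) v
  have h4 := hφ.mfderiv_time_apply s (f y) σ
  exact congrArg₂ (fun a b : E => a + b) h3 h4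

theorem contMDiff_flowOut (hφ : IsSmoothFlow X φ) {f : N → M} (hf : ContMDiff J I ∞ f) :
    ContMDiff (J.prod 𝓘(ℝ, ℝ)) I ∞ (fun p : N × ℝ => φ p.2 (f p.1)) :=
  ContMDiff.comp (I' := 𝓘(ℝ, ℝ).prod I) hφ.contMDiff
    (contMDiff_snd.prodMk (hf.comp contMDiff_fst))

end IsSmoothFlow

end FlowDerivative

/-! ### Contact hypersurfaces transverse to a Liouville flow -/

section ContactHypersurface

open Filter Topology

variable {E : Type*} [NormedAddCommGroup E] [NormedSpace ℝ E] [FiniteDimensional ℝ E]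
  {E' : Type*} [NormedAddCommGroup E'] [NormedSpace ℝ E'] [FiniteDimensional ℝ E']

/-- A hyperplane, the image of `A`, and a vector `x` outside of it span the space. -/
theorem bijective_add_smul_of_transverse (A : E' →L[ℝ] E) (x : E) (l : E →L[ℝ] ℝ)
    (hA : Function.Injective A) (hlA : ∀ v, l (A v) = 0) (hlx : l x ≠ 0)
    (hdim : Module.finrank ℝ E = Module.finrank ℝ E' + 1) :
    Function.Bijective (fun p : E' × ℝ => A p.1 + p.2 • x) := by
  let L : E' × ℝ →ₗ[ℝ] E :=
    A.toLinearMap ∘ₗ LinearMap.fst ℝ E' ℝ + (LinearMap.snd ℝ E' ℝ).smulRight x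
  have hL : ∀ p, L p = A p.1 + p.2 • x := fun p => rfl
  have hinj : Function.Injective L := by
    rw [injective_iff_map_eq_zero]
    rintro ⟨v, σ⟩ h
    have h0 : A v + σ • x = 0 := h
    have h1 : l (A v + σ • x) = 0 := by rw [h0, map_zero]
    rw [map_add, map_smul, hlA, zero_add, smul_eq_mul] at h1
    have h2 : σ = 0 := (mul_eq_zero.1 h1).resolve_right hlx
    rw [h2, zero_smul, add_zero] at h0
    have h3 : v = 0 := hA (h0.trans (map_zero A).symm)
    rw [h2, h3]; rfl
  have hd : Module.finrank ℝ (E' × ℝ) = Module.finrank ℝ E := by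
    rw [hdim, Module.finrank_prod, Module.finrank_self]
  exact ⟨hinj, (LinearMap.injective_iff_surjective_of_finrank_eq_finrank hd).1 hinj⟩

/-- Bijectivity of the derivative of `(y, s) ↦ φ_s (f y)`, for a flow with derivative `D` that maps
the generator `x` to `c`, from transversality at time `0`. -/
theorem bijective_of_eq_add_smul {A : E' →L[ℝ] E} {x c : E} {D : E →L[ℝ] E} {T : E' × ℝ →L[ℝ] E}
    (hA : Function.Bijective (fun p : E' × ℝ => A p.1 + p.2 • x)) (hD : Function.Injective D)
    (hx : D x = c) (hT : ∀ p, T p = D (A p.1) + p.2 • c) : Function.Bijective T := by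
  have h1 : Function.Bijective D :=
    ⟨hD, (LinearMap.injective_iff_surjective (f := D.toLinearMap)).1 hD⟩
  have h2 : ⇑T = D ∘ fun p : E' × ℝ => A p.1 + p.2 • x := by
    funext p
    rw [hT, ← hx]
    simp
  rw [h2]
  exact h1.comp hA

variable {H : Type*} [TopologicalSpace H] {I : ModelWithCorners ℝ E H} [I.Boundaryless]
  {M : Type*} [TopologicalSpace M] [ChartedSpace H M] [IsManifold I ∞ M]
  {H' : Type*} [TopologicalSpace H'] {J : ModelWithCorners ℝ E' H'} [J.Boundaryless]
  {N : Type*} [TopologicalSpace N] [ChartedSpace H' N] [IsManifold J ∞ N]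

namespace OneForm

/-- A hypersurface transverse to the Liouville vector field is of contact type. -/
theorem isContact_pullback_of_transverse {lam : OneForm I M} (hlam : lam.Smooth)
    (hnd : lam.NondegenerateD) {X : (x : M) → TangentSpace I x}
    (hX : ∀ (x : M) (v : TangentSpace I x), lam.d x (X x) v = lam x v) {F : M → ℝ} {f : N → M}
    (hf : ContMDiff J I ∞ f) (hinj : ∀ y, Function.Injective (mfderiv J I f y))
    (hker : ∀ y v, mfderiv I 𝓘(ℝ, ℝ) F (f y) (mfderiv J I f y v) = 0)
    (htr : ∀ y, differential I F (f y) (X (f y)) ≠ 0)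
    (hdim : Module.finrank ℝ E = Module.finrank ℝ E' + 1) :
    (pullback (I := J) f lam).IsContact := by
  have hsurj : ∀ (y : N) (w : E), ∃ (v : E') (σ : ℝ),
      (mfderiv J I f y : E' →L[ℝ] E) v + σ • (X (f y) : E) = w := by
    intro y w
    obtain ⟨p, hp⟩ := (bijective_add_smul_of_transverse (E := E) (E' := E')
      (mfderiv J I f y : E' →L[ℝ] E) (X (f y) : E) (mfderiv I 𝓘(ℝ, ℝ) F (f y) : E →L[ℝ] ℝ)
      (hinj y) (hker y) (htr y) hdim).2 w
    exact ⟨p.1, p.2, hp⟩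
  have hXX : ∀ x, (lam x (X x) : ℝ) = 0 := fun x => by rw [← hX, d_self]
  have hX0 : ∀ y, X (f y) ≠ 0 := by
    intro y h
    refine htr y ?_
    rw [h]
    exact map_zero _
  have hne : ∀ y, pullback (I := J) f lam y ≠ 0 := by
    intro y hy
    refine hX0 y (hnd _ _ fun w => ?_)
    rw [hX]
    obtain ⟨v, σ, hw⟩ := hsurj y w
    have h1 : lam (f y) (mfderiv J I f y v) = 0 := DFunLike.congr_fun hy v
    have key : ∀ (D : E →L[ℝ] ℝ) (a b c : E), a + σ • b = c → D a = 0 → D b = 0 → D c = 0 := by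
      rintro D a b _ rfl h h'
      rw [map_add, map_smul, h, h', smul_zero, add_zero]
    exact key (lam (f y)) _ _ _ hw h1 (hXX _)
  refine ⟨hlam.pullback hf, hne, fun y u hu hu2 => ?_⟩
  obtain ⟨r, hr⟩ : ∃ r : E', (lam (f y) : E →L[ℝ] ℝ) ((mfderiv J I f y : E' →L[ℝ] E) r) = 1 := by
    obtain ⟨r, hr⟩ : ∃ r : E', (pullback (I := J) f lam y : E' →L[ℝ] ℝ) r ≠ 0 := by
      by_contra! h
      exact hne y (ContinuousLinearMap.ext h)
    refine ⟨((pullback (I := J) f lam y : E' →L[ℝ] ℝ) r)⁻¹ • r, ?_⟩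
    exact (map_smul (pullback (I := J) f lam y : E' →L[ℝ] ℝ) _ r).trans (inv_mul_cancel₀ hr)
  have hd : ∀ v : E', lam.d (f y) (mfderiv J I f y u) (mfderiv J I f y v)
      = (pullback (I := J) f lam).d y u v := fun v =>
    (d_pullback hf.contMDiffAt (hlam.differentiableAt_inChart _) u v).symm
  let U : TangentSpace I (f y) := mfderiv J I f y u
  let k : ℝ := lam.d (f y) U (mfderiv J I f y r)
  -- `U` is a multiple of the Liouville vector, because `d lam (U, ·) = k lam`; as `U` is tangent to
  -- the hypersurface, the multiple vanishes
  have hUX : U + (-k) • X (f y) = 0 := by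
    refine hnd _ _ fun w => ?_
    rw [d_add_left, d_smul_left, hX]
    obtain ⟨v, σ, hw⟩ := hsurj y w
    -- split `v` into its components along `r` and in the contact hyperplane
    let a : ℝ := lam (f y) (mfderiv J I f y v)
    let v0 : E' := v - a • r
    have hv0 : (lam (f y) : E →L[ℝ] ℝ) ((mfderiv J I f y : E' →L[ℝ] E) v0) = 0 := by
      have key : ∀ (D : E →L[ℝ] ℝ) (A : E' →L[ℝ] E), D (A v) = a → D (A r) = 1 → D (A v0) = 0 := by
        intro D A h h'
        simp only [v0, map_sub, map_smul, h, h', smul_eq_mul, mul_one, sub_self]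
      exact key _ _ rfl hr
    have hv0' : lam.d (f y) U (mfderiv J I f y v0) = 0 := (hd v0).trans (hu2 v0 hv0)
    have hw' : w = ((mfderiv J I f y v0 : TangentSpace I (f y))
        + a • (mfderiv J I f y r : TangentSpace I (f y))) + σ • X (f y) := by
      have key : ∀ (A : E' →L[ℝ] E) (b c : E), A v + σ • b = c →
          c = (A v0 + a • A r) + σ • b := by
        rintro A b _ rfl
        simp only [v0, map_sub, map_smul, sub_add_cancel]
      exact key (mfderiv J I f y) _ _ hw
    have h1 : lam.d (f y) U w = a * k := by
      have hu' : lam (f y) U = 0 := hu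
      rw [hw', d_add_right, d_add_right, d_smul_right, d_smul_right, hv0', d_swap lam _ U (X (f y)),
        hX, hu']
      ring
    have h2 : (lam (f y) w : ℝ) = a := by
      have key : ∀ (D : E →L[ℝ] ℝ) (p q s w : E), w = p + a • q + σ • s → D p = 0 → D q = 1 →
          D s = 0 → D w = a := by
        rintro D p q s _ rfl h h' h''
        simp [h, h', h'']
      exact key (lam (f y)) _ _ _ _ hw' hv0 hr (hXX _)
    rw [h1, h2]
    ring
  have hk : k = 0 := by
    have h1 := hker y u
    have key : ∀ (D : E →L[ℝ] ℝ) (a b : E), a + (-k) • b = 0 → D a = 0 → D b ≠ 0 → k = 0 := by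
      intro D a b h h' h''
      have h3 : D (a + (-k) • b) = 0 := by rw [h, map_zero]
      rw [map_add, map_smul, h', zero_add, smul_eq_mul, neg_mul, neg_eq_zero] at h3
      exact (mul_eq_zero.1 h3).resolve_right h''
    exact key (mfderiv I 𝓘(ℝ, ℝ) F (f y)) _ _ hUX h1 (htr y)
  have hU : U = 0 := by
    rw [hk, neg_zero, zero_smul, add_zero] at hUX
    exact hUX
  exact hinj y (hU.trans (map_zero (mfderiv J I f y : E' →L[ℝ] E)).symm)

end OneForm

end ContactHypersurface

section Exhaustion

open Filter Topology

variable {E : Type*} [NormedAddCommGroup E] [NormedSpace ℝ E] [FiniteDimensional ℝ E]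
  {H : Type*} [TopologicalSpace H] {I : ModelWithCorners ℝ E H} [I.Boundaryless]
  {M : Type u} [TopologicalSpace M] [ChartedSpace H M] [IsManifold I ∞ M] [T2Space M]

/-- A complete Liouville vector field `X` with a function `F` that increases along `X` outside of a
compact sublevel set `{F ≤ c}`, into which every trajectory enters in backward time, makes the end
of `M` the positive half of the symplectization of the contact hypersurface `{F = c}`. -/
theorem isLiouvilleManifold_of_isSmoothFlow {lam : OneForm I M} (hlam : lam.Smooth)
    (hnd : lam.NondegenerateD) {X : (x : M) → TangentSpace I x} {φ : ℝ → M → M}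
    (hφ : IsSmoothFlow X φ)
    (hX : ∀ (x : M) (v : TangentSpace I x), lam.d x (X x) v = lam x v) {F : M → ℝ}
    (hF : ContMDiff I 𝓘(ℝ, ℝ) ∞ F) {c : ℝ}
    (hmono : ∀ x, 0 ≤ OneForm.differential I F x (X x))
    (hpos : ∀ x, c ≤ F x → 0 < OneForm.differential I F x (X x))
    (hcpt : IsCompact {x | F x ≤ c}) (hback : ∀ x, ∃ T, 0 ≤ T ∧ F (φ (-T) x) ≤ c) {m : ℕ}
    (hdim : Module.finrank ℝ E = m + 1) : IsLiouvilleManifold lam := by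
  have hdim' : Module.finrank ℝ E = Module.finrank ℝ (EuclideanSpace ℝ (Fin m)) + 1 := by
    rw [finrank_euclideanSpace_fin, hdim]
  have hreg : ∀ x : {x : M // F x = c}, mfderiv I 𝓘(ℝ, ℝ) F x.1 ≠ 0 := by
    intro x h
    have h1 := hpos x.1 x.2.ge
    rw [OneForm.differential, h] at h1
    exact lt_irrefl _ h1
  choose Ψ hmem hΨ using fun x => exists_sliceChart hdim' hF (hreg x)
  let N : Type u := {x : M // F x = c}
  let _ : ChartedSpace (EuclideanSpace ℝ (Fin m)) N := levelChartedSpace Ψ hmem hΨ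
  have hman : IsManifold (𝓡 m) ∞ N := isManifold_levelSet Ψ hmem hΨ
  obtain ⟨hval, hder⟩ := contMDiff_levelSet_val hF Ψ hmem hΨ
  have hcptN : CompactSpace N := isCompact_iff_compactSpace.1
    (hcpt.of_isClosed_subset (isClosed_eq hF.continuous continuous_const) fun x hx => le_of_eq hx)
  -- `F` along the trajectories
  have hmon : ∀ x, Monotone fun t => F (φ t x) := fun x =>
    monotone_of_hasDerivAt_nonneg (fun t => hφ.hasDerivAt_comp hF t x) fun t => hmono _
  have hstrict : ∀ x, c ≤ F x → ∀ t, 0 < t → c < F (φ t x) := by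
    intro x hx t ht
    have h1 : ∀ s ∈ Icc 0 t, c ≤ F (φ s x) := by
      intro s hs
      have h2 := hmon x hs.1
      simp only [hφ.zero] at h2
      exact hx.trans h2
    have h3 : StrictMonoOn (fun t => F (φ t x)) (Icc 0 t) := by
      refine strictMonoOn_of_deriv_pos (convex_Icc 0 t)
        (fun s _ => (hφ.hasDerivAt_comp hF s x).continuousAt.continuousWithinAt) fun s hs => ?_
      rw [interior_Icc] at hs
      rw [(hφ.hasDerivAt_comp hF s x).deriv]
      exact hpos _ (h1 s ⟨hs.1.le, hs.2.le⟩)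
    have h4 := h3 (left_mem_Icc.2 ht.le) (right_mem_Icc.2 ht.le) ht
    simp only [hφ.zero] at h4
    exact hx.trans_lt h4
  -- every point of `{c ≤ F}` lies on a forward trajectory starting from the level set
  have hexit : ∀ x, c ≤ F x → ∃ (y : N) (t : ℝ), 0 ≤ t ∧ φ t y.1 = x := by
    intro x hx
    obtain ⟨T, hT, hTx⟩ := hback x
    have hcont : ContinuousOn (fun t => F (φ t x)) (Icc (-T) 0) :=
      fun s _ => (hφ.hasDerivAt_comp hF s x).continuousAt.continuousWithinAt
    obtain ⟨t, ht, htc⟩ := intermediate_value_Icc (by linarith) hcont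
      (show c ∈ Icc (F (φ (-T) x)) (F (φ 0 x)) from ⟨hTx, by rwa [hφ.zero]⟩)
    refine ⟨⟨φ t x, htc⟩, -t, by linarith [ht.2], hφ.neg_apply t x⟩
  let emb : N × ℝ → M := fun p => φ p.2 p.1.1
  have hIci : ∀ S, emb '' (univ ×ˢ Ici S) = φ (-S) ⁻¹' {x | c ≤ F x} := by
    intro S
    ext x
    constructor
    · rintro ⟨⟨y, s⟩, ⟨-, hs⟩, rfl⟩
      change c ≤ F (φ (-S) (φ s y.1))
      rw [← hφ.add]
      have h2 := hmon y.1 (show (0 : ℝ) ≤ -S + s by linarith [show S ≤ s from hs])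
      simp only [hφ.zero] at h2
      exact y.2.ge.trans h2
    · intro hx
      obtain ⟨y, t, ht, h⟩ := hexit _ hx
      refine ⟨(y, S + t), ⟨mem_univ _, show S ≤ S + t by linarith⟩, ?_⟩
      change φ (S + t) y.1 = x
      rw [hφ.add, h, hφ.apply_neg]
  have hIoi : ∀ S, (emb '' (univ ×ˢ Ioi S))ᶜ = φ S '' {x | F x ≤ c} := by
    intro S
    ext x
    constructor
    · intro hx
      refine ⟨φ (-S) x, ?_, hφ.apply_neg S x⟩
      by_contra! h
      have h' : c < F (φ (-S) x) := not_le.1 h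
      obtain ⟨y, t, ht, hy⟩ := hexit _ h'.le
      refine hx ⟨(y, S + t), ⟨mem_univ _, show S < S + t from ?_⟩, ?_⟩
      · rcases ht.lt_or_eq with ht | rfl
        · linarith
        · rw [hφ.zero] at hy
          rw [← hy, y.2] at h'
          exact absurd h' (lt_irrefl _)
      · change φ (S + t) y.1 = x
        rw [hφ.add, hy, hφ.apply_neg]
    · rintro ⟨x, hx, rfl⟩ ⟨⟨y, s⟩, ⟨-, hs⟩, h⟩
      have h1 : φ (-S) (φ s y.1) = x := by
        have h' : φ s y.1 = φ S x := h
        rw [h', hφ.neg_apply]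
      rw [← hφ.add] at h1
      have h2 := hstrict y.1 y.2.ge (-S + s) (by linarith [show S < s from hs])
      rw [h1] at h2
      exact absurd h2 (not_lt.2 hx)
  have hembs : ContMDiff ((𝓡 m).prod 𝓘(ℝ, ℝ)) I ∞ emb := hφ.contMDiff_flowOut hval
  have hk0 : ∀ x, (lam x (X x) : ℝ) = 0 := fun x => by rw [← hX, OneForm.d_self]
  refine ⟨hlam, hnd, m, N, inferInstance, inferInstance, hman, inferInstance, hcptN,
    OneForm.pullback (I := 𝓡 m) (Subtype.val : N → M) lam,
    OneForm.isContact_pullback_of_transverse hlam hnd hX hval (fun y => (hder y).1)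
      (fun y => (hder y).2) (fun y => (hpos y.1 y.2.ge).ne') hdim',
    ⟨{ emb := emb, isLocalDiffeomorphOn := ?_, injOn := ?_, pullback_eq := ?_,
        isClosed_image := ?_, isCompact_compl := ?_ }⟩⟩
  · rintro ⟨⟨y, s⟩, hys⟩
    refine isLocalDiffeomorphAt_of_bijective_mfderiv
      (Eventually.of_forall fun p => hembs.contMDiffAt) ?_
    have hb := bijective_add_smul_of_transverse (E := E) (E' := EuclideanSpace ℝ (Fin m))
      (mfderiv (𝓡 m) I (Subtype.val : N → M) y : EuclideanSpace ℝ (Fin m) →L[ℝ] E) (X y.1 : E)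
      (mfderiv I 𝓘(ℝ, ℝ) F y.1 : E →L[ℝ] ℝ) (hder y).1 (hder y).2 (hpos y.1 y.2.ge).ne' hdim'
    exact bijective_of_eq_add_smul (E := E) (E' := EuclideanSpace ℝ (Fin m)) hb
      (hφ.mfderiv_injective s y.1) (hφ.mfderiv_generator s y.1)
      (T := (mfderiv ((𝓡 m).prod 𝓘(ℝ, ℝ)) I emb (y, s) : EuclideanSpace ℝ (Fin m) × ℝ →L[ℝ] E))
      fun p => hφ.mfderiv_flowOut (J := 𝓡 m) hval.contMDiffAt s p.1 p.2
  · have hlt : ∀ (y y' : N) (s s' : ℝ), φ s y.1 = φ s' y'.1 → ¬ s < s' := by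
      intro y y' s s' h hs
      have h1 : φ (-s + s') y'.1 = y.1 := by rw [hφ.add, ← h, hφ.neg_apply]
      have h2 := hstrict y'.1 y'.2.ge (-s + s') (by linarith)
      rw [h1, y.2] at h2
      exact lt_irrefl _ h2
    rintro ⟨y, s⟩ - ⟨y', s'⟩ - h
    have h' : φ s y.1 = φ s' y'.1 := h
    have hs : s = s' := le_antisymm (not_lt.1 (hlt _ _ _ _ h'.symm)) (not_lt.1 (hlt _ _ _ _ h'))
    subst hs
    have h2 := congrArg (φ (-s)) h'
    rw [hφ.neg_apply, hφ.neg_apply] at h2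
    rw [Subtype.ext h2]
  · intro y s _
    refine ContinuousLinearMap.ext fun p => ?_
    have h1 := OneForm.isSmoothFlow_pullback hlam hφ hk0 (c := 1)
      (fun x v => (hX x v).trans (one_mul _).symm) s y.1
      (mfderiv (𝓡 m) I (Subtype.val : N → M) y p.1)
    have h2 := hφ.mfderiv_flowOut (J := 𝓡 m) (f := (Subtype.val : N → M)) (y := y)
      hval.contMDiffAt s p.1 p.2
    have h3 : OneForm.pullback (I := (𝓡 m).prod 𝓘(ℝ, ℝ)) (Prod.fst : N × ℝ → N)
        (OneForm.pullback (I := 𝓡 m) (Subtype.val : N → M) lam) (y, s) p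
        = lam y.1 (mfderiv (𝓡 m) I (Subtype.val : N → M) y p.1) := by
      have h4 : (mfderiv ((𝓡 m).prod 𝓘(ℝ, ℝ)) (𝓡 m) (Prod.fst : N × ℝ → N) (y, s) p) = p.1 :=
        DFunLike.congr_fun (mfderiv_fst (I := 𝓡 m) (I' := 𝓘(ℝ, ℝ)) (x := (y, s))) p
      exact congrArg (fun v => lam y.1 (mfderiv (𝓡 m) I (Subtype.val : N → M) y v)) h4
    have key : ∀ (D : E →L[ℝ] ℝ) (a b c : E), a = b + p.2 • c → D c = 0 → D a = D b := by
      rintro D _ b c rfl h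
      rw [map_add, map_smul, h, smul_zero, add_zero]
    refine (key (lam (φ s y.1)) _ _ _ h2 (hk0 _)).trans (h1.trans ?_)
    rw [one_mul]
    exact congrArg (fun r => Real.exp s * r) h3.symm
  · intro S _
    rw [hIci]
    exact (isClosed_le continuous_const hF.continuous).preimage (hφ.contMDiff_apply (-S)).continuous
  · intro S _
    rw [hIoi]
    exact hcpt.image (hφ.contMDiff_apply S).continuous

end Exhaustion

/-! ### The Liouville form on a convex end -/

section Ends

open Filter Topology

variable {E : Type*} [NormedAddCommGroup E] [NormedSpace ℝ E] [FiniteDimensional ℝ E]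
  {H : Type*} [TopologicalSpace H] {I : ModelWithCorners ℝ E H} [I.Boundaryless]
  {W : Type*} [TopologicalSpace W] [ChartedSpace H W] [IsManifold I ∞ W]
  {E' : Type*} [NormedAddCommGroup E'] [NormedSpace ℝ E'] [FiniteDimensional ℝ E']
  {H' : Type*} [TopologicalSpace H'] {J : ModelWithCorners ℝ E' H'} [J.Boundaryless]
  {Y : Type*} [TopologicalSpace Y] [ChartedSpace H' Y] [IsManifold J ∞ Y]
  {lam : OneForm I W} {al : OneForm J Y}

theorem OneForm.d_zero_left (lam : OneForm I W) (x : W) (v : TangentSpace I x) :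
    lam.d x 0 v = 0 := by
  rw [← zero_smul ℝ (0 : TangentSpace I x), d_smul_left, zero_mul]

/-- The exterior derivative of `e^s al` on the symplectization. -/
theorem OneForm.d_symplectization (hal : al.Smooth) (y : Y) (s : ℝ) (u v : E' × ℝ) :
    OneForm.d (I := J.prod 𝓘(ℝ, ℝ)) (M := Y × ℝ) (fun p => Real.exp p.2 •
      OneForm.pullback (I := J.prod 𝓘(ℝ, ℝ)) (J := J) (Prod.fst : Y × ℝ → Y) al p) (y, s) u v
      = Real.exp s * (al.d y u.1 v.1 + u.2 * al y v.1 - v.2 * al y u.1) := by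
  have hfst : ContMDiff (J.prod 𝓘(ℝ, ℝ)) J ∞ (Prod.fst : Y × ℝ → Y) := contMDiff_fst
  have hD : ∀ u : E' × ℝ, mfderiv (J.prod 𝓘(ℝ, ℝ)) J (Prod.fst : Y × ℝ → Y) (y, s) u = u.1 :=
    fun u => DFunLike.congr_fun (mfderiv_fst (I := J) (I' := 𝓘(ℝ, ℝ)) (x := (y, s))) u
  have hexp : ∀ u : E' × ℝ, OneForm.differential (J.prod 𝓘(ℝ, ℝ))
      (fun p : Y × ℝ => Real.exp p.2) (y, s) u = Real.exp s * u.2 := by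
    intro u
    have h1 : HasMFDerivAt 𝓘(ℝ, ℝ) 𝓘(ℝ, ℝ) Real.exp s
        ((1 : ℝ →L[ℝ] ℝ).smulRight (Real.exp s)) :=
      (Real.hasDerivAt_exp s).hasFDerivAt.hasMFDerivAt
    have h2 := HasMFDerivAt.comp (g := Real.exp) ((y, s) : Y × ℝ) h1
      (hasMFDerivAt_snd (I := J) (I' := 𝓘(ℝ, ℝ)) (x := ((y, s) : Y × ℝ)))
    refine (DFunLike.congr_fun h2.mfderiv u).trans ?_
    exact mul_comm u.2 (Real.exp s)
  have hmd : MDifferentiableAt (J.prod 𝓘(ℝ, ℝ)) 𝓘(ℝ, ℝ) (fun p : Y × ℝ => Real.exp p.2) (y, s) :=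
    ((Real.contDiff_exp.contMDiff (n := ∞)).comp contMDiff_snd).contMDiffAt.mdifferentiableAt
      (by simp)
  refine (OneForm.d_smul hmd ((hal.pullback hfst).differentiableAt_inChart _) u v).trans ?_
  have h2 : ∀ u : E' × ℝ, (OneForm.pullback (I := J.prod 𝓘(ℝ, ℝ)) (J := J)
      (Prod.fst : Y × ℝ → Y) al).inChart (y, s) (extChartAt (J.prod 𝓘(ℝ, ℝ)) (y, s) (y, s)) u
      = al y u.1 := fun u =>
    (DFunLike.congr_fun (OneForm.inChart_self _ _) u).trans (congrArg (al y) (hD u))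
  have h3 : (OneForm.pullback (I := J.prod 𝓘(ℝ, ℝ)) (J := J) (Prod.fst : Y × ℝ → Y) al).d (y, s) u v
      = al.d y u.1 v.1 := by
    have key : ∀ a b : E', a = u.1 → b = v.1 → al.d y a b = al.d y u.1 v.1 := by
      rintro _ _ rfl rfl; rfl
    exact (OneForm.d_pullback hfst.contMDiffAt (hal.differentiableAt_inChart _) u v).trans
      (key _ _ (hD u) (hD v))
  have key : ∀ D A B P Q : ℝ, D = al.d y u.1 v.1 → A = Real.exp s * u.2 → B = Real.exp s * v.2 →
      P = al y v.1 → Q = al y u.1 → Real.exp s * D + A * P - B * Q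
        = Real.exp s * (al.d y u.1 v.1 + u.2 * al y v.1 - v.2 * al y u.1) := by
    rintro _ _ _ _ _ rfl rfl rfl rfl rfl
    ring
  exact key _ _ _ _ _ h3 (hexp u) (hexp v) (h2 v) (h2 u)

namespace ConvexEnd

theorem isLocalDiffeomorphAt (e : ConvexEnd lam al) (y : Y) {s : ℝ} (hs : 0 < s) :
    IsLocalDiffeomorphAt (J.prod 𝓘(ℝ, ℝ)) I ∞ e.emb (y, s) :=
  e.isLocalDiffeomorphOn ⟨(y, s), ⟨mem_univ _, hs⟩⟩

theorem contMDiffAt_emb (e : ConvexEnd lam al) (y : Y) {s : ℝ} (hs : 0 < s) :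
    ContMDiffAt (J.prod 𝓘(ℝ, ℝ)) I ∞ e.emb (y, s) :=
  (e.isLocalDiffeomorphAt y hs).contMDiffAt

theorem surjective_mfderiv_emb (e : ConvexEnd lam al) (y : Y) {s : ℝ} (hs : 0 < s) :
    Function.Surjective (mfderiv (J.prod 𝓘(ℝ, ℝ)) I e.emb (y, s)) := by
  have h := (e.isLocalDiffeomorphAt y hs).mfderivToContinuousLinearEquiv_coe (by simp)
  rw [← h]
  exact ((e.isLocalDiffeomorphAt y hs).mfderivToContinuousLinearEquiv (by simp)).surjective

theorem pullback_emb_apply (e : ConvexEnd lam al) (y : Y) {s : ℝ} (hs : 0 < s) (u : E' × ℝ) :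
    lam (e.emb (y, s)) (mfderiv (J.prod 𝓘(ℝ, ℝ)) I e.emb (y, s) u) = Real.exp s * al y u.1 := by
  have h1 := DFunLike.congr_fun (e.pullback_eq y s hs) u
  refine h1.trans ?_
  have h2 : (mfderiv (J.prod 𝓘(ℝ, ℝ)) J (Prod.fst : Y × ℝ → Y) (y, s) u) = u.1 :=
    DFunLike.congr_fun (mfderiv_fst (I := J) (I' := 𝓘(ℝ, ℝ)) (x := (y, s))) u
  exact congrArg (fun r => Real.exp s * al y r) h2

theorem d_emb (e : ConvexEnd lam al) (hlam : lam.Smooth) (hal : al.Smooth) (y : Y) {s : ℝ}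
    (hs : 0 < s) (u v : E' × ℝ) :
    lam.d (e.emb (y, s)) (mfderiv (J.prod 𝓘(ℝ, ℝ)) I e.emb (y, s) u)
      (mfderiv (J.prod 𝓘(ℝ, ℝ)) I e.emb (y, s) v)
      = Real.exp s * (al.d y u.1 v.1 + u.2 * al y v.1 - v.2 * al y u.1) := by
  rw [← OneForm.d_symplectization hal]
  refine (OneForm.d_pullback (e.contMDiffAt_emb y hs) (hlam.differentiableAt_inChart _)
    u v).symm.trans ?_
  refine OneForm.d_congr ?_ u v
  filter_upwards [(isOpen_lt continuous_const continuous_snd).mem_nhds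
    (show (y, s) ∈ {p : Y × ℝ | 0 < p.2} from hs)] with p hp
  exact e.pullback_eq p.1 p.2 hp

theorem isLiouvilleVector_emb (e : ConvexEnd lam al) (hlam : lam.Smooth) (hal : al.Smooth) (y : Y)
    {s : ℝ} (hs : 0 < s) : lam.IsLiouvilleVector (e.emb (y, s))
      (mfderiv (J.prod 𝓘(ℝ, ℝ)) I e.emb (y, s) ((0, 1) : E' × ℝ)) := by
  intro v
  obtain ⟨w, rfl⟩ := e.surjective_mfderiv_emb y hs v
  refine (e.d_emb hlam hal y hs (0, 1) w).trans ?_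
  refine Eq.trans ?_ (e.pullback_emb_apply y hs w).symm
  have h0 : al.d y (0 : E') w.1 = 0 := al.d_zero_left y w.1
  have h1 : al y (0 : E') = 0 := map_zero (al y : E' →L[ℝ] ℝ)
  simp only
  rw [h0]
  refine (congrArg (fun r => Real.exp s * (0 + 1 * al y w.1 - w.2 * r)) h1).trans ?_
  ring

theorem isOpen_image (e : ConvexEnd lam al) {A : Set (Y × ℝ)} (hA : IsOpen A)
    (h : ∀ p ∈ A, 0 < p.2) : IsOpen (e.emb '' A) := by
  rw [isOpen_iff_mem_nhds]
  rintro _ ⟨p, hp, rfl⟩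
  obtain ⟨Φ, h1, h2⟩ := e.isLocalDiffeomorphAt p.1 (h p hp)
  have h3 : IsOpen (Φ '' (Φ.source ∩ A)) :=
    Φ.toOpenPartialHomeomorph.isOpen_image_of_subset_source (Φ.open_source.inter hA)
      inter_subset_left
  refine mem_of_superset (h3.mem_nhds ⟨p, ⟨h1, hp⟩, (h2 h1).symm⟩) ?_
  rintro _ ⟨q, ⟨hq1, hq2⟩, rfl⟩
  exact ⟨q, hq2, h2 hq1⟩

theorem eq_of_emb_eq (e : ConvexEnd lam al) {p q : Y × ℝ} (hp : 0 < p.2) (hq : 0 < q.2)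
    (h : e.emb p = e.emb q) : p = q :=
  e.injOn ⟨mem_univ _, hp⟩ ⟨mem_univ _, hq⟩ h

end ConvexEnd

end Ends

/-! ### The Liouville flow of a manifold with a convex end -/

section EndFlow

open Filter Topology

variable {E : Type*} [NormedAddCommGroup E] [NormedSpace ℝ E] [FiniteDimensional ℝ E]
  {H : Type*} [TopologicalSpace H] {I : ModelWithCorners ℝ E H} [I.Boundaryless]
  {W : Type*} [TopologicalSpace W] [ChartedSpace H W] [IsManifold I ∞ W]
  {E' : Type*} [NormedAddCommGroup E'] [NormedSpace ℝ E'] [FiniteDimensional ℝ E']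
  {H' : Type*} [TopologicalSpace H'] {J : ModelWithCorners ℝ E' H'} [J.Boundaryless]
  {Y : Type*} [TopologicalSpace Y] [ChartedSpace H' Y] [IsManifold J ∞ Y]
  {lam : OneForm I W} {al : OneForm J Y}

namespace OneForm

theorem NondegenerateD.liouvilleVector_unique (hnd : lam.NondegenerateD) {x : W}
    {z z' : TangentSpace I x} (h : lam.IsLiouvilleVector x z) (h' : lam.IsLiouvilleVector x z') :
    z = z' := by
  have h1 : z + (-1 : ℝ) • z' = 0 := hnd x _ fun v => by
    rw [d_add_left, d_smul_left, h v, h' v]; ring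
  rw [neg_one_smul, ← sub_eq_add_neg] at h1
  exact sub_eq_zero.1 h1

end OneForm

namespace ConvexEnd

/-- The lines `{y} × (0, ∞)` of the end are trajectories of the Liouville vector field. -/
theorem isMIntegralCurveOn_emb (e : ConvexEnd lam al) (hlam : lam.Smooth)
    (hnd : lam.NondegenerateD) (hal : al.Smooth) {X : (x : W) → TangentSpace I x}
    (hX : ∀ x, lam.IsLiouvilleVector x (X x)) (y : Y) (s : ℝ) :
    IsMIntegralCurveOn (fun t => e.emb (y, s + t)) X (Ioi (-s)) := by
  intro t ht
  have ht' : 0 < s + t := by linarith [show -s < t from ht]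
  have h1 : HasMFDerivAt 𝓘(ℝ, ℝ) (J.prod 𝓘(ℝ, ℝ)) (fun t : ℝ => ((y, s + t) : Y × ℝ)) t
      (ContinuousLinearMap.inr ℝ E' ℝ) := by
    have h2 : HasMFDerivAt 𝓘(ℝ, ℝ) 𝓘(ℝ, ℝ) (fun t : ℝ => s + t) t
        (ContinuousLinearMap.id ℝ ℝ) := ((hasFDerivAt_id t).const_add s).hasMFDerivAt
    exact (hasMFDerivAt_const y t).prodMk h2
  have h2 := HasMFDerivAt.comp t (g := e.emb)
    ((e.contMDiffAt_emb y ht').mdifferentiableAt (by simp)).hasMFDerivAt h1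
  have h3 : X (e.emb (y, s + t)) = (mfderiv (J.prod 𝓘(ℝ, ℝ)) I e.emb (y, s + t))
      ((0, 1) : E' × ℝ) :=
    hnd.liouvilleVector_unique (hX _) (e.isLiouvilleVector_emb hlam hal y ht')
  refine HasMFDerivAt.hasMFDerivWithinAt ?_
  refine h2.congr_mfderiv ?_
  have key : ∀ (D : E' × ℝ →L[ℝ] E) (x : E), x = D (0, 1) →
      D.comp (ContinuousLinearMap.inr ℝ E' ℝ) = (1 : ℝ →L[ℝ] ℝ).smulRight x := by
    rintro D _ rfl
    ext
    simp
  exact key _ _ h3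

/-- The Liouville vector field of a manifold with a convex end is complete, and its flow translates
the symplectization coordinate of the end. -/
theorem exists_liouvilleFlow [T2Space W] (e : ConvexEnd lam al) (hlam : lam.Smooth)
    (hnd : lam.NondegenerateD) (hal : al.Smooth) :
    ∃ (X : (x : W) → TangentSpace I x) (φ : ℝ → W → W),
      ContMDiff I I.tangent ∞ (fun x => (⟨x, X x⟩ : TangentBundle I W)) ∧ IsSmoothFlow X φ ∧
      (∀ x, lam.IsLiouvilleVector x (X x)) ∧
      ∀ (y : Y) (s t : ℝ), 0 < s → 0 < s + t → φ t (e.emb (y, s)) = e.emb (y, s + t) := by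
  obtain ⟨X, hXs, hX⟩ := OneForm.exists_dualVectorField hlam 0 (fun x u h => hnd x u fun v => by
    simpa using h v)
  have hXL : ∀ x, lam.IsLiouvilleVector x (X x) := fun x v => by
    have h := hX x v
    rwa [zero_mul, add_zero] at h
  have hcurve := e.isMIntegralCurveOn_emb hlam hnd hal hXL
  obtain ⟨ε, hε, hK⟩ := (e.isCompact_compl 1 one_pos).exists_uniform_isMIntegralCurveOn hXs
  -- a uniform existence time: by compactness off `Y × (1, ∞)`, and explicitly on it
  obtain ⟨φ, hφ⟩ := exists_isSmoothFlow hXs (lt_min hε one_pos) fun x => by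
    by_cases hx : x ∈ e.emb '' (univ ×ˢ Ioi 1)
    · obtain ⟨⟨y, s⟩, ⟨-, hs⟩, rfl⟩ := hx
      refine ⟨fun t => e.emb (y, s + t), by simp, (hcurve y s).mono fun t ht => ?_⟩
      have h1 : (1 : ℝ) < s := hs
      have h2 := min_le_right ε 1
      exact show -s < t by linarith [ht.1]
    · obtain ⟨γ, h0, hγ⟩ := hK x hx
      exact ⟨γ, h0, hγ.mono (Ioo_subset_Ioo (neg_le_neg (min_le_left _ _)) (min_le_left _ _))⟩
  refine ⟨X, φ, hXs, hφ, hXL, fun y s t hs hst => ?_⟩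
  have hX1 : ContMDiff I I.tangent 1 (fun x => (⟨x, X x⟩ : TangentBundle I W)) :=
    hXs.of_le (by simp)
  have h1 := isMIntegralCurveOn_Ioo_eqOn_of_contMDiff_boundaryless (t₀ := 0) (a := -s)
    (b := |t| + 1) ⟨by linarith, by positivity⟩ hX1
    ((hφ.isMIntegralCurve (e.emb (y, s))).isMIntegralCurveOn _)
    ((hcurve y s).mono Ioo_subset_Ioi_self) (by simp [hφ.zero])
  exact h1 ⟨by linarith, by linarith [le_abs_self t]⟩

variable {EQ : Type*} [NormedAddCommGroup EQ] [NormedSpace ℝ EQ]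
  {HQ : Type*} [TopologicalSpace HQ] {IQ : ModelWithCorners ℝ EQ HQ}
  {Q : Type*} [TopologicalSpace Q] [ChartedSpace HQ Q]
  {EN : Type*} [NormedAddCommGroup EN] [NormedSpace ℝ EN]
  {HN : Type*} [TopologicalSpace HN] {IN : ModelWithCorners ℝ EN HN}
  {N : Type*} [TopologicalSpace N] [ChartedSpace HN N]

/-- A smooth map on the end, with parameters in `Q`, extends to the whole manifold by any smooth
map with which it agrees on the collar `s ≤ 1`. -/
theorem exists_contMDiff_extension (e : ConvexEnd lam al) {k : (Y × ℝ) × Q → N} {k₀ : W × Q → N}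
    (hk₀ : ContMDiff (I.prod IQ) IN ∞ k₀)
    (hk : ∀ y s q, 0 < s → ContMDiffAt ((J.prod 𝓘(ℝ, ℝ)).prod IQ) IN ∞ k ((y, s), q))
    (h : ∀ y s q, 0 < s → s ≤ 1 → k ((y, s), q) = k₀ (e.emb (y, s), q)) :
    ∃ g : W × Q → N, ContMDiff (I.prod IQ) IN ∞ g ∧
      (∀ y s q, 0 < s → g (e.emb (y, s), q) = k ((y, s), q)) ∧
      ∀ w q, w ∉ e.emb '' (univ ×ˢ Ici 1) → g (w, q) = k₀ (w, q) := by
  classical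
  let g : W × Q → N := fun x =>
    if h : ∃ p : Y × ℝ, 0 < p.2 ∧ e.emb p = x.1 then k (h.choose, x.2) else k₀ x
  have hg : ∀ y s q, 0 < s → g (e.emb (y, s), q) = k ((y, s), q) := by
    intro y s q hs
    have hex : ∃ p : Y × ℝ, 0 < p.2 ∧ e.emb p = e.emb (y, s) := ⟨(y, s), hs, rfl⟩
    have h1 : hex.choose = (y, s) := e.eq_of_emb_eq hex.choose_spec.1 hs hex.choose_spec.2
    change dite _ _ _ = _
    rw [dif_pos hex, h1]
  have hg₀ : ∀ w q, w ∉ e.emb '' (univ ×ˢ Ici 1) → g (w, q) = k₀ (w, q) := by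
    intro w q hw
    by_cases hex : ∃ p : Y × ℝ, 0 < p.2 ∧ e.emb p = w
    · obtain ⟨⟨y, s⟩, hs, rfl⟩ := hex
      rw [hg y s q hs]
      refine h y s q hs (le_of_lt (not_le.1 fun h1 => hw ⟨(y, s), ⟨mem_univ _, h1⟩, rfl⟩))
    · exact dif_neg hex
  refine ⟨g, ?_, hg, hg₀⟩
  rintro ⟨w, q⟩
  by_cases hw : w ∈ e.emb '' (univ ×ˢ Ici 1)
  · obtain ⟨⟨y, s⟩, ⟨-, hs⟩, rfl⟩ := hw
    have hs' : (0 : ℝ) < s := one_pos.trans_le hs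
    obtain ⟨Φ, h1, h2⟩ := e.isLocalDiffeomorphAt y hs'
    have h3 : e.emb (y, s) ∈ Φ.target := by rw [h2 h1]; exact Φ.apply_mem_target h1
    have h4 : Φ.symm (e.emb (y, s)) = (y, s) := by rw [h2 h1]; exact Φ.symm_apply_apply h1
    have h5 : ContMDiffAt I (J.prod 𝓘(ℝ, ℝ)) ∞ Φ.symm (e.emb (y, s)) := Φ.contMDiffAt_symm h3
    have h6 : ContMDiffAt (I.prod IQ) IN ∞ (fun x : W × Q => k (Φ.symm x.1, x.2))
        (e.emb (y, s), q) := by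
      refine ContMDiffAt.comp (I' := (J.prod 𝓘(ℝ, ℝ)).prod IQ) (g := k)
        (f := fun x : W × Q => (Φ.symm x.1, x.2)) _ ?_ ?_
      · change ContMDiffAt _ _ _ _ (Φ.symm (e.emb (y, s)), q)
        rw [h4]
        exact hk y s q hs'
      · exact (h5.comp (f := Prod.fst) (e.emb (y, s), q) contMDiffAt_fst).prodMk contMDiffAt_snd
    refine h6.congr_of_eventuallyEq ?_
    have h7 : ∀ᶠ w in 𝓝 (e.emb (y, s)), 0 < (Φ.symm w).2 := by
      refine (continuous_snd.continuousAt.comp h5.continuousAt).eventually (lt_mem_nhds ?_)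
      change 0 < (Φ.symm (e.emb (y, s))).2
      rw [h4]
      exact hs'
    have h8 := h7.and (Φ.open_target.mem_nhds h3)
    filter_upwards [(continuous_fst.tendsto (e.emb (y, s), q)).eventually h8] with x hx
    have h9 : e.emb (Φ.symm x.1) = x.1 := by
      rw [h2 (Φ.symm_apply_mem_source hx.2)]
      exact Φ.apply_symm_apply hx.2
    have h10 := hg (Φ.symm x.1).1 (Φ.symm x.1).2 x.2 hx.1
    have h11 : e.emb ((Φ.symm x.1).1, (Φ.symm x.1).2) = x.1 := h9
    rw [h11] at h10
    exact h10
  · refine hk₀.contMDiffAt.congr_of_eventuallyEq ?_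
    filter_upwards [((e.isClosed_image 1 one_pos).isOpen_compl.preimage continuous_fst).mem_nhds
      (show (w, q) ∈ Prod.fst ⁻¹' (e.emb '' (univ ×ˢ Ici 1))ᶜ from hw)] with x hx
    exact hg₀ x.1 x.2 hx

end ConvexEnd

end EndFlow

/-! ### Stabilization -/

section Stabilization

open Filter Topology

variable {E : Type*} [NormedAddCommGroup E] [NormedSpace ℝ E] [FiniteDimensional ℝ E]
  {H : Type*} [TopologicalSpace H] {I : ModelWithCorners ℝ E H} [I.Boundaryless]
  {W : Type*} [TopologicalSpace W] [ChartedSpace H W] [IsManifold I ∞ W]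
  {lam : OneForm I W}

namespace OneForm

theorem stdComplex_apply (z w : ℂ) :
    stdComplex z w = 1 / 2 * (z.re * w.im - z.im * w.re) := rfl

/-- The form `stdComplex` as a linear function of the base point. -/
noncomputable def stdComplexCLM : ℂ →L[ℝ] ℂ →L[ℝ] ℝ :=
  (1 / 2 : ℝ) • (Complex.reCLM.smulRight Complex.imCLM - Complex.imCLM.smulRight Complex.reCLM)

theorem d_stdComplex (z u v : ℂ) : stdComplex.d z u v = u.re * v.im - u.im * v.re := by
  refine (d_normedSpace stdComplex z u v).trans ?_
  have h : fderiv ℝ (F := ℂ →L[ℝ] ℝ) stdComplex z = stdComplexCLM := stdComplexCLM.fderiv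
  rw [h]
  change 1 / 2 * (u.re * v.im - u.im * v.re) - 1 / 2 * (v.re * u.im - v.im * u.re) = _
  ring

theorem smooth_stdComplex : stdComplex.Smooth := by
  have h1 : ContMDiff 𝓘(ℝ, ℂ).tangent 𝓘(ℝ, ℂ) ∞
      (fun v : TangentBundle 𝓘(ℝ, ℂ) ℂ => v.1) := Bundle.contMDiff_proj _
  have h2 : ContMDiff 𝓘(ℝ, ℂ).tangent 𝓘(ℝ, ℂ) ∞
      (fun v : TangentBundle 𝓘(ℝ, ℂ) ℂ => (v.2 : ℂ)) := contMDiff_snd_tangentBundle_modelSpace ℂ _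
  exact (stdComplexCLM.contDiff.contMDiff.comp h1).clm_apply h2

theorem mfderiv_fst_apply (p : W × ℂ) (v : E × ℂ) :
    mfderiv (I.prod 𝓘(ℝ, ℂ)) I (Prod.fst : W × ℂ → W) p v = v.1 :=
  DFunLike.congr_fun (mfderiv_fst (I := I) (I' := 𝓘(ℝ, ℂ)) (x := p)) v

theorem mfderiv_snd_apply (p : W × ℂ) (v : E × ℂ) :
    mfderiv (I.prod 𝓘(ℝ, ℂ)) 𝓘(ℝ, ℂ) (Prod.snd : W × ℂ → ℂ) p v = v.2 :=
  DFunLike.congr_fun (mfderiv_snd (I := I) (I' := 𝓘(ℝ, ℂ)) (x := p)) v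

theorem stabilization_apply (lam : OneForm I W) (p : W × ℂ) (v : E × ℂ) :
    lam.stabilization p v = lam p.1 v.1 + stdComplex p.2 v.2 :=
  congrArg₂ (· + ·) (congrArg (lam p.1) (mfderiv_fst_apply p v))
    (congrArg (stdComplex p.2) (mfderiv_snd_apply (I := I) p v))

theorem Smooth.stabilization (hlam : lam.Smooth) : lam.stabilization.Smooth :=
  (hlam.pullback contMDiff_fst).add (smooth_stdComplex.pullback contMDiff_snd)

theorem d_stabilization (hlam : lam.Smooth) (p : W × ℂ) (u v : E × ℂ) :
    lam.stabilization.d p u v = lam.d p.1 u.1 v.1 + (u.2.re * v.2.im - u.2.im * v.2.re) := by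
  have h1 : ContMDiff (I.prod 𝓘(ℝ, ℂ)) I ∞ (Prod.fst : W × ℂ → W) := contMDiff_fst
  have h2 : ContMDiff (I.prod 𝓘(ℝ, ℂ)) 𝓘(ℝ, ℂ) ∞ (Prod.snd : W × ℂ → ℂ) := contMDiff_snd
  refine (d_add ((hlam.pullback h1).differentiableAt_inChart p)
    ((smooth_stdComplex.pullback h2).differentiableAt_inChart p) u v).trans ?_
  have k1 : ∀ a b : E, a = u.1 → b = v.1 → lam.d p.1 a b = lam.d p.1 u.1 v.1 := by
    rintro _ _ rfl rfl; rfl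
  have k2 : ∀ a b : ℂ, a = u.2 → b = v.2 →
      stdComplex.d p.2 a b = u.2.re * v.2.im - u.2.im * v.2.re := by
    rintro _ _ rfl rfl; exact d_stdComplex _ _ _
  exact congrArg₂ (· + ·)
    ((d_pullback h1.contMDiffAt (hlam.differentiableAt_inChart _) u v).trans
      (k1 _ _ (mfderiv_fst_apply p u) (mfderiv_fst_apply p v)))
    ((d_pullback h2.contMDiffAt (smooth_stdComplex.differentiableAt_inChart _) u v).trans
      (k2 _ _ (mfderiv_snd_apply (I := I) p u) (mfderiv_snd_apply (I := I) p v)))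

theorem NondegenerateD.stabilization (hlam : lam.Smooth) (hnd : lam.NondegenerateD) :
    lam.stabilization.NondegenerateD := by
  intro p u hu
  have hu' : ∀ v : E × ℂ, lam.d p.1 (u.1 : E) v.1
      + ((u.2 : ℂ).re * v.2.im - (u.2 : ℂ).im * v.2.re) = 0 := fun v =>
    (d_stabilization hlam p u v).symm.trans (hu v)
  have h1 : (u.1 : E) = 0 := hnd p.1 u.1 fun v => by
    have h := hu' (v, 0)
    simpa using h
  have h0 : lam.d p.1 (u.1 : E) (0 : E) = 0 := by
    refine (congrArg (fun a : E => lam.d p.1 a (0 : E)) h1).trans (d_zero_left _ _ _)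
  have hre : (u.2 : ℂ).re = 0 := by
    have h := hu' (0, Complex.I)
    simpa [h0] using h
  have him : (u.2 : ℂ).im = 0 := by
    have h := hu' (0, 1)
    simpa [h0] using h
  exact Prod.ext h1 (Complex.ext hre him)

end OneForm

/-- The product of a Liouville flow with the Liouville flow of the complex plane. -/
theorem IsSmoothFlow.prod_exp {X : (x : W) → TangentSpace I x} {φ : ℝ → W → W}
    (hφ : IsSmoothFlow X φ) :
    IsSmoothFlow (I := I.prod 𝓘(ℝ, ℂ)) (M := W × ℂ) (fun p => ((X p.1, (1 / 2 : ℝ) • p.2) : E × ℂ))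
      (fun t p => (φ t p.1, Real.exp (t / 2) • p.2)) where
  contMDiff := by
    have h1 : ContMDiff (𝓘(ℝ, ℝ).prod (I.prod 𝓘(ℝ, ℂ))) (𝓘(ℝ, ℝ).prod I) ∞
        (fun p : ℝ × (W × ℂ) => (p.1, p.2.1)) :=
      contMDiff_fst.prodMk (contMDiff_fst.comp contMDiff_snd)
    have h2 : ContMDiff (𝓘(ℝ, ℝ).prod (I.prod 𝓘(ℝ, ℂ))) 𝓘(ℝ, ℝ) ∞
        (fun p : ℝ × (W × ℂ) => Real.exp (p.1 / 2)) :=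
      (show ContDiff ℝ ∞ fun t : ℝ => Real.exp (t / 2) by fun_prop).contMDiff.comp contMDiff_fst
    exact (hφ.contMDiff.comp h1).prodMk (h2.smul (contMDiff_snd.comp contMDiff_snd))
  zero p := by simp [hφ.zero]
  add s t p := by
    refine Prod.ext (hφ.add s t p.1) ?_
    change Real.exp ((s + t) / 2) • p.2 = Real.exp (s / 2) • Real.exp (t / 2) • p.2
    rw [smul_smul, ← Real.exp_add]
    congr 2
    ring
  isMIntegralCurve p t := by
    have h1 : HasDerivAt (fun t : ℝ => Real.exp (t / 2) • p.2)
        ((1 / 2 : ℝ) • Real.exp (t / 2) • p.2) t := by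
      have h := (((hasDerivAt_id t).div_const 2).exp).smul_const p.2
      refine h.congr_deriv ?_
      rw [smul_smul]
      congr 1
      simp only [id]
      ring
    have h2 := (hφ.isMIntegralCurve p.1 t).prodMk h1.hasFDerivAt.hasMFDerivAt
    exact h2

end Stabilization

/-! ### The convex end of the stabilization -/

section StabilizationLiouville

open Filter Topology

theorem expNegInvGlue.deriv_pos {x : ℝ} (hx : 0 < x) : 0 < deriv expNegInvGlue x := by
  have h1 : expNegInvGlue =ᶠ[𝓝 x] fun x => Real.exp (-x⁻¹) := by
    filter_upwards [lt_mem_nhds hx] with y hy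
    simp [expNegInvGlue, not_le.2 hy]
  have h2 : HasDerivAt (fun x => Real.exp (-x⁻¹)) (Real.exp (-x⁻¹) * -(-(x ^ 2)⁻¹)) x :=
    ((hasDerivAt_inv hx.ne').neg).exp
  rw [h1.deriv_eq, h2.deriv, neg_neg]
  positivity

theorem expNegInvGlue.lt_of_lt {x y : ℝ} (hx : 0 < x) (hxy : x < y) :
    expNegInvGlue x < expNegInvGlue y := by
  have h : StrictMonoOn expNegInvGlue (Ioi 0) := by
    refine strictMonoOn_of_deriv_pos (convex_Ioi 0)
      (expNegInvGlue.contDiff (n := 0)).continuous.continuousOn fun x hx => ?_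
    rw [interior_Ioi] at hx
    exact expNegInvGlue.deriv_pos hx
  exact h hx (hx.trans hxy) hxy

variable {E : Type*} [NormedAddCommGroup E] [NormedSpace ℝ E] [FiniteDimensional ℝ E]
  {H : Type*} [TopologicalSpace H] {I : ModelWithCorners ℝ E H} [I.Boundaryless]
  {M : Type*} [TopologicalSpace M] [ChartedSpace H M] [IsManifold I ∞ M]

/-- The derivative of a function along a vector field, computed from the flow at time `0`. -/
theorem IsSmoothFlow.differential_eq {X : (x : M) → TangentSpace I x} {φ : ℝ → M → M}
    (hφ : IsSmoothFlow X φ) {F : M → ℝ} (hF : ContMDiff I 𝓘(ℝ, ℝ) ∞ F) {x : M} {d : ℝ}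
    (h : HasDerivAt (fun t => F (φ t x)) d 0) : OneForm.differential I F x (X x) = d := by
  have h1 := (hφ.hasDerivAt_comp hF 0 x).unique h
  have key : ∀ y, y = x → OneForm.differential I F y (X y) = d →
      OneForm.differential I F x (X x) = d := by
    rintro y rfl h; exact h
  exact key _ (hφ.zero x) h1

/-- The stabilization of a Liouville manifold is a Liouville manifold: its end is modelled on a
level set of `|z|² + h`, where `h` is an increasing function of the symplectization coordinate. -/
theorem IsLiouvilleManifold.stabilization {n : ℕ} {W : Type u} [TopologicalSpace W] [T2Space W]
    [ChartedSpace (EuclideanSpace ℝ (Fin n)) W] [IsManifold (𝓡 n) ∞ W]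
    {lam : OneForm (𝓡 n) W} (h : IsLiouvilleManifold lam) :
    IsLiouvilleManifold lam.stabilization := by
  obtain ⟨hlam, hnd, m, Y, _, _, _, _, _, al, hal, ⟨e⟩⟩ := h
  obtain ⟨X, φ, -, hφ, hX, hend⟩ := e.exists_liouvilleFlow hlam hnd hal.smooth
  -- `h = expNegInvGlue (s - 1)` extends by zero and is strictly increasing for `1 < s`
  have hη : ContDiff ℝ ∞ fun s : ℝ => expNegInvGlue (s - 1) :=
    expNegInvGlue.contDiff.comp (contDiff_id.sub contDiff_const)
  have hsq : ContMDiff ((𝓡 n).prod 𝓘(ℝ, ℂ)) 𝓘(ℝ, ℝ) ∞ (fun x : W × ℂ => ‖x.2‖ ^ 2) :=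
    (contDiff_norm_sq ℝ).contMDiff.comp contMDiff_snd
  obtain ⟨F, hF, hFend, hFout⟩ := e.exists_contMDiff_extension (Q := ℂ) (IQ := 𝓘(ℝ, ℂ))
    (k := fun x => ‖x.2‖ ^ 2 + expNegInvGlue (x.1.2 - 1)) (k₀ := fun x : W × ℂ => ‖x.2‖ ^ 2) hsq
    (fun y s z _ => by
      have h1 : ContMDiff (((𝓡 m).prod 𝓘(ℝ, ℝ)).prod 𝓘(ℝ, ℂ)) 𝓘(ℝ, ℝ) ∞
          (fun x : (Y × ℝ) × ℂ => ‖x.2‖ ^ 2) := (contDiff_norm_sq ℝ).contMDiff.comp contMDiff_snd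
      have h2 : ContMDiff (((𝓡 m).prod 𝓘(ℝ, ℝ)).prod 𝓘(ℝ, ℂ)) 𝓘(ℝ, ℝ) ∞
          (fun x : (Y × ℝ) × ℂ => expNegInvGlue (x.1.2 - 1)) :=
        hη.contMDiff.comp (contMDiff_snd.comp contMDiff_fst)
      exact (h1.add h2).contMDiffAt)
    (fun y s z _ hs => by
      simp only
      rw [expNegInvGlue.zero_of_nonpos (by linarith), add_zero])
  -- the product flow
  let Φ : ℝ → W × ℂ → W × ℂ := fun t p => (φ t p.1, Real.exp (t / 2) • p.2)
  let X' : (p : W × ℂ) → TangentSpace ((𝓡 n).prod 𝓘(ℝ, ℂ)) p :=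
    fun p => ((X p.1, (1 / 2 : ℝ) • p.2) : EuclideanSpace ℝ (Fin n) × ℂ)
  have hΦ : IsSmoothFlow X' Φ := hφ.prod_exp
  have hX' : ∀ (x : W × ℂ) (v : TangentSpace ((𝓡 n).prod 𝓘(ℝ, ℂ)) x),
      lam.stabilization.d x (X' x) v = lam.stabilization x v := by
    intro x v
    refine (OneForm.d_stabilization hlam x _ v).trans ((?_ : _ = _).trans
      (OneForm.stabilization_apply lam x v).symm)
    refine congrArg₂ (· + ·) (hX x.1 v.1) ?_
    rw [OneForm.stdComplex_apply]
    simp only [X', Complex.real_smul, Complex.re_ofReal_mul, Complex.im_ofReal_mul]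
    ring
  have hnorm : ∀ (t : ℝ) (z : ℂ), ‖Real.exp (t / 2) • z‖ ^ 2 = Real.exp t * ‖z‖ ^ 2 := by
    intro t z
    rw [norm_smul, Real.norm_eq_abs, abs_of_pos (Real.exp_pos _), mul_pow, sq, ← Real.exp_add]
    congr 2
    ring
  have hexp : ∀ z : ℂ, HasDerivAt (fun t => Real.exp t * ‖z‖ ^ 2) (‖z‖ ^ 2) 0 := by
    intro z
    have h := (Real.hasDerivAt_exp 0).mul_const (‖z‖ ^ 2)
    rwa [Real.exp_zero, one_mul] at h
  have hDend : ∀ y s z, 0 < s → OneForm.differential ((𝓡 n).prod 𝓘(ℝ, ℂ)) F (e.emb (y, s), z)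
      (X' (e.emb (y, s), z)) = ‖z‖ ^ 2 + deriv expNegInvGlue (s - 1) := by
    intro y s z hs
    refine hΦ.differential_eq hF ?_
    have h1 : HasDerivAt (fun t => expNegInvGlue (s + t - 1)) (deriv expNegInvGlue (s - 1)) 0 := by
      have h2 : HasDerivAt expNegInvGlue (deriv expNegInvGlue (s - 1)) (s + 0 - 1) := by
        rw [add_zero]
        exact ((expNegInvGlue.contDiff (n := 1)).differentiable
          (by simp)).differentiableAt.hasDerivAt
      have h3 := HasDerivAt.comp (0 : ℝ) h2 (((hasDerivAt_id (0 : ℝ)).const_add s).sub_const 1)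
      rwa [mul_one] at h3
    refine ((hexp z).add h1).congr_of_eventuallyEq ?_
    filter_upwards [lt_mem_nhds (show -s < 0 by linarith)] with t ht
    change F (φ t (e.emb (y, s)), Real.exp (t / 2) • z) = _
    rw [hend y s t hs (by linarith), hFend _ _ _ (by linarith)]
    simp only [hnorm, Pi.add_apply]
  have hDout : ∀ w z, w ∉ e.emb '' (univ ×ˢ Ici 1) →
      OneForm.differential ((𝓡 n).prod 𝓘(ℝ, ℂ)) F (w, z) (X' (w, z)) = ‖z‖ ^ 2 := by
    intro w z hw
    refine hΦ.differential_eq hF ((hexp z).congr_of_eventuallyEq ?_)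
    have hc : ContinuousAt (fun t => φ t w) 0 := (hφ.isMIntegralCurve w 0).continuousAt
    have h1 : (e.emb '' (univ ×ˢ Ici 1))ᶜ ∈ 𝓝 (φ 0 w) := by
      rw [hφ.zero]
      exact (e.isClosed_image 1 one_pos).isOpen_compl.mem_nhds hw
    filter_upwards [hc h1] with t ht
    change F (φ t w, Real.exp (t / 2) • z) = _
    rw [hFout _ _ ht]
    exact hnorm t z
  -- the level of the contact hypersurface is the value of `h` at `s = 2`, so that on it `z ≠ 0`
  -- or `1 < s`
  let c : ℝ := expNegInvGlue 1
  have hc : 0 < c := expNegInvGlue.pos_of_pos one_pos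
  -- every trajectory leaves the end in backward time
  have hleave : ∀ w, ∃ T₀, 0 ≤ T₀ ∧ ∀ T, T₀ ≤ T → φ (-T) w ∉ e.emb '' (univ ×ˢ Ici 1) := by
    intro w
    by_cases hw : w ∈ e.emb '' (univ ×ˢ Ici 1)
    · obtain ⟨⟨y, s⟩, ⟨-, hs⟩, rfl⟩ := hw
      have hs' : (1 : ℝ) ≤ s := hs
      refine ⟨s, by linarith, ?_⟩
      rintro T hT ⟨⟨y', s'⟩, ⟨-, hs2⟩, hy'⟩
      have hs2' : (1 : ℝ) ≤ s' := hs2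
      have h1 : φ T (e.emb (y', s')) = e.emb (y, s) := by rw [hy', hφ.apply_neg]
      rw [hend _ _ _ (by linarith) (by linarith)] at h1
      have h2 := congrArg Prod.snd (e.eq_of_emb_eq (show 0 < s' + T by linarith)
        (show 0 < s by linarith) h1)
      simp only at h2
      linarith
    · refine ⟨0, le_rfl, ?_⟩
      rintro T hT ⟨⟨y', s'⟩, ⟨-, hs2⟩, hy'⟩
      have hs2' : (1 : ℝ) ≤ s' := hs2
      refine hw ⟨(y', s' + T), ⟨mem_univ _, show (1 : ℝ) ≤ s' + T by linarith⟩, ?_⟩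
      rw [← hend _ _ _ (by linarith) (by linarith), hy', hφ.apply_neg]
  refine isLiouvilleManifold_of_isSmoothFlow (m := n + 1) hlam.stabilization
    (hnd.stabilization hlam) hΦ hX' hF (c := c) ?_ ?_ ?_ ?_ ?_
  · rintro ⟨w, z⟩
    by_cases hw : w ∈ e.emb '' (univ ×ˢ Ici 1)
    · obtain ⟨⟨y, s⟩, ⟨-, hs⟩, rfl⟩ := hw
      rw [hDend y s z (one_pos.trans_le hs)]
      exact add_nonneg (sq_nonneg _) expNegInvGlue.monotone.deriv_nonneg
    · rw [hDout w z hw]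
      exact sq_nonneg _
  · rintro ⟨w, z⟩ hx
    by_cases hw : w ∈ e.emb '' (univ ×ˢ Ici 1)
    · obtain ⟨⟨y, s⟩, ⟨-, hs⟩, rfl⟩ := hw
      have hs' : (0 : ℝ) < s := one_pos.trans_le hs
      rw [hDend y s z hs']
      rcases eq_or_ne z 0 with rfl | hz
      · rw [hFend _ _ _ hs'] at hx
        simp only [norm_zero, ne_eq, OfNat.ofNat_ne_zero, not_false_eq_true, zero_pow,
          zero_add] at hx
        have h1 : 0 < s - 1 := by
          by_contra! h1
          rw [expNegInvGlue.zero_of_nonpos h1] at hx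
          exact absurd hc (not_lt.2 hx)
        exact add_pos_of_nonneg_of_pos (sq_nonneg _) (expNegInvGlue.deriv_pos h1)
      · have := norm_pos_iff.2 hz
        exact add_pos_of_pos_of_nonneg (by positivity) expNegInvGlue.monotone.deriv_nonneg
    · rw [hDout w z hw]
      rw [hFout w z hw] at hx
      exact hc.trans_le hx
  · refine ((e.isCompact_compl 2 two_pos).prod (isCompact_closedBall (0 : ℂ) (Real.sqrt c))
      ).of_isClosed_subset (isClosed_le hF.continuous continuous_const) ?_
    rintro ⟨w, z⟩ hx
    have hx' : F (w, z) ≤ c := hx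
    refine ⟨?_, ?_⟩
    · rintro ⟨⟨y, s⟩, ⟨-, hs⟩, rfl⟩
      have hs' : (2 : ℝ) < s := hs
      rw [hFend _ _ _ (by linarith)] at hx'
      have h1 : c < expNegInvGlue (s - 1) := expNegInvGlue.lt_of_lt one_pos (by linarith)
      have h2 := sq_nonneg ‖z‖
      simp only at hx'
      linarith
    · have h1 : ‖z‖ ^ 2 ≤ c := by
        by_cases hw : w ∈ e.emb '' (univ ×ˢ Ici 1)
        · obtain ⟨⟨y, s⟩, ⟨-, hs⟩, rfl⟩ := hw
          rw [hFend _ _ _ (one_pos.trans_le hs)] at hx'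
          have := expNegInvGlue.nonneg (s - 1)
          simp only at hx'
          linarith
        · rwa [hFout w z hw] at hx'
      rw [mem_closedBall_zero_iff]
      exact Real.le_sqrt_of_sq_le h1
  · rintro ⟨w, z⟩
    obtain ⟨T₀, hT₀, hout⟩ := hleave w
    have h1 : Tendsto (fun T => Real.exp (-T) * ‖z‖ ^ 2) atTop (𝓝 (0 * ‖z‖ ^ 2)) :=
      (Real.tendsto_exp_neg_atTop_nhds_zero).mul_const _
    rw [zero_mul] at h1
    obtain ⟨T, hT1, hT2⟩ := ((h1.eventually (gt_mem_nhds hc)).and (eventually_ge_atTop T₀)).exists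
    refine ⟨T, hT₀.trans hT2, ?_⟩
    change F (φ (-T) w, Real.exp (-T / 2) • z) ≤ c
    rw [hFout _ _ (hout T hT2)]
    exact (hnorm (-T) z).trans_le hT1.le
  · change Module.finrank ℝ (EuclideanSpace ℝ (Fin n) × ℂ) = n + 1 + 1
    rw [Module.finrank_prod, finrank_euclideanSpace_fin, Complex.finrank_real_complex]

end StabilizationLiouville

/-! ### A twist of the plane about a moving point -/

namespace CollarTwist

open Filter Topology

/-- A cutoff function of the symplectization coordinate: `0` for `s ≤ 1` and `1` for `2 ≤ s`. -/
noncomputable def cutoff (s : ℝ) : ℝ := Real.smoothTransition (s - 1)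

/-- A function with derivative `1` at `k = 1`, the value of `radiusSq` at the origin, that vanishes
for `3 ≤ k`. -/
noncomputable def profile (k : ℝ) : ℝ := (k - 1) * Real.smoothTransition (3 - k)

/-- The squared distance of `z` from `e^(s/2)`, in units of `e^(s/2)`. -/
noncomputable def radiusSq (s : ℝ) (z : ℂ) : ℝ :=
  Real.exp (-s) * ‖z - (Real.exp (s / 2) : ℝ)‖ ^ 2

/-- The angle of the rotation about `e^(s/2)`, a function of the distance from `e^(s/2)`. -/
noncomputable def angle (s : ℝ) (z : ℂ) : ℝ := cutoff s * deriv profile (radiusSq s z)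

/-- The rotation by the angle `θ` about `e^(s/2)`. -/
noncomputable def rotation (θ s : ℝ) (z : ℂ) : ℂ :=
  (Real.exp (s / 2) : ℝ) + Complex.exp (θ * Complex.I) * (z - (Real.exp (s / 2) : ℝ))

/-- The twist of the plane about `e^(s/2)`: a rotation by a distance-dependent angle. -/
noncomputable def twist (s : ℝ) (z : ℂ) : ℂ := rotation (angle s z) s z

/-- The inverse of `twist s`. -/
noncomputable def twistInv (s : ℝ) (z : ℂ) : ℂ := rotation (-angle s z) s z

/-- The time for which the Reeb flow runs in the Liouville-form-preserving lift of the twist. -/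
noncomputable def shift (s : ℝ) (z : ℂ) : ℝ :=
  1 / 2 * ((deriv cutoff s + cutoff s) * profile (radiusSq s z)
    - cutoff s * (radiusSq s z * deriv profile (radiusSq s z)))
  - 1 / 2 * (Real.exp (-s / 2) * (twist s z - z).im)

/-- The primitive of the change of the Liouville form under the lift of the twist. It is supported
in the region where the cutoff is not constant. -/
noncomputable def primitive (s : ℝ) (z : ℂ) : ℝ :=
  1 / 2 * (deriv cutoff s * (Real.exp s * profile (radiusSq s z)))

theorem contDiff_cutoff : ContDiff ℝ ∞ cutoff :=
  Real.smoothTransition.contDiff.comp (contDiff_id.sub contDiff_const)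

theorem contDiff_profile : ContDiff ℝ ∞ profile :=
  (contDiff_id.sub contDiff_const).mul
    (Real.smoothTransition.contDiff.comp (contDiff_const.sub contDiff_id))

theorem contDiff_deriv_cutoff : ContDiff ℝ ∞ (deriv cutoff) :=
  (contDiff_infty_iff_deriv.1 contDiff_cutoff).2

theorem contDiff_deriv_profile : ContDiff ℝ ∞ (deriv profile) :=
  (contDiff_infty_iff_deriv.1 contDiff_profile).2

theorem cutoff_of_le {s : ℝ} (hs : s ≤ 1) : cutoff s = 0 :=
  Real.smoothTransition.zero_of_nonpos (by linarith)

theorem cutoff_of_ge {s : ℝ} (hs : 2 ≤ s) : cutoff s = 1 :=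
  Real.smoothTransition.one_of_one_le (by linarith)

theorem deriv_cutoff_of_le {s : ℝ} (hs : s ≤ 1) : deriv cutoff s = 0 := by
  refine IsLocalMin.deriv_eq_zero (Eventually.of_forall fun t => ?_)
  rw [cutoff_of_le hs]
  exact Real.smoothTransition.nonneg _

theorem deriv_cutoff_of_ge {s : ℝ} (hs : 2 ≤ s) : deriv cutoff s = 0 := by
  refine IsLocalMax.deriv_eq_zero (Eventually.of_forall fun t => ?_)
  rw [cutoff_of_ge hs]
  exact Real.smoothTransition.le_one _

theorem profile_of_ge {k : ℝ} (hk : 3 ≤ k) : profile k = 0 := by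
  rw [profile, Real.smoothTransition.zero_of_nonpos (by linarith), mul_zero]

theorem deriv_profile_one : deriv profile 1 = 1 := by
  have h : profile =ᶠ[𝓝 1] fun k => k - 1 := by
    filter_upwards [gt_mem_nhds (show (1 : ℝ) < 2 by norm_num)] with k hk
    rw [profile, Real.smoothTransition.one_of_one_le (by linarith), mul_one]
  rw [h.deriv_eq]
  exact ((hasDerivAt_id (1 : ℝ)).sub_const 1).deriv

theorem contDiff_radiusSq : ContDiff ℝ ∞ fun p : ℝ × ℂ => radiusSq p.1 p.2 := by
  have h1 : ContDiff ℝ ∞ fun p : ℝ × ℂ => p.2 - ((Real.exp (p.1 / 2) : ℝ) : ℂ) :=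
    contDiff_snd.sub (Complex.ofRealCLM.contDiff.comp
      (by fun_prop : ContDiff ℝ ∞ fun p : ℝ × ℂ => Real.exp (p.1 / 2)))
  exact (by fun_prop : ContDiff ℝ ∞ fun p : ℝ × ℂ => Real.exp (-p.1)).mul (h1.norm_sq ℝ)

theorem contDiff_angle : ContDiff ℝ ∞ fun p : ℝ × ℂ => angle p.1 p.2 :=
  (contDiff_cutoff.comp contDiff_fst).mul (contDiff_deriv_profile.comp contDiff_radiusSq)

theorem contDiff_rotation {θ : ℝ × ℂ → ℝ} (hθ : ContDiff ℝ ∞ θ) :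
    ContDiff ℝ ∞ fun p : ℝ × ℂ => rotation (θ p) p.1 p.2 := by
  have h1 : ContDiff ℝ ∞ fun p : ℝ × ℂ => ((Real.exp (p.1 / 2) : ℝ) : ℂ) :=
    Complex.ofRealCLM.contDiff.comp
      (by fun_prop : ContDiff ℝ ∞ fun p : ℝ × ℂ => Real.exp (p.1 / 2))
  have h2 : ContDiff ℝ ∞ fun p : ℝ × ℂ => ((θ p : ℝ) : ℂ) := Complex.ofRealCLM.contDiff.comp hθ
  exact h1.add (((h2.mul contDiff_const).cexp).mul (contDiff_snd.sub h1))

theorem contDiff_twist : ContDiff ℝ ∞ fun p : ℝ × ℂ => twist p.1 p.2 :=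
  contDiff_rotation contDiff_angle

theorem contDiff_twistInv : ContDiff ℝ ∞ fun p : ℝ × ℂ => twistInv p.1 p.2 :=
  contDiff_rotation contDiff_angle.neg

theorem contDiff_shift : ContDiff ℝ ∞ fun p : ℝ × ℂ => shift p.1 p.2 := by
  have h1 := contDiff_profile.comp contDiff_radiusSq
  have h2 := contDiff_deriv_profile.comp contDiff_radiusSq
  have h3 : ContDiff ℝ ∞ fun p : ℝ × ℂ => cutoff p.1 := contDiff_cutoff.comp contDiff_fst
  have h4 : ContDiff ℝ ∞ fun p : ℝ × ℂ => deriv cutoff p.1 :=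
    contDiff_deriv_cutoff.comp contDiff_fst
  have h5 : ContDiff ℝ ∞ fun p : ℝ × ℂ => (twist p.1 p.2 - p.2).im :=
    Complex.imCLM.contDiff.comp (contDiff_twist.sub contDiff_snd)
  exact (contDiff_const.mul (((h4.add h3).mul h1).sub (h3.mul (contDiff_radiusSq.mul h2)))).sub
    (contDiff_const.mul ((by fun_prop : ContDiff ℝ ∞ fun p : ℝ × ℂ => Real.exp (-p.1 / 2)).mul h5))

theorem contDiff_primitive : ContDiff ℝ ∞ fun p : ℝ × ℂ => primitive p.1 p.2 :=
  contDiff_const.mul ((contDiff_deriv_cutoff.comp contDiff_fst).mul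
    ((by fun_prop : ContDiff ℝ ∞ fun p : ℝ × ℂ => Real.exp p.1).mul
      (contDiff_profile.comp contDiff_radiusSq)))

theorem radiusSq_rotation (θ s : ℝ) (z : ℂ) : radiusSq s (rotation θ s z) = radiusSq s z := by
  rw [radiusSq, rotation, add_sub_cancel_left, norm_mul, Complex.norm_exp_ofReal_mul_I, one_mul,
    radiusSq]

theorem angle_rotation (θ s : ℝ) (z : ℂ) : angle s (rotation θ s z) = angle s z := by
  rw [angle, radiusSq_rotation, angle]

theorem rotation_rotation_neg (θ s : ℝ) (z : ℂ) : rotation θ s (rotation (-θ) s z) = z := by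
  rw [rotation, rotation, add_sub_cancel_left, ← mul_assoc, ← Complex.exp_add]
  push_cast
  rw [neg_mul, add_neg_cancel, Complex.exp_zero, one_mul, add_sub_cancel]

theorem twist_twistInv (s : ℝ) (z : ℂ) : twist s (twistInv s z) = z := by
  rw [twist, twistInv, angle_rotation, rotation_rotation_neg]

theorem twistInv_twist (s : ℝ) (z : ℂ) : twistInv s (twist s z) = z := by
  rw [twist, twistInv, angle_rotation]
  have := rotation_rotation_neg (-angle s z) s z
  rwa [neg_neg] at this

theorem twist_of_le {s : ℝ} (hs : s ≤ 1) (z : ℂ) : twist s z = z := by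
  rw [twist, angle, cutoff_of_le hs, zero_mul, rotation]
  simp

theorem twistInv_of_le {s : ℝ} (hs : s ≤ 1) (z : ℂ) : twistInv s z = z := by
  rw [twistInv, angle, cutoff_of_le hs, zero_mul, rotation]
  simp

theorem shift_of_le {s : ℝ} (hs : s ≤ 1) (z : ℂ) : shift s z = 0 := by
  rw [shift, cutoff_of_le hs, deriv_cutoff_of_le hs, twist_of_le hs]
  simp

theorem primitive_of_le {s : ℝ} (hs : s ≤ 1) (z : ℂ) : primitive s z = 0 := by
  rw [primitive, deriv_cutoff_of_le hs]
  simp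

theorem primitive_of_ge {s : ℝ} (hs : 2 ≤ s) (z : ℂ) : primitive s z = 0 := by
  rw [primitive, deriv_cutoff_of_ge hs]
  simp

theorem primitive_of_norm_ge (s : ℝ) {z : ℂ} (hz : 3 * Real.exp 1 ≤ ‖z‖) : primitive s z = 0 := by
  rcases le_total 2 s with hs | hs
  · exact primitive_of_ge hs z
  · have h1 : Real.exp (s / 2) ≤ Real.exp 1 := Real.exp_le_exp.2 (by linarith)
    have h2 : ‖z‖ - Real.exp (s / 2) ≤ ‖z - (Real.exp (s / 2) : ℝ)‖ := by
      have h := norm_sub_norm_le z ((Real.exp (s / 2) : ℝ) : ℂ)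
      rwa [Complex.norm_real, Real.norm_eq_abs, abs_of_pos (Real.exp_pos _)] at h
    have h3 : 2 * Real.exp (s / 2) ≤ ‖z - (Real.exp (s / 2) : ℝ)‖ := by linarith
    have h4 : 3 ≤ radiusSq s z := by
      rw [radiusSq]
      have h5 : (2 * Real.exp (s / 2)) ^ 2 ≤ ‖z - (Real.exp (s / 2) : ℝ)‖ ^ 2 := by gcongr
      have h6 : Real.exp (-s) * (2 * Real.exp (s / 2)) ^ 2 = 4 := by
        have : Real.exp (-s) * (Real.exp (s / 2) * Real.exp (s / 2)) = 1 := by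
          rw [← Real.exp_add, ← Real.exp_add, ← Real.exp_zero]; congr 1; ring
        linear_combination 4 * this
      have h7 := mul_le_mul_of_nonneg_left h5 (Real.exp_pos (-s)).le
      linarith
    rw [primitive, profile_of_ge h4]
    simp

/-- Far out in the end the twist moves the origin: it rotates it by one radian about `e^(s/2)`. -/
theorem twist_zero_ne_zero {s : ℝ} (hs : 2 ≤ s) : twist s 0 ≠ 0 := by
  have h1 : radiusSq s 0 = 1 := by
    rw [radiusSq, zero_sub, norm_neg, Complex.norm_real, Real.norm_eq_abs,
      abs_of_pos (Real.exp_pos _), sq, ← Real.exp_add, ← Real.exp_add, ← Real.exp_zero]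
    congr 1
    ring
  have h2 : angle s 0 = 1 := by rw [angle, h1, deriv_profile_one, cutoff_of_ge hs, one_mul]
  intro h
  rw [twist, h2, rotation] at h
  have h3 := congrArg Complex.im h
  simp only [Complex.ofReal_one, one_mul, zero_sub, mul_neg, Complex.add_im, Complex.ofReal_im,
    Complex.neg_im, Complex.mul_im, mul_zero, Complex.ofReal_re, zero_add,
    Complex.zero_im, neg_eq_zero, mul_eq_zero] at h3
  have h4 : (Complex.exp Complex.I).im = Real.sin 1 := by
    have := Complex.exp_ofReal_mul_I_im 1
    rwa [Complex.ofReal_one, one_mul] at this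
  rw [h4] at h3
  rcases h3 with h3 | h3
  · exact (Real.sin_pos_of_pos_of_lt_pi one_pos (by linarith [Real.pi_gt_three])).ne' h3
  · exact (Real.exp_pos _).ne' h3

theorem radiusSq_eq (s : ℝ) (z : ℂ) :
    radiusSq s z = Real.exp (-s) * ((z.re - Real.exp (s / 2)) ^ 2 + z.im ^ 2) := by
  rw [radiusSq, Complex.sq_norm, Complex.normSq_apply]
  simp only [Complex.sub_re, Complex.sub_im, Complex.ofReal_re, Complex.ofReal_im, sub_zero]
  ring

theorem rotation_re (θ s : ℝ) (z : ℂ) : (rotation θ s z).re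
    = Real.exp (s / 2) + (Real.cos θ * (z.re - Real.exp (s / 2)) - Real.sin θ * z.im) := by
  simp only [rotation, Complex.add_re, Complex.mul_re, Complex.exp_ofReal_mul_I_re,
    Complex.exp_ofReal_mul_I_im, Complex.sub_re, Complex.sub_im, Complex.ofReal_re,
    Complex.ofReal_im, sub_zero]

theorem rotation_im (θ s : ℝ) (z : ℂ) : (rotation θ s z).im
    = Real.cos θ * z.im + Real.sin θ * (z.re - Real.exp (s / 2)) := by
  simp only [rotation, Complex.add_im, Complex.mul_im, Complex.exp_ofReal_mul_I_re,
    Complex.exp_ofReal_mul_I_im, Complex.sub_re, Complex.sub_im, Complex.ofReal_re,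
    Complex.ofReal_im, sub_zero, zero_add]

/-- The identity of one-forms `e^s da + G^* β = β + df` on `ℝ × ℂ`, for the form
`β = (1/2) (x dy - y dx)` of the plane, the twist `G`, the shift `a` and the primitive `f`; here it
is evaluated on the velocity of a curve `(S, Z)`. It says that the lift of the twist by the Reeb
flow for time `a` changes the Liouville form by `df`. -/
theorem liouvilleForm_change {S : ℝ → ℝ} {Z : ℝ → ℂ} {σ t da df : ℝ} {w dG : ℂ}
    (hS : HasDerivAt S σ t) (hZ : HasDerivAt Z w t)
    (ha : HasDerivAt (fun t => shift (S t) (Z t)) da t)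
    (hf : HasDerivAt (fun t => primitive (S t) (Z t)) df t)
    (hG : HasDerivAt (fun t => twist (S t) (Z t)) dG t) :
    Real.exp (S t) * da
      + 1 / 2 * ((twist (S t) (Z t)).re * dG.im - (twist (S t) (Z t)).im * dG.re)
      = 1 / 2 * ((Z t).re * w.im - (Z t).im * w.re) + df := by
  have hx : HasDerivAt (fun t => (Z t).re) w.re t := Complex.reCLM.hasFDerivAt.comp_hasDerivAt t hZ
  have hy : HasDerivAt (fun t => (Z t).im) w.im t := Complex.imCLM.hasFDerivAt.comp_hasDerivAt t hZ
  have hG1 : HasDerivAt (fun t => (twist (S t) (Z t)).re) dG.re t :=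
    Complex.reCLM.hasFDerivAt.comp_hasDerivAt t hG
  have hG2 : HasDerivAt (fun t => (twist (S t) (Z t)).im) dG.im t :=
    Complex.imCLM.hasFDerivAt.comp_hasDerivAt t hG
  have hρ : HasDerivAt (fun t => Real.exp (S t / 2)) (Real.exp (S t / 2) * (σ / 2)) t :=
    (hS.div_const 2).exp
  have hr : HasDerivAt (fun t => Real.exp (-S t / 2)) (Real.exp (-S t / 2) * (-σ / 2)) t :=
    (hS.neg.div_const 2).exp
  have he : HasDerivAt (fun t => Real.exp (S t)) (Real.exp (S t) * σ) t := hS.exp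
  have hχ : HasDerivAt (fun t => cutoff (S t)) (deriv cutoff (S t) * σ) t :=
    ((contDiff_cutoff.differentiable (by simp)).differentiableAt.hasDerivAt).comp t hS
  have hχ1 : HasDerivAt (fun t => deriv cutoff (S t)) (deriv (deriv cutoff) (S t) * σ) t :=
    ((contDiff_deriv_cutoff.differentiable (by simp)).differentiableAt.hasDerivAt).comp t hS
  have hκ := (hS.neg.exp).mul (((hx.sub hρ).pow 2).add (hy.pow 2))
  obtain ⟨k', hκ'⟩ : ∃ k', HasDerivAt (fun t => radiusSq (S t) (Z t)) k' t :=
    ⟨_, hκ.congr_of_eventuallyEq (Eventually.of_forall fun t => radiusSq_eq (S t) (Z t))⟩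
  have hb : HasDerivAt (fun t => profile (radiusSq (S t) (Z t)))
      (deriv profile (radiusSq (S t) (Z t)) * k') t :=
    ((contDiff_profile.differentiable (by simp)).differentiableAt.hasDerivAt).comp t hκ'
  have hβ : HasDerivAt (fun t => deriv profile (radiusSq (S t) (Z t)))
      (deriv (deriv profile) (radiusSq (S t) (Z t)) * k') t :=
    ((contDiff_deriv_profile.differentiable (by simp)).differentiableAt.hasDerivAt).comp t hκ'
  have hB : HasDerivAt (fun t => angle (S t) (Z t)) _ t := hχ.mul hβ
  have hG1' := hG1.unique ((hρ.add ((hB.cos.mul (hx.sub hρ)).sub (hB.sin.mul hy))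
    ).congr_of_eventuallyEq (Eventually.of_forall fun t => rotation_re _ (S t) (Z t)))
  have hG2' := hG2.unique (((hB.cos.mul hy).add (hB.sin.mul (hx.sub hρ))
    ).congr_of_eventuallyEq (Eventually.of_forall fun t => rotation_im _ (S t) (Z t)))
  have ha' := ha.unique (((((hχ1.add hχ).mul hb).sub (hχ.mul (hκ'.mul hβ))).const_mul (1 / 2)).sub
    ((hr.mul (hG2.sub hy)).const_mul (1 / 2)))
  have hf' := hf.unique ((hχ1.mul (he.mul hb)).const_mul (1 / 2))
  have e1 : Real.exp (S t) = Real.exp (S t / 2) ^ 2 := by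
    rw [sq, ← Real.exp_add]; congr 1; ring
  have e2 : Real.exp (S t / 2) * Real.exp (-S t / 2) = 1 := by
    rw [← Real.exp_add, ← Real.exp_zero]; congr 1; ring
  have e3 : radiusSq (S t) (Z t) * Real.exp (S t / 2) ^ 2
      = ((Z t).re - Real.exp (S t / 2)) ^ 2 + (Z t).im ^ 2 := by
    have h : Real.exp (-S t) * Real.exp (S t / 2) ^ 2 = 1 := by
      rw [← e1, ← Real.exp_add, ← Real.exp_zero]; congr 1; ring
    rw [radiusSq_eq]
    linear_combination (((Z t).re - Real.exp (S t / 2)) ^ 2 + (Z t).im ^ 2) * h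
  have e4 := Real.sin_sq_add_cos_sq (angle (S t) (Z t))
  rw [ha', hf', hG1', hG2', twist, rotation_re, rotation_im]
  simp only [Pi.add_apply, Pi.sub_apply, Pi.mul_apply]
  rw [twist, rotation_im, e1]
  generalize Real.exp (S t / 2) = ρ at *
  generalize Real.exp (-S t / 2) = r at *
  generalize deriv (deriv profile) (radiusSq (S t) (Z t)) = β₁ at *
  generalize deriv profile (radiusSq (S t) (Z t)) = β at *
  generalize profile (radiusSq (S t) (Z t)) = b at *
  generalize radiusSq (S t) (Z t) = κ at *
  generalize Real.cos (angle (S t) (Z t)) = c at *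
  generalize Real.sin (angle (S t) (Z t)) = q at *
  generalize deriv (deriv cutoff) (S t) = χ₂ at *
  generalize deriv cutoff (S t) = χ₁ at *
  generalize cutoff (S t) = χ at *
  generalize (Z t).re = x at *
  generalize (Z t).im = y at *
  -- a polynomial identity modulo `sin² + cos² = 1`, `e^(s/2) e^(-s/2) = 1` and the definition of
  -- `radiusSq`
  linear_combination (1 / 2 * (((x - ρ) * w.im - y * (w.re - ρ * (σ / 2)))
    + (χ₁ * σ * β + χ * (β₁ * k')) * ((x - ρ) ^ 2 + y ^ 2))) * e4
    - 1 / 2 * (χ₁ * σ * β + χ * (β₁ * k')) * e3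
    - 1 / 2 * ρ * (-q * (χ₁ * σ * β + χ * (β₁ * k')) * y + c * w.im
      + (c * (χ₁ * σ * β + χ * (β₁ * k')) * (x - ρ) + q * (w.re - ρ * (σ / 2))) - w.im
      - σ / 2 * (c * y + q * (x - ρ) - y)) * e2

end CollarTwist

/-! ### A symplectomorphism that displaces the zero section at infinity -/

section ReebFlow

open Filter Topology

variable {E' : Type*} [NormedAddCommGroup E'] [NormedSpace ℝ E'] [FiniteDimensional ℝ E']
  {H' : Type*} [TopologicalSpace H'] {J : ModelWithCorners ℝ E' H'} [J.Boundaryless]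
  {Y : Type*} [TopologicalSpace Y] [ChartedSpace H' Y] [IsManifold J ∞ Y]
  {al : OneForm J Y}

/-- The Reeb flow of a contact form on a compact manifold: it preserves the contact form, and the
form is `1` on its generator. -/
theorem OneForm.IsContact.exists_reebFlow [T2Space Y] [CompactSpace Y] (hal : al.IsContact) :
    ∃ (X : (y : Y) → TangentSpace J y) (φ : ℝ → Y → Y), IsSmoothFlow X φ ∧
      (∀ y, al y (X y) = 1) ∧
      ∀ (t : ℝ) (y : Y) (v : TangentSpace J y), al (φ t y) (mfderiv J J (φ t) y v) = al y v := by
  obtain ⟨X, hXs, hX⟩ := OneForm.exists_dualVectorField hal.smooth 1 (fun y u h => by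
    have h0 : al y u = 0 := by
      have h1 := h u
      rw [OneForm.d_self, zero_add, one_mul] at h1
      exact mul_self_eq_zero.1 h1
    exact hal.nondegenerate y u h0 fun v _ => by simpa [h0] using h v)
  have h1 : ∀ y, al y (X y) = 1 := by
    intro y
    have h2 := hX y (X y)
    rw [OneForm.d_self, zero_add, one_mul] at h2
    by_contra hne
    have h0 : al y (X y) = 0 := by
      by_contra h0
      exact hne (mul_right_cancel₀ h0 (h2.trans (one_mul _).symm))
    have h3 : ∀ v, al.d y (X y) v = al y v := fun v => by simpa [h0] using hX y v
    have h4 : X y = 0 := hal.nondegenerate y (X y) h0 fun v hv => by rw [h3, hv]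
    refine hal.ne_zero y (ContinuousLinearMap.ext fun v => ?_)
    rw [← h3 v, h4]
    exact OneForm.d_zero_left _ _ _
  have h2 : ∀ y v, al.d y (X y) v = 0 * al y v := fun y v => by
    have h3 := hX y v
    rw [h1] at h3
    linarith
  obtain ⟨ε, hε, hK⟩ := (isCompact_univ (X := Y)).exists_uniform_isMIntegralCurveOn hXs
  obtain ⟨φ, hφ⟩ := exists_isSmoothFlow hXs hε fun y => hK y (mem_univ y)
  refine ⟨X, φ, hφ, h1, fun t y v => ?_⟩
  rw [OneForm.isSmoothFlow_pullback hal.smooth hφ h1 h2, zero_mul, Real.exp_zero, one_mul]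

end ReebFlow

section Displacement

open Filter Topology CollarTwist

variable {E : Type*} [NormedAddCommGroup E] [NormedSpace ℝ E] [FiniteDimensional ℝ E]
  {H : Type*} [TopologicalSpace H] {I : ModelWithCorners ℝ E H} [I.Boundaryless]
  {W : Type*} [TopologicalSpace W] [ChartedSpace H W] [IsManifold I ∞ W]
  {E' : Type*} [NormedAddCommGroup E'] [NormedSpace ℝ E'] [FiniteDimensional ℝ E']
  {H' : Type*} [TopologicalSpace H'] {J : ModelWithCorners ℝ E' H'} [J.Boundaryless]
  {Y : Type*} [TopologicalSpace Y] [ChartedSpace H' Y] [IsManifold J ∞ Y]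
  {lam : OneForm I W} {al : OneForm J Y}

theorem contMDiff_end_comp {EN : Type*} [NormedAddCommGroup EN] [NormedSpace ℝ EN] {f : ℝ × ℂ → EN}
    (hf : ContDiff ℝ ∞ f) :
    ContMDiff ((J.prod 𝓘(ℝ, ℝ)).prod 𝓘(ℝ, ℂ)) 𝓘(ℝ, EN) ∞
      (fun q : (Y × ℝ) × ℂ => f (q.1.2, q.2)) := by
  have h1 : ContMDiff ((J.prod 𝓘(ℝ, ℝ)).prod 𝓘(ℝ, ℂ)) 𝓘(ℝ, ℝ × ℂ) ∞
      (fun q : (Y × ℝ) × ℂ => (q.1.2, q.2)) :=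
    ContMDiff.prodMk_space (contMDiff_snd.comp contMDiff_fst) contMDiff_snd
  exact hf.contMDiff.comp h1

theorem hasMFDerivAt_end_comp {EN : Type*} [NormedAddCommGroup EN] [NormedSpace ℝ EN]
    {f : ℝ × ℂ → EN} (hf : ContDiff ℝ ∞ f) (q : (Y × ℝ) × ℂ) :
    HasMFDerivAt ((J.prod 𝓘(ℝ, ℝ)).prod 𝓘(ℝ, ℂ)) 𝓘(ℝ, EN)
      (fun q : (Y × ℝ) × ℂ => f (q.1.2, q.2)) q
      ((fderiv ℝ f (q.1.2, q.2)).comp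
        (((ContinuousLinearMap.snd ℝ E' ℝ).comp (ContinuousLinearMap.fst ℝ (E' × ℝ) ℂ)).prod
          (ContinuousLinearMap.snd ℝ (E' × ℝ) ℂ)) : (E' × ℝ) × ℂ →L[ℝ] EN) := by
  have h1 : HasMFDerivAt ((J.prod 𝓘(ℝ, ℝ)).prod 𝓘(ℝ, ℂ)) 𝓘(ℝ, ℝ)
      (fun q : (Y × ℝ) × ℂ => q.1.2) q
      ((ContinuousLinearMap.snd ℝ E' ℝ).comp (ContinuousLinearMap.fst ℝ (E' × ℝ) ℂ)) :=
    HasMFDerivAt.comp (g := Prod.snd) q (hasMFDerivAt_snd q.1) (hasMFDerivAt_fst q)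
  have h2 : HasMFDerivAt ((J.prod 𝓘(ℝ, ℝ)).prod 𝓘(ℝ, ℂ)) 𝓘(ℝ, ℂ)
      (fun q : (Y × ℝ) × ℂ => q.2) q (ContinuousLinearMap.snd ℝ (E' × ℝ) ℂ) := hasMFDerivAt_snd q
  have h3 : HasMFDerivAt ((J.prod 𝓘(ℝ, ℝ)).prod 𝓘(ℝ, ℂ)) 𝓘(ℝ, ℝ × ℂ)
      (fun q : (Y × ℝ) × ℂ => (q.1.2, q.2)) q
      ((((ContinuousLinearMap.snd ℝ E' ℝ).comp (ContinuousLinearMap.fst ℝ (E' × ℝ) ℂ)).prod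
          (ContinuousLinearMap.snd ℝ (E' × ℝ) ℂ)) : (E' × ℝ) × ℂ →L[ℝ] ℝ × ℂ) :=
    ⟨h1.1.prodMk h2.1, h1.2.prodMk h2.2⟩
  have h4 : HasMFDerivAt 𝓘(ℝ, ℝ × ℂ) 𝓘(ℝ, EN) f (q.1.2, q.2) (fderiv ℝ f (q.1.2, q.2)) :=
    ((hf.differentiable (by simp)).differentiableAt.hasFDerivAt).hasMFDerivAt
  exact HasMFDerivAt.comp (g := f) q h4 h3

/-- The infinitesimal version of `CollarTwist.liouvilleForm_change`. -/
theorem CollarTwist.fderiv_liouvilleForm_change (s : ℝ) (z : ℂ) (v : ℝ × ℂ) :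
    Real.exp s * fderiv ℝ (fun p : ℝ × ℂ => shift p.1 p.2) (s, z) v
      + OneForm.stdComplex (twist s z) (fderiv ℝ (fun p : ℝ × ℂ => twist p.1 p.2) (s, z) v : ℂ)
      = OneForm.stdComplex z v.2 + fderiv ℝ (fun p : ℝ × ℂ => primitive p.1 p.2) (s, z) v := by
  have hline : ∀ {EN : Type} [NormedAddCommGroup EN] [NormedSpace ℝ EN] {f : ℝ × ℂ → EN},
      ContDiff ℝ ∞ f → HasDerivAt (fun t : ℝ => f (s + t * v.1, z + t • v.2))
        (fderiv ℝ f (s, z) v) 0 := by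
    intro EN _ _ f hf
    have h1 : HasDerivAt (fun t : ℝ => (s + t * v.1, z + t • v.2)) v 0 := by
      have h2 : HasDerivAt (fun t : ℝ => s + t * v.1) v.1 0 := by
        simpa using ((hasDerivAt_id (0 : ℝ)).mul_const v.1).const_add s
      have h3 : HasDerivAt (fun t : ℝ => z + t • v.2) v.2 0 := by
        simpa using ((hasDerivAt_id (0 : ℝ)).smul_const v.2).const_add z
      exact h2.prodMk h3
    have h4 : HasFDerivAt f (fderiv ℝ f (s, z)) (s + 0 * v.1, z + (0 : ℝ) • v.2) := by
      simpa using (hf.differentiable (by simp)).differentiableAt.hasFDerivAt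
    exact h4.comp_hasDerivAt 0 h1
  have h := liouvilleForm_change (hline contDiff_fst) (hline contDiff_snd) (hline contDiff_shift)
    (hline contDiff_primitive) (hline contDiff_twist)
  have h1 : fderiv ℝ (Prod.snd : ℝ × ℂ → ℂ) (s, z) v = v.2 := by rw [fderiv_snd]; rfl
  rw [h1] at h
  simp only [zero_mul, add_zero, zero_smul] at h
  rw [OneForm.stdComplex_apply, OneForm.stdComplex_apply]
  exact h

end Displacement

section DisplacementMap

open Filter Topology CollarTwist

variable {E : Type*} [NormedAddCommGroup E] [NormedSpace ℝ E] [FiniteDimensional ℝ E]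
  {H : Type*} [TopologicalSpace H] {I : ModelWithCorners ℝ E H} [I.Boundaryless]
  {W : Type*} [TopologicalSpace W] [ChartedSpace H W] [IsManifold I ∞ W]
  {E' : Type*} [NormedAddCommGroup E'] [NormedSpace ℝ E'] [FiniteDimensional ℝ E']
  {H' : Type*} [TopologicalSpace H'] {J : ModelWithCorners ℝ E' H'} [J.Boundaryless]
  {Y : Type*} [TopologicalSpace Y] [ChartedSpace H' Y] [IsManifold J ∞ Y]
  {lam : OneForm I W} {al : OneForm J Y}

/-- The map `(y, s, z) ↦ (φ_{τ(s, z)} y, s, G(s, z))` of the end of the stabilization, for a flow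
`φ` on `Y`. -/
def endMap (e : ConvexEnd lam al) (φ : ℝ → Y → Y) (τ : ℝ × ℂ → ℝ) (G : ℝ × ℂ → ℂ)
    (q : (Y × ℝ) × ℂ) : W × ℂ :=
  (e.emb (φ (τ (q.1.2, q.2)) q.1.1, q.1.2), G (q.1.2, q.2))

theorem contMDiffAt_endMap (e : ConvexEnd lam al) {X : (y : Y) → TangentSpace J y} {φ : ℝ → Y → Y}
    (hφ : IsSmoothFlow X φ) {τ : ℝ × ℂ → ℝ} {G : ℝ × ℂ → ℂ} (hτ : ContDiff ℝ ∞ τ)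
    (hG : ContDiff ℝ ∞ G) (y : Y) {s : ℝ} (z : ℂ) (hs : 0 < s) :
    ContMDiffAt ((J.prod 𝓘(ℝ, ℝ)).prod 𝓘(ℝ, ℂ)) (I.prod 𝓘(ℝ, ℂ)) ∞ (endMap e φ τ G)
      ((y, s), z) := by
  have h1 : ContMDiff ((J.prod 𝓘(ℝ, ℝ)).prod 𝓘(ℝ, ℂ)) J ∞
      (fun q : (Y × ℝ) × ℂ => φ (τ (q.1.2, q.2)) q.1.1) :=
    hφ.contMDiff.comp ((contMDiff_end_comp hτ).prodMk (contMDiff_fst.comp contMDiff_fst))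
  have h2 : ContMDiff ((J.prod 𝓘(ℝ, ℝ)).prod 𝓘(ℝ, ℂ)) (J.prod 𝓘(ℝ, ℝ)) ∞
      (fun q : (Y × ℝ) × ℂ => (φ (τ (q.1.2, q.2)) q.1.1, q.1.2)) :=
    h1.prodMk (contMDiff_snd.comp contMDiff_fst)
  have h3 := ContMDiffAt.comp (I' := J.prod 𝓘(ℝ, ℝ)) (g := e.emb)
    (f := fun q : (Y × ℝ) × ℂ => (φ (τ (q.1.2, q.2)) q.1.1, q.1.2)) ((y, s), z)
    (e.contMDiffAt_emb (φ (τ (s, z)) y) hs) h2.contMDiffAt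
  exact h3.prodMk (contMDiff_end_comp hG).contMDiffAt

/-- The pullback of the stabilized form under `endMap`, for a flow that preserves the contact form
and on whose generator the contact form is `1`. -/
theorem stabilization_mfderiv_endMap (e : ConvexEnd lam al) {X : (y : Y) → TangentSpace J y}
    {φ : ℝ → Y → Y} (hφ : IsSmoothFlow X φ) (h1 : ∀ y, al y (X y) = 1)
    (hpres : ∀ (t : ℝ) (y : Y) (v : TangentSpace J y),
      al (φ t y) (mfderiv J J (φ t) y v) = al y v)
    {τ : ℝ × ℂ → ℝ} {G : ℝ × ℂ → ℂ} (hτ : ContDiff ℝ ∞ τ) (hG : ContDiff ℝ ∞ G)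
    (y : Y) {s : ℝ} (z : ℂ) (hs : 0 < s) (u : (E' × ℝ) × ℂ) :
    lam.stabilization (endMap e φ τ G ((y, s), z))
      (mfderiv ((J.prod 𝓘(ℝ, ℝ)).prod 𝓘(ℝ, ℂ)) (I.prod 𝓘(ℝ, ℂ)) (endMap e φ τ G) ((y, s), z) u)
      = Real.exp s * (al y u.1.1 + fderiv ℝ τ (s, z) (u.1.2, u.2))
        + OneForm.stdComplex (G (s, z)) (fderiv ℝ G (s, z) (u.1.2, u.2) : ℂ) := by
  let q : (Y × ℝ) × ℂ := ((y, s), z)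
  have hA : HasMFDerivAt ((J.prod 𝓘(ℝ, ℝ)).prod 𝓘(ℝ, ℂ)) J (fun q : (Y × ℝ) × ℂ => q.1.1) q
      ((ContinuousLinearMap.fst ℝ E' ℝ).comp (ContinuousLinearMap.fst ℝ (E' × ℝ) ℂ)) :=
    HasMFDerivAt.comp (g := Prod.fst) q (hasMFDerivAt_fst q.1) (hasMFDerivAt_fst q)
  have hS : HasMFDerivAt ((J.prod 𝓘(ℝ, ℝ)).prod 𝓘(ℝ, ℂ)) 𝓘(ℝ, ℝ)
      (fun q : (Y × ℝ) × ℂ => q.1.2) q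
      ((ContinuousLinearMap.snd ℝ E' ℝ).comp (ContinuousLinearMap.fst ℝ (E' × ℝ) ℂ)) :=
    HasMFDerivAt.comp (g := Prod.snd) q (hasMFDerivAt_snd q.1) (hasMFDerivAt_fst q)
  have hm := hA.prodMk (hasMFDerivAt_end_comp (J := J) hτ q)
  have hΘ : HasMFDerivAt (J.prod 𝓘(ℝ, ℝ)) J (fun p : Y × ℝ => φ p.2 p.1) (y, τ (s, z)) _ :=
    ((hφ.contMDiff_flowOut (f := id) (J := J) contMDiff_id).contMDiffAt.mdifferentiableAt
      (by simp)).hasMFDerivAt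
  have hΘm := HasMFDerivAt.comp (g := fun p : Y × ℝ => φ p.2 p.1) q hΘ hm
  have hb := hΘm.prodMk hS
  have hemb : HasMFDerivAt (J.prod 𝓘(ℝ, ℝ)) I e.emb (φ (τ (s, z)) y, s) _ :=
    ((e.contMDiffAt_emb (φ (τ (s, z)) y) hs).mdifferentiableAt (by simp)).hasMFDerivAt
  have hfst := HasMFDerivAt.comp (g := e.emb) q hemb hb
  have hall := (hfst.prodMk (hasMFDerivAt_end_comp (J := J) hG q)).mfderiv
  have hall' := DFunLike.congr_fun hall u
  refine (congrArg (lam.stabilization _) hall').trans ?_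
  refine (OneForm.stabilization_apply lam _ _).trans ?_
  refine congrArg₂ (· + ·) ?_ rfl
  refine (e.pullback_emb_apply (φ (τ (s, z)) y) hs _).trans ?_
  refine congrArg (fun r => Real.exp s * r) ?_
  have h2 := hφ.mfderiv_flowOut (J := J) (f := id) (y := y) contMDiffAt_id (τ (s, z)) u.1.1
    (fderiv ℝ τ (s, z) (u.1.2, u.2))
  have key : ∀ (D : E' →L[ℝ] ℝ) (a b c : E') (r : ℝ), a = b + r • c → D c = 1 →
      D a = D b + r := by
    rintro D _ b c r rfl h
    rw [map_add, map_smul, h, smul_eq_mul, mul_one]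
  refine (key (al (φ (τ (s, z)) y)) _ _ _ _ h2 (h1 _)).trans ?_
  refine congrArg (· + fderiv ℝ τ (s, z) (u.1.2, u.2)) ?_
  refine Eq.trans ?_ (hpres (τ (s, z)) y u.1.1)
  have h3 : (mfderiv J J (id : Y → Y) y : E' →L[ℝ] E') = ContinuousLinearMap.id ℝ E' := mfderiv_id
  exact congrArg (fun L : E' →L[ℝ] E' => al (φ (τ (s, z)) y)
    (mfderiv J J (φ (τ (s, z))) y (L u.1.1))) h3

end DisplacementMap

section DisplacementDiffeo

open Filter Topology CollarTwist

variable {E : Type*} [NormedAddCommGroup E] [NormedSpace ℝ E] [FiniteDimensional ℝ E]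
  {H : Type*} [TopologicalSpace H] {I : ModelWithCorners ℝ E H} [I.Boundaryless]
  {W : Type*} [TopologicalSpace W] [ChartedSpace H W] [IsManifold I ∞ W] [T2Space W]
  {E' : Type*} [NormedAddCommGroup E'] [NormedSpace ℝ E'] [FiniteDimensional ℝ E']
  {H' : Type*} [TopologicalSpace H'] {J : ModelWithCorners ℝ E' H'} [J.Boundaryless]
  {Y : Type*} [TopologicalSpace Y] [ChartedSpace H' Y] [IsManifold J ∞ Y] [T2Space Y]
  [CompactSpace Y] {lam : OneForm I W} {al : OneForm J Y}

/-- A diffeomorphism of the stabilization that preserves the symplectic form, preserves the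
Liouville form outside of a compact set `A × closedBall 0 R`, and displaces `W × {0}` from itself
outside of this compact set. -/
theorem exists_displacement (hlam : lam.Smooth) (hal : al.IsContact) (e : ConvexEnd lam al) :
    ∃ (g : (W × ℂ) ≃ₘ⟮I.prod 𝓘(ℝ, ℂ), I.prod 𝓘(ℝ, ℂ)⟯ (W × ℂ)) (A : Set W) (R : ℝ),
      IsCompact A ∧
      (∀ (x : W × ℂ) (u v : TangentSpace (I.prod 𝓘(ℝ, ℂ)) x),
        lam.stabilization.d (g x) (mfderiv (I.prod 𝓘(ℝ, ℂ)) (I.prod 𝓘(ℝ, ℂ)) g x u)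
          (mfderiv (I.prod 𝓘(ℝ, ℂ)) (I.prod 𝓘(ℝ, ℂ)) g x v) = lam.stabilization.d x u v) ∧
      (∀ x ∉ A ×ˢ Metric.closedBall (0 : ℂ) R, ∀ v : TangentSpace (I.prod 𝓘(ℝ, ℂ)) x,
        lam.stabilization (g x) (mfderiv (I.prod 𝓘(ℝ, ℂ)) (I.prod 𝓘(ℝ, ℂ)) g x v)
          = lam.stabilization x v) ∧
      ∀ x : W × ℂ, x.2 = 0 → (g x).2 = 0 → x ∈ A ×ˢ Metric.closedBall (0 : ℂ) R := by
  obtain ⟨X, φ, hφ, h1, hpres⟩ := hal.exists_reebFlow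
  -- the Reeb time of the inverse map
  let τ' : ℝ × ℂ → ℝ := fun p => -shift p.1 (twistInv p.1 p.2)
  have hτ' : ContDiff ℝ ∞ τ' := (contDiff_shift.comp (contDiff_fst.prodMk contDiff_twistInv)).neg
  obtain ⟨g, hg, hgend, hgout⟩ := e.exists_contMDiff_extension (Q := ℂ) (IQ := 𝓘(ℝ, ℂ))
    (k := endMap e φ (fun p => shift p.1 p.2) (fun p => twist p.1 p.2)) (k₀ := id) contMDiff_id
    (fun y s z hs => contMDiffAt_endMap e hφ contDiff_shift contDiff_twist y z hs)
    (fun y s z _ hs => by simp [endMap, shift_of_le hs, twist_of_le hs, hφ.zero])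
  obtain ⟨g', hg', hgend', hgout'⟩ := e.exists_contMDiff_extension (Q := ℂ) (IQ := 𝓘(ℝ, ℂ))
    (k := endMap e φ τ' (fun p => twistInv p.1 p.2)) (k₀ := id) contMDiff_id
    (fun y s z hs => contMDiffAt_endMap e hφ hτ' contDiff_twistInv y z hs)
    (fun y s z _ hs => by simp [endMap, τ', shift_of_le hs, twistInv_of_le hs, hφ.zero])
  obtain ⟨F, hF, hFend, hFout⟩ := e.exists_contMDiff_extension (Q := ℂ) (IQ := 𝓘(ℝ, ℂ))
    (k := fun q : (Y × ℝ) × ℂ => primitive q.1.2 q.2) (k₀ := fun _ => (0 : ℝ)) contMDiff_const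
    (fun y s z hs => (contMDiff_end_comp contDiff_primitive).contMDiffAt)
    (fun y s z _ hs => primitive_of_le hs z)
  have hleft : Function.LeftInverse g' g := by
    rintro ⟨w, z⟩
    by_cases hw : w ∈ e.emb '' (univ ×ˢ Ici 1)
    · obtain ⟨⟨y, s⟩, ⟨-, hs⟩, rfl⟩ := hw
      have hs' : (0 : ℝ) < s := one_pos.trans_le hs
      rw [hgend y s z hs', endMap, hgend' _ _ _ hs', endMap]
      simp only [τ', twistInv_twist, hφ.neg_apply]
    · rw [hgout w z hw, id, hgout' w z hw, id]
  have hright : Function.RightInverse g' g := by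
    rintro ⟨w, z⟩
    by_cases hw : w ∈ e.emb '' (univ ×ˢ Ici 1)
    · obtain ⟨⟨y, s⟩, ⟨-, hs⟩, rfl⟩ := hw
      have hs' : (0 : ℝ) < s := one_pos.trans_le hs
      rw [hgend' y s z hs', endMap, hgend _ _ _ hs', endMap]
      simp only [τ', twist_twistInv, hφ.apply_neg]
    · rw [hgout' w z hw, id, hgout w z hw, id]
  -- the change of the Liouville form
  have hpull : ∀ x : W × ℂ, (OneForm.pullback (I := I.prod 𝓘(ℝ, ℂ)) g lam.stabilization x
      : E × ℂ →L[ℝ] ℝ)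
      = (lam.stabilization + OneForm.differential (I.prod 𝓘(ℝ, ℂ)) F) x := by
    rintro ⟨w, z⟩
    by_cases hw : w ∈ e.emb '' (univ ×ˢ Ici 1)
    · obtain ⟨⟨y, s⟩, ⟨-, hs⟩, rfl⟩ := hw
      have hs' : (0 : ℝ) < s := one_pos.trans_le hs
      let q : (Y × ℝ) × ℂ := ((y, s), z)
      let κ : (Y × ℝ) × ℂ → W × ℂ := fun q => (e.emb q.1, q.2)
      have hnear : ∀ᶠ q' : (Y × ℝ) × ℂ in 𝓝 q, 0 < q'.1.2 :=
        (isOpen_lt continuous_const (continuous_snd.comp continuous_fst)).mem_nhds hs'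
      have hemb : HasMFDerivAt (J.prod 𝓘(ℝ, ℝ)) I e.emb (y, s) _ :=
        ((e.contMDiffAt_emb y hs').mdifferentiableAt (by simp)).hasMFDerivAt
      have hκ := (HasMFDerivAt.comp (g := e.emb) q hemb
        (hasMFDerivAt_fst (I := J.prod 𝓘(ℝ, ℝ)) (I' := 𝓘(ℝ, ℂ)) q)).prodMk
        (hasMFDerivAt_snd (I := J.prod 𝓘(ℝ, ℝ)) (I' := 𝓘(ℝ, ℂ)) q)
      have hκd : MDifferentiableAt ((J.prod 𝓘(ℝ, ℝ)).prod 𝓘(ℝ, ℂ)) (I.prod 𝓘(ℝ, ℂ)) κ q :=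
        hκ.mdifferentiableAt
      refine ContinuousLinearMap.ext fun v => ?_
      obtain ⟨u₁, hu₁⟩ := e.surjective_mfderiv_emb y hs' v.1
      let u : (E' × ℝ) × ℂ := (u₁, v.2)
      have hu : mfderiv ((J.prod 𝓘(ℝ, ℝ)).prod 𝓘(ℝ, ℂ)) (I.prod 𝓘(ℝ, ℂ)) κ q u = v :=
        (DFunLike.congr_fun hκ.mfderiv u).trans (Prod.ext hu₁ rfl)
      have hgκ : mfderiv (I.prod 𝓘(ℝ, ℂ)) (I.prod 𝓘(ℝ, ℂ)) g (κ q) v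
          = mfderiv ((J.prod 𝓘(ℝ, ℝ)).prod 𝓘(ℝ, ℂ)) (I.prod 𝓘(ℝ, ℂ))
            (endMap e φ (fun p => shift p.1 p.2) (fun p => twist p.1 p.2)) q u := by
        have h2 := mfderiv_comp_apply q
          (hg.contMDiffAt.mdifferentiableAt (by simp) : MDifferentiableAt _ _ g (κ q)) hκd u
        have h3 : g ∘ κ =ᶠ[𝓝 q]
            endMap e φ (fun p => shift p.1 p.2) (fun p => twist p.1 p.2) := by
          filter_upwards [hnear] with q' hq'
          exact hgend q'.1.1 q'.1.2 q'.2 hq'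
        rw [h3.mfderiv_eq] at h2
        refine Eq.trans ?_ h2.symm
        exact congrArg (mfderiv (I.prod 𝓘(ℝ, ℂ)) (I.prod 𝓘(ℝ, ℂ)) g (κ q)) hu.symm
      have hFκ : OneForm.differential (I.prod 𝓘(ℝ, ℂ)) F (κ q) v
          = fderiv ℝ (fun p : ℝ × ℂ => primitive p.1 p.2) (s, z) (u.1.2, u.2) := by
        have h2 := mfderiv_comp_apply q
          (hF.contMDiffAt.mdifferentiableAt (by simp) : MDifferentiableAt _ _ F (κ q)) hκd u
        have h3 : F ∘ κ =ᶠ[𝓝 q] fun q : (Y × ℝ) × ℂ => primitive q.1.2 q.2 := by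
          filter_upwards [hnear] with q' hq'
          exact hFend q'.1.1 q'.1.2 q'.2 hq'
        rw [h3.mfderiv_eq] at h2
        refine Eq.trans ?_ (h2.symm.trans
          (DFunLike.congr_fun (hasMFDerivAt_end_comp (J := J) contDiff_primitive q).mfderiv u))
        exact congrArg (mfderiv (I.prod 𝓘(ℝ, ℂ)) 𝓘(ℝ, ℝ) F (κ q)) hu.symm
      have h2 := stabilization_mfderiv_endMap e hφ h1 hpres contDiff_shift contDiff_twist y z hs' u
      have h3 : lam.stabilization (κ q) v = Real.exp s * al y u₁.1 + OneForm.stdComplex z v.2 := by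
        refine (OneForm.stabilization_apply lam (κ q) v).trans ?_
        refine congrArg (· + OneForm.stdComplex z v.2) ?_
        exact (congrArg (lam (e.emb (y, s))) hu₁.symm).trans (e.pullback_emb_apply y hs' u₁)
      have h4 := fderiv_liouvilleForm_change s z (u.1.2, u.2)
      have h5 : lam.stabilization (g (κ q)) (mfderiv (I.prod 𝓘(ℝ, ℂ)) (I.prod 𝓘(ℝ, ℂ)) g (κ q) v)
          = Real.exp s * (al y u₁.1 + fderiv ℝ (fun p : ℝ × ℂ => shift p.1 p.2) (s, z) (u.1.2, u.2))
            + OneForm.stdComplex (twist s z)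
              (fderiv ℝ (fun p : ℝ × ℂ => twist p.1 p.2) (s, z) (u.1.2, u.2) : ℂ) := by
        have h6 : g (κ q) = endMap e φ (fun p => shift p.1 p.2) (fun p => twist p.1 p.2) q :=
          hgend y s z hs'
        refine Eq.trans ?_ h2
        have h7 := lam.stabilization.congr_point h6
        exact (congrArg (lam.stabilization (g (κ q))) hgκ).trans (DFunLike.congr_fun h7 _)
      refine h5.trans ?_
      refine Eq.trans ?_ (congrArg₂ (· + ·) h3 hFκ).symm
      simp only at h4
      linear_combination h4
    · have h2 : ∀ᶠ x : W × ℂ in 𝓝 (w, z), x.1 ∉ e.emb '' (univ ×ˢ Ici 1) :=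
        ((e.isClosed_image 1 one_pos).isOpen_compl.preimage continuous_fst).mem_nhds hw
      have h3 : g =ᶠ[𝓝 (w, z)] id := h2.mono fun x hx => hgout x.1 x.2 hx
      have h4 : F =ᶠ[𝓝 (w, z)] fun _ => 0 := h2.mono fun x hx => hFout x.1 x.2 hx
      have h5 : (OneForm.differential (I.prod 𝓘(ℝ, ℂ)) F (w, z) : E × ℂ →L[ℝ] ℝ) = 0 :=
        h4.mfderiv_eq.trans mfderiv_const
      refine (OneForm.pullback_congr lam.stabilization h3).trans ?_
      refine ContinuousLinearMap.ext fun v => ?_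
      refine Eq.trans ?_ ((congrArg (lam.stabilization (w, z) v + ·)
        (DFunLike.congr_fun h5 v)).trans (add_zero _)).symm
      exact congrArg (lam.stabilization (w, z))
        (DFunLike.congr_fun (mfderiv_id (I := I.prod 𝓘(ℝ, ℂ)) (x := (w, z))) v)
  let A : Set W := (e.emb '' (univ ×ˢ Ioi 2))ᶜ
  -- the radius of `primitive_of_norm_ge`
  let R : ℝ := 3 * Real.exp 1
  have hA : IsCompact A := e.isCompact_compl 2 two_pos
  have hK : IsClosed (A ×ˢ Metric.closedBall (0 : ℂ) R) :=
    hA.isClosed.prod Metric.isClosed_closedBall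
  refine ⟨⟨⟨g, g', hleft, hright⟩, hg, hg'⟩, A, R, hA, ?_, ?_, ?_⟩
  · intro x u v
    refine (OneForm.d_pullback hg.contMDiffAt
      (hlam.stabilization.differentiableAt_inChart _) u v).symm.trans ?_
    refine (OneForm.d_congr (Eventually.of_forall hpull) u v).trans ?_
    refine (OneForm.d_add (hlam.stabilization.differentiableAt_inChart x)
      (OneForm.differentiableAt_inChart_differential hF.contMDiffAt) u v).trans ?_
    rw [OneForm.d_differential hF.contMDiffAt, add_zero]
  · intro x hx v
    have h2 : F =ᶠ[𝓝 x] fun _ => 0 := by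
      filter_upwards [hK.isOpen_compl.mem_nhds hx] with x' hx'
      by_cases hw : x'.1 ∈ e.emb '' (univ ×ˢ Ici 1)
      · obtain ⟨⟨y, s⟩, ⟨-, hs⟩, hy⟩ := hw
        have h3 : F x' = primitive s x'.2 := by
          have h4 := hFend y s x'.2 (one_pos.trans_le hs)
          rw [hy] at h4
          exact h4
        rw [h3]
        by_cases hs2 : 2 ≤ s
        · exact primitive_of_ge hs2 _
        · refine primitive_of_norm_ge s (le_of_lt (not_le.1 fun h4 => hx' ⟨?_, ?_⟩))
          · rintro ⟨⟨y', s'⟩, ⟨-, hs'⟩, hy'⟩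
            have hs'' : (2 : ℝ) < s' := hs'
            have h5 := congrArg Prod.snd (e.eq_of_emb_eq (two_pos.trans hs'')
              (one_pos.trans_le hs) (hy'.trans hy.symm))
            simp only at h5
            rw [h5] at hs''
            exact hs2 hs''.le
          · rwa [mem_closedBall_zero_iff]
      · exact hFout x'.1 x'.2 hw
    have h5 : (OneForm.differential (I.prod 𝓘(ℝ, ℂ)) F x : E × ℂ →L[ℝ] ℝ) = 0 :=
      h2.mfderiv_eq.trans mfderiv_const
    refine (DFunLike.congr_fun (hpull x) v).trans ?_
    exact (congrArg (lam.stabilization x v + ·) (DFunLike.congr_fun h5 v)).trans (add_zero _)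
  · rintro ⟨w, z⟩ hz hgz
    have hz' : z = 0 := hz
    subst hz'
    refine ⟨?_, by simp [R, Real.exp_nonneg]⟩
    rintro ⟨⟨y, s⟩, ⟨-, hs⟩, rfl⟩
    have hs' : (2 : ℝ) < s := hs
    refine twist_zero_ne_zero hs'.le ?_
    have h2 := congrArg Prod.snd (hgend y s 0 (two_pos.trans hs'))
    exact h2.symm.trans hgz

end DisplacementDiffeo

/-! ### Positive loops of Hamiltonian diffeomorphisms -/

section HamiltonianLoop

open Filter Topology

variable {E : Type*} [NormedAddCommGroup E] [NormedSpace ℝ E] [FiniteDimensional ℝ E]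
  {H : Type*} [TopologicalSpace H] {I : ModelWithCorners ℝ E H} [I.Boundaryless]
  {M : Type*} [TopologicalSpace M] [ChartedSpace H M] [IsManifold I ∞ M]
  {lam : OneForm I M}

theorem Diffeomorph.mdifferentiableAt_apply (f : M ≃ₘ⟮I, I⟯ M) (x : M) :
    MDifferentiableAt I I f x :=
  f.contMDiff.contMDiffAt.mdifferentiableAt (by simp)

theorem Diffeomorph.surjective_mfderiv (f : M ≃ₘ⟮I, I⟯ M) (x : M) :
    Function.Surjective (mfderiv I I f x) := by
  intro w
  have hx : f.symm (f x) = x := f.symm_apply_apply x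
  have h1 := mfderiv_comp_apply (f x) (f.mdifferentiableAt_apply (f.symm (f x)))
    (f.symm.mdifferentiableAt_apply (f x)) w
  have h2 : (f : M → M) ∘ f.symm = id := by
    funext y; exact f.apply_symm_apply y
  rw [h2, mfderiv_id] at h1
  have key : ∀ y, y = x → ∀ z : E, (mfderiv I I f y : E →L[ℝ] E) z = w →
      ∃ v : E, (mfderiv I I f x : E →L[ℝ] E) v = w := by
    rintro y rfl z hz; exact ⟨z, hz⟩
  exact key _ hx _ h1.symm

namespace OneForm

/-- The map `f` preserves `d lam` at `x`. -/
def PreservesDAt (lam : OneForm I M) (f : M → M) (x : M) : Prop :=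
  ∀ u v : TangentSpace I x, lam.d (f x) (mfderiv I I f x u) (mfderiv I I f x v) = lam.d x u v

/-- The map `f` preserves `lam` at `x`. -/
def PreservesAt (lam : OneForm I M) (f : M → M) (x : M) : Prop :=
  ∀ v : TangentSpace I x, lam (f x) (mfderiv I I f x v) = lam x v

theorem PreservesDAt.comp {f g : M → M} {x : M} (hg : lam.PreservesDAt g (f x))
    (hf : lam.PreservesDAt f x) (hgd : MDifferentiableAt I I g (f x))
    (hfd : MDifferentiableAt I I f x) : lam.PreservesDAt (g ∘ f) x := by
  intro u v
  rw [mfderiv_comp_apply x hgd hfd, mfderiv_comp_apply x hgd hfd]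
  exact (hg _ _).trans (hf u v)

theorem PreservesAt.comp {f g : M → M} {x : M} (hg : lam.PreservesAt g (f x))
    (hf : lam.PreservesAt f x) (hgd : MDifferentiableAt I I g (f x))
    (hfd : MDifferentiableAt I I f x) : lam.PreservesAt (g ∘ f) x := by
  intro v
  rw [mfderiv_comp_apply x hgd hfd]
  exact (hg _).trans (hf v)

theorem mfderiv_symm_mfderiv (f : M ≃ₘ⟮I, I⟯ M) (x : M) (v : TangentSpace I x) :
    mfderiv I I f.symm (f x) (mfderiv I I f x v) = v := by
  have h1 := mfderiv_comp_apply x (f.symm.mdifferentiableAt_apply (f x))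
    (f.mdifferentiableAt_apply x) v
  have h2 : (f.symm : M → M) ∘ f = id := by
    funext y; exact f.symm_apply_apply y
  rw [h2, mfderiv_id] at h1
  exact h1.symm

theorem PreservesDAt.symm {f : M ≃ₘ⟮I, I⟯ M} {x : M} (hf : lam.PreservesDAt f x) :
    lam.PreservesDAt f.symm (f x) := by
  intro u v
  obtain ⟨u, rfl⟩ := f.surjective_mfderiv x u
  obtain ⟨v, rfl⟩ := f.surjective_mfderiv x v
  rw [hf u v]
  have key : ∀ y, y = x → ∀ a b : E, a = u → b = v → lam.d y a b = lam.d x u v := by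
    rintro y rfl a b rfl rfl; rfl
  exact key _ (f.symm_apply_apply x) _ _ (mfderiv_symm_mfderiv f x u) (mfderiv_symm_mfderiv f x v)

theorem PreservesAt.symm {f : M ≃ₘ⟮I, I⟯ M} {x : M} (hf : lam.PreservesAt f x) :
    lam.PreservesAt f.symm (f x) := by
  intro v
  obtain ⟨v, rfl⟩ := f.surjective_mfderiv x v
  rw [hf v]
  have key : ∀ y, y = x → ∀ a : E, a = v → lam y a = lam x v := by
    rintro y rfl a rfl; rfl
  exact key _ (f.symm_apply_apply x) _ (mfderiv_symm_mfderiv f x v)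

end OneForm

variable [T2Space M]

/-- The time-`t` map of a flow. -/
def IsSmoothFlow.diffeomorph {X : (x : M) → TangentSpace I x} {φ : ℝ → M → M}
    (hφ : IsSmoothFlow X φ) (t : ℝ) : M ≃ₘ⟮I, I⟯ M where
  toFun := φ t
  invFun := φ (-t)
  left_inv := hφ.neg_apply t
  right_inv := hφ.apply_neg t
  contMDiff_toFun := hφ.contMDiff_apply t
  contMDiff_invFun := hφ.contMDiff_apply (-t)

/-- The commutator-like loop `ρ_t g ρ_t g⁻¹`, for a circle action `ρ` with Hamiltonian `Q ≥ 0`, and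
a symplectomorphism `g`, exact at infinity, that displaces the zero set of `Q` from itself at
infinity: at infinity its Hamiltonian, `Q` plus a translate of `Q`, is positive. -/
theorem exists_positive_hamiltonianLoop (hlam : lam.Smooth) {X : (x : M) → TangentSpace I x}
    {ρ : ℝ → M → M} (hρ : IsSmoothFlow X ρ) (hper : ∀ x, ρ 1 x = x) {Q : M → ℝ}
    (hQ : ContMDiff I 𝓘(ℝ, ℝ) ∞ Q) (hQ0 : ∀ x, 0 ≤ Q x) (hQρ : ∀ t x, Q (ρ t x) = Q x)
    (hXQ : ∀ (x : M) (v : TangentSpace I x), lam.d x (X x) v = -OneForm.differential I Q x v)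
    (hlamX : ∀ x, lam x (X x) = Q x) (hρlam : ∀ t x, lam.PreservesAt (ρ t) x)
    {g : M ≃ₘ⟮I, I⟯ M} (hgd : ∀ x, lam.PreservesDAt g x) {K : Set M} (hK : IsCompact K)
    (hKρ : ∀ t, ∀ x ∉ K, ρ t x ∉ K) (hgK : ∀ x ∉ K, lam.PreservesAt g x)
    (hdisp : ∀ x, Q x = 0 → Q (g x) = 0 → x ∈ K) :
    ∃ psi : ℝ → (M ≃ₘ⟮I, I⟯ M), IsContactAtInfinityHamiltonianLoop lam psi ∧
      ∃ K' : Set M, IsCompact K' ∧ ∀ t, ∀ x ∉ K',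
        0 < lam (psi t x) (isotopyVelocity (I := I) (fun τ => psi τ) t x) := by
  have hρD : ∀ t x, lam.PreservesDAt (ρ t) x := by
    intro t x u v
    refine (OneForm.d_pullback (hρ.contMDiff_apply t).contMDiffAt
      (hlam.differentiableAt_inChart _) u v).symm.trans ?_
    exact OneForm.d_congr
      (Eventually.of_forall fun y => ContinuousLinearMap.ext fun w => hρlam t y w) u v
  let psi : ℝ → (M ≃ₘ⟮I, I⟯ M) := fun t =>
    g.symm.trans ((hρ.diffeomorph t).trans (g.trans (hρ.diffeomorph t)))
  have hpsi : ∀ t x, psi t x = ρ t (g (ρ t (g.symm x))) := fun t x => rfl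
  have hpsi' : ∀ t, (psi t : M → M) = ρ t ∘ g ∘ ρ t ∘ g.symm := fun t => rfl
  have hρd : ∀ t x, MDifferentiableAt I I (ρ t) x := fun t x =>
    (hρ.contMDiff_apply t).contMDiffAt.mdifferentiableAt (by simp)
  have hd1 : ∀ t x, MDifferentiableAt I I (ρ t ∘ g.symm) x := fun t x =>
    (hρd t _).comp x (g.symm.mdifferentiableAt_apply x)
  have hd2 : ∀ t x, MDifferentiableAt I I (g ∘ ρ t ∘ g.symm) x := fun t x =>
    (g.mdifferentiableAt_apply _).comp x (hd1 t x)
  have hsymm : ∀ x, lam.PreservesDAt g.symm x := by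
    intro x
    have h := (hgd (g.symm x)).symm
    rwa [g.apply_symm_apply] at h
  have hsympl : ∀ t x, lam.PreservesDAt (psi t) x := by
    intro t x
    have h2 : lam.PreservesDAt (ρ t ∘ g.symm) x :=
      (hρD t _).comp (hsymm x) (hρd t _) (g.symm.mdifferentiableAt_apply x)
    have h3 : lam.PreservesDAt (g ∘ ρ t ∘ g.symm) x :=
      (hgd _).comp h2 (g.mdifferentiableAt_apply _) (hd1 t x)
    rw [hpsi']
    exact (hρD t _).comp h3 (hρd t _) (hd2 t x)
  have hoff : ∀ x ∉ g '' K, g.symm x ∉ K := fun x hx h =>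
    hx ⟨_, h, g.apply_symm_apply x⟩
  have hexact : ∀ t, ∀ x ∉ g '' K, lam.PreservesAt (psi t) x := by
    intro t x hx
    have h1 : lam.PreservesAt g.symm x := by
      have h := (hgK (g.symm x) (hoff x hx)).symm
      rwa [g.apply_symm_apply] at h
    have h2 : lam.PreservesAt (ρ t ∘ g.symm) x :=
      (hρlam t _).comp h1 (hρd t _) (g.symm.mdifferentiableAt_apply x)
    have h3 : lam.PreservesAt (g ∘ ρ t ∘ g.symm) x :=
      OneForm.PreservesAt.comp (f := ρ t ∘ g.symm) (hgK _ (hKρ t _ (hoff x hx))) h2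
        (g.mdifferentiableAt_apply _) (hd1 t x)
    rw [hpsi']
    exact (hρlam t _).comp h3 (hρd t _) (hd2 t x)
  -- the velocity of the loop: both factors `ρ_t` in `ρ_t g ρ_t g⁻¹` contribute
  have hvel : ∀ t x, isotopyVelocity (I := I) (fun τ => psi τ) t x
      = (fun a b : E => a + b) (mfderiv I I (ρ t ∘ g) (ρ t (g.symm x)) (X (ρ t (g.symm x))))
        (X (psi t x)) := by
    intro t x
    let f : ℝ → M := fun τ => g (ρ τ (g.symm x))
    have hρt : MDifferentiableAt 𝓘(ℝ, ℝ) I (fun τ => ρ τ (g.symm x)) t :=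
      (hρ.isMIntegralCurve (g.symm x) t).mdifferentiableAt
    have hfs : ContMDiff 𝓘(ℝ, ℝ) I ∞ f := g.contMDiff.comp
      (hρ.contMDiff.comp (contMDiff_id.prodMk contMDiff_const))
    have hf : mfderiv 𝓘(ℝ, ℝ) I f t (1 : ℝ)
        = mfderiv I I g (ρ t (g.symm x)) (X (ρ t (g.symm x))) := by
      refine (mfderiv_comp_apply (f := fun τ => ρ τ (g.symm x)) (g := g) t
        (g.mdifferentiableAt_apply _) hρt (1 : ℝ)).trans ?_
      exact congrArg (mfderiv I I g (ρ t (g.symm x))) (hρ.mfderiv_time t (g.symm x))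
    have hdiag : HasMFDerivAt 𝓘(ℝ, ℝ) (𝓘(ℝ, ℝ).prod 𝓘(ℝ, ℝ)) (fun τ : ℝ => (τ, τ)) t
        ((ContinuousLinearMap.id ℝ ℝ).prod (ContinuousLinearMap.id ℝ ℝ) : ℝ →L[ℝ] ℝ × ℝ) :=
      (hasMFDerivAt_id t).prodMk (hasMFDerivAt_id t)
    have hfl := ((hρ.contMDiff_flowOut hfs).contMDiffAt (x := (t, t))).mdifferentiableAt (by simp)
    have h1 := HasMFDerivAt.comp (g := fun p : ℝ × ℝ => ρ p.2 (f p.1)) (f := fun τ : ℝ => (τ, τ))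
      t hfl.hasMFDerivAt hdiag
    have h2 := DFunLike.congr_fun h1.mfderiv (1 : ℝ)
    refine h2.trans ((hρ.mfderiv_flowOut hfs.contMDiffAt t 1 1).trans ?_)
    have h3 : (mfderiv I I (ρ t ∘ g) (ρ t (g.symm x)) : E →L[ℝ] E) (X (ρ t (g.symm x)))
        = (mfderiv I I (ρ t) (f t) : E →L[ℝ] E) ((mfderiv 𝓘(ℝ, ℝ) I f t : ℝ →L[ℝ] E) 1) := by
      refine (mfderiv_comp_apply (ρ t (g.symm x)) (hρd t _) (g.mdifferentiableAt_apply _)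
        (X (ρ t (g.symm x)))).trans ?_
      exact congrArg (mfderiv I I (ρ t) (f t)) hf.symm
    have key : ∀ a b c : E, a = b → b + (1 : ℝ) • c = a + c := by
      rintro a b c rfl
      rw [one_smul]
    exact key _ _ _ h3
  refine ⟨psi, ⟨⟨?_, ?_, ?_⟩, fun t x => hsympl t x, ?_, ?_⟩, g '' K, hK.image g.continuous, ?_⟩
  · have h1 : ContMDiff (𝓘(ℝ, ℝ).prod I) I ∞ (fun p : ℝ × M => ρ p.1 (g.symm p.2)) :=
      hρ.contMDiff.comp (contMDiff_fst.prodMk (g.symm.contMDiff.comp contMDiff_snd))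
    exact hρ.contMDiff.comp (contMDiff_fst.prodMk (g.contMDiff.comp h1))
  · intro t
    have h1 : ∀ x, ρ (t + 1) x = ρ t x := fun x => by rw [hρ.add, hper]
    ext x
    rw [hpsi, hpsi, h1, h1]
  · ext x
    rw [hpsi, hρ.zero, hρ.zero, g.apply_symm_apply]
    rfl
  -- the Hamiltonian is `Q` plus its translate by `ρ_t g`
  · refine ⟨fun t x => Q x + Q (g.symm (ρ (-t) x)), ?_, ?_⟩
    · have h1 : ContMDiff (𝓘(ℝ, ℝ).prod I) I ∞ (fun p : ℝ × M => ρ (-p.1) p.2) :=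
        hρ.contMDiff.comp (ContMDiff.prodMk (contDiff_neg.contMDiff.comp contMDiff_fst)
          contMDiff_snd)
      exact (hQ.comp contMDiff_snd).add (hQ.comp (g.symm.contMDiff.comp h1))
    · intro t x v
      let y := ρ t (g.symm x)
      let F : M ≃ₘ⟮I, I⟯ M := g.trans (hρ.diffeomorph t)
      have hF : ∀ x, F x = ρ t (g x) := fun x => rfl
      have hFd : lam.PreservesDAt F y :=
        (hρD t _).comp (hgd y) (hρd t _) (g.mdifferentiableAt_apply y)
      obtain ⟨v, rfl⟩ := F.surjective_mfderiv y v
      have hQF : ContMDiff I 𝓘(ℝ, ℝ) ∞ (fun x => Q (g.symm (ρ (-t) x))) :=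
        hQ.comp (g.symm.contMDiff.comp (hρ.contMDiff_apply (-t)))
      have h1 : mfderiv I 𝓘(ℝ, ℝ) (fun x => Q (g.symm (ρ (-t) x))) (F y) (mfderiv I I F y v)
          = OneForm.differential I Q y v := by
        refine (mfderiv_comp_apply y (hQF.contMDiffAt.mdifferentiableAt (by simp))
          (F.mdifferentiableAt_apply y) v).symm.trans ?_
        have h2 : (fun x => Q (g.symm (ρ (-t) x))) ∘ F = Q := by
          funext x
          change Q (g.symm (ρ (-t) (ρ t (g x)))) = Q x
          rw [hρ.neg_apply, g.symm_apply_apply]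
        rw [h2]; rfl
      have h3 : lam.d (F y) (mfderiv I I F y (X y)) (mfderiv I I F y v)
          = -OneForm.differential I Q y v := (hFd _ _).trans (hXQ y v)
      have h4 : lam.d (F y) (isotopyVelocity (I := I) (fun τ => psi τ) t x) (mfderiv I I F y v)
          = -OneForm.differential I Q y v
            + -OneForm.differential I Q (F y) (mfderiv I I F y v) := by
        refine (congrArg (fun a : E => lam.d (F y) a (mfderiv I I F y v)) (hvel t x)).trans ?_
        exact (OneForm.d_add_left lam (F y) _ _ _).trans (congrArg₂ (· + ·) h3 (hXQ (F y) _))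
      refine h4.trans ?_
      have h5 : mfderiv I 𝓘(ℝ, ℝ) (fun x => Q x + Q (g.symm (ρ (-t) x))) (F y) (mfderiv I I F y v)
          = OneForm.differential I Q (F y) (mfderiv I I F y v) + OneForm.differential I Q y v :=
        (DFunLike.congr_fun (mfderiv_add (hQ.contMDiffAt.mdifferentiableAt (by simp))
          (hQF.contMDiffAt.mdifferentiableAt (by simp))) _).trans
          (congrArg (OneForm.differential I Q (F y) (mfderiv I I F y v) + ·) h1)
      refine Eq.trans ?_ (congrArg (fun r : ℝ => -r) h5).symm
      ring
  · refine ⟨g '' K, hK.image g.continuous, fun t x hx z hz w => ?_⟩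
    obtain ⟨v, rfl⟩ := (psi t).surjective_mfderiv x w
    exact (hsympl t x z v).trans ((hz v).trans (hexact t x hx v).symm)
  · intro t x hx
    have hy : ρ t (g.symm x) ∉ K := hKρ t _ (hoff x hx)
    have h1 : lam.PreservesAt (ρ t ∘ g) (ρ t (g.symm x)) :=
      (hρlam t _).comp (hgK _ hy) (hρd t _) (g.mdifferentiableAt_apply _)
    have h2 : lam (psi t x) (isotopyVelocity (I := I) (fun τ => psi τ) t x)
        = Q (ρ t (g.symm x)) + Q (psi t x) := by
      refine (congrArg (lam (psi t x)) (hvel t x)).trans ?_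
      refine (map_add (lam (psi t x) : E →L[ℝ] ℝ) _ _).trans ?_
      exact congrArg₂ (· + ·) ((h1 _).trans (hlamX _)) (hlamX _)
    rw [h2]
    have h3 : Q (psi t x) = Q (g (ρ t (g.symm x))) := hQρ t _
    rw [h3]
    rcases (hQ0 (ρ t (g.symm x))).lt_or_eq with h | h
    · exact add_pos_of_pos_of_nonneg h (hQ0 _)
    · refine add_pos_of_nonneg_of_pos (hQ0 _) (lt_of_le_of_ne (hQ0 _) fun h' => hy ?_)
      exact hdisp _ h.symm h'.symm

end HamiltonianLoop

section RotationLoop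

open Filter Topology

variable {E : Type*} [NormedAddCommGroup E] [NormedSpace ℝ E] [FiniteDimensional ℝ E]
  {H : Type*} [TopologicalSpace H] {I : ModelWithCorners ℝ E H} [I.Boundaryless]
  {W : Type*} [TopologicalSpace W] [ChartedSpace H W] [IsManifold I ∞ W] [T2Space W]

theorem OneForm.stdComplex_mul_mul (c z w : ℂ) :
    OneForm.stdComplex (c * z) (c * w : ℂ) = Complex.normSq c * OneForm.stdComplex z w := by
  rw [stdComplex_apply, stdComplex_apply, Complex.normSq_apply]
  simp only [Complex.mul_re, Complex.mul_im]
  ring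

/-- The circle action on `W × ℂ` by rotation of the second factor. -/
noncomputable def rotationFlow (t : ℝ) (p : W × ℂ) : W × ℂ :=
  (p.1, Complex.exp ((2 * Real.pi * t : ℝ) * Complex.I) * p.2)

theorem isSmoothFlow_rotationFlow :
    IsSmoothFlow (I := I.prod 𝓘(ℝ, ℂ)) (M := W × ℂ)
      (fun p => ((0, (2 * Real.pi : ℝ) * Complex.I * p.2) : E × ℂ)) rotationFlow where
  contMDiff := by
    have h1 : ContMDiff (𝓘(ℝ, ℝ).prod (I.prod 𝓘(ℝ, ℂ))) 𝓘(ℝ, ℂ) ∞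
        (fun p : ℝ × (W × ℂ) => Complex.exp ((2 * Real.pi * p.1 : ℝ) * Complex.I)) := by
      have h2 : ContDiff ℝ ∞ fun t : ℝ => Complex.exp ((2 * Real.pi * t : ℝ) * Complex.I) :=
        ((Complex.ofRealCLM.contDiff.comp
          (by fun_prop : ContDiff ℝ ∞ fun t : ℝ => 2 * Real.pi * t)).mul contDiff_const).cexp
      exact h2.contMDiff.comp contMDiff_fst
    have h3 : ContDiff ℝ ∞ fun q : ℂ × ℂ => q.1 * q.2 := contDiff_fst.mul contDiff_snd
    exact (contMDiff_fst.comp contMDiff_snd).prodMk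
      (h3.contMDiff.comp (h1.prodMk_space (contMDiff_snd.comp contMDiff_snd)))
  zero p := by simp [rotationFlow]
  add s t p := by
    simp only [rotationFlow]
    rw [← mul_assoc, ← Complex.exp_add]
    congr 3
    push_cast
    ring
  isMIntegralCurve p t := by
    have h1 : HasDerivAt (fun t : ℝ => Complex.exp ((2 * Real.pi * t : ℝ) * Complex.I) * p.2)
        ((2 * Real.pi : ℝ) * Complex.I
          * (Complex.exp ((2 * Real.pi * t : ℝ) * Complex.I) * p.2)) t := by
      have h2 : HasDerivAt (fun t : ℝ => ((2 * Real.pi * t : ℝ) : ℂ) * Complex.I)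
          ((2 * Real.pi : ℝ) * Complex.I) t := by
        have h3 : HasDerivAt (fun t : ℝ => 2 * Real.pi * t) (2 * Real.pi) t := by
          simpa using (hasDerivAt_id t).const_mul (2 * Real.pi)
        exact h3.ofReal_comp.mul_const Complex.I
      refine (h2.cexp.mul_const p.2).congr_deriv ?_
      ring
    have h2 := (hasMFDerivAt_const (I := 𝓘(ℝ, ℝ)) (I' := I) p.1 t).prodMk
      h1.hasFDerivAt.hasMFDerivAt
    refine h2.congr_mfderiv ?_
    have key : ∀ v : ℂ, (0 : ℝ →L[ℝ] E).prod (ContinuousLinearMap.toSpanSingleton ℝ v)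
        = (1 : ℝ →L[ℝ] ℝ).smulRight ((0, v) : E × ℂ) := by
      intro v
      ext <;> simp
    exact key _

theorem mfderiv_rotationFlow (t : ℝ) (p : W × ℂ) (v : E × ℂ) :
    mfderiv (I.prod 𝓘(ℝ, ℂ)) (I.prod 𝓘(ℝ, ℂ)) (rotationFlow t : W × ℂ → W × ℂ) p v
      = (v.1, Complex.exp ((2 * Real.pi * t : ℝ) * Complex.I) * v.2) := by
  have h1 : HasMFDerivAt (I.prod 𝓘(ℝ, ℂ)) 𝓘(ℝ, ℂ)
      (fun p : W × ℂ => Complex.exp ((2 * Real.pi * t : ℝ) * Complex.I) * p.2) p _ :=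
    HasMFDerivAt.comp (g := fun z : ℂ => Complex.exp ((2 * Real.pi * t : ℝ) * Complex.I) * z)
      (f := Prod.snd) p
      (((ContinuousLinearMap.mul ℝ ℂ (Complex.exp ((2 * Real.pi * t : ℝ) * Complex.I))
        ).hasFDerivAt (x := p.2)).hasMFDerivAt) (hasMFDerivAt_snd (I := I) (I' := 𝓘(ℝ, ℂ)) p)
  exact DFunLike.congr_fun ((hasMFDerivAt_fst (I := I) (I' := 𝓘(ℝ, ℂ)) p).prodMk h1).mfderiv v

/-- The stabilization of a manifold with a convex end carries a loop of Hamiltonian diffeomorphisms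
that is positive at infinity. -/
theorem exists_positive_hamiltonianLoop_stabilization
    {E' : Type*} [NormedAddCommGroup E'] [NormedSpace ℝ E'] [FiniteDimensional ℝ E']
    {H' : Type*} [TopologicalSpace H'] {J : ModelWithCorners ℝ E' H'} [J.Boundaryless]
    {Y : Type*} [TopologicalSpace Y] [ChartedSpace H' Y] [IsManifold J ∞ Y] [T2Space Y]
    [CompactSpace Y] {lam : OneForm I W} {al : OneForm J Y}
    (hlam : lam.Smooth) (hal : al.IsContact) (e : ConvexEnd lam al) :
    ∃ psi : ℝ → ((W × ℂ) ≃ₘ⟮I.prod 𝓘(ℝ, ℂ), I.prod 𝓘(ℝ, ℂ)⟯ (W × ℂ)),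
      IsContactAtInfinityHamiltonianLoop lam.stabilization psi ∧
      ∃ K : Set (W × ℂ), IsCompact K ∧ ∀ t, ∀ x ∉ K, 0 < lam.stabilization (psi t x)
        (isotopyVelocity (I := I.prod 𝓘(ℝ, ℂ)) (fun τ => psi τ) t x) := by
  obtain ⟨g, A, R, hA, hgd, hgK, hdisp⟩ := exists_displacement hlam hal e
  have hone : ∀ t : ℝ, ‖Complex.exp ((2 * Real.pi * t : ℝ) * Complex.I)‖ = 1 := fun t =>
    Complex.norm_exp_ofReal_mul_I _
  have hQ : ContMDiff (I.prod 𝓘(ℝ, ℂ)) 𝓘(ℝ, ℝ) ∞ (fun p : W × ℂ => Real.pi * ‖p.2‖ ^ 2) :=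
    (contDiff_const.mul (contDiff_norm_sq ℝ)).contMDiff.comp contMDiff_snd
  have hQd : ∀ (p : W × ℂ) (v : E × ℂ),
      OneForm.differential (I.prod 𝓘(ℝ, ℂ)) (fun p : W × ℂ => Real.pi * ‖p.2‖ ^ 2) p v
        = 2 * Real.pi * (p.2.re * v.2.re + p.2.im * v.2.im) := by
    intro p v
    have h1 : HasFDerivAt (fun z : ℂ => Real.pi * ‖z‖ ^ 2)
        (Real.pi • (2 • (innerSL ℝ p.2 : ℂ →L[ℝ] ℝ))) p.2 :=
      ((hasStrictFDerivAt_norm_sq p.2).hasFDerivAt).const_mul Real.pi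
    have h2 := HasMFDerivAt.comp (g := fun z : ℂ => Real.pi * ‖z‖ ^ 2) (f := Prod.snd) p
      h1.hasMFDerivAt (hasMFDerivAt_snd (I := I) (I' := 𝓘(ℝ, ℂ)) p)
    refine (DFunLike.congr_fun h2.mfderiv v).trans ?_
    have key : ∀ w : ℂ, (Real.pi • (2 • (innerSL ℝ p.2 : ℂ →L[ℝ] ℝ))) w
        = 2 * Real.pi * (p.2.re * w.re + p.2.im * w.im) := by
      intro w
      simp [Complex.inner]
      ring
    exact key v.2
  refine exists_positive_hamiltonianLoop hlam.stabilization (isSmoothFlow_rotationFlow (I := I))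
    (fun p => ?_) (Q := fun p => Real.pi * ‖p.2‖ ^ 2) hQ
    (fun p => mul_nonneg Real.pi_nonneg (sq_nonneg _)) (fun t p => ?_) (fun p v => ?_) (fun p => ?_)
    (fun t p v => ?_) hgd (hA.prod (isCompact_closedBall (0 : ℂ) R)) (fun t p hp h => hp ?_)
    hgK (fun p h1 h2 => ?_)
  · have h : Complex.exp ((2 * Real.pi * 1 : ℝ) * Complex.I) = 1 := by
      push_cast
      rw [mul_one]
      exact Complex.exp_two_pi_mul_I
    rw [rotationFlow, h, one_mul]
  · simp only [rotationFlow, norm_mul, hone, one_mul]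
  · refine (OneForm.d_stabilization hlam p _ v).trans ?_
    rw [hQd p v]
    have h0 : lam.d p.1 (0 : E) v.1 = 0 := lam.d_zero_left p.1 v.1
    simp only [Complex.mul_re, Complex.mul_im, Complex.ofReal_re, Complex.ofReal_im, Complex.I_re,
      Complex.I_im]
    linear_combination h0
  · refine (OneForm.stabilization_apply lam p _).trans ?_
    have h0 : lam p.1 (0 : E) = 0 := map_zero (lam p.1 : E →L[ℝ] ℝ)
    rw [OneForm.stdComplex_apply, Complex.sq_norm, Complex.normSq_apply]
    simp only [Complex.mul_re, Complex.mul_im, Complex.ofReal_re,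
      Complex.ofReal_im, Complex.I_re, Complex.I_im]
    refine (congrArg (· + _) h0).trans ?_
    ring
  · refine (congrArg (lam.stabilization (rotationFlow t p)) (mfderiv_rotationFlow t p v)).trans ?_
    refine (OneForm.stabilization_apply lam (rotationFlow t p) _).trans
      (Eq.trans ?_ (OneForm.stabilization_apply lam p v).symm)
    refine congrArg (lam p.1 v.1 + ·) ?_
    refine (OneForm.stdComplex_mul_mul _ p.2 v.2).trans ?_
    rw [Complex.normSq_eq_norm_sq, hone, one_pow, one_mul]
  · refine ⟨h.1, ?_⟩
    have h2 := h.2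
    rw [mem_closedBall_zero_iff] at h2 ⊢
    rwa [rotationFlow, norm_mul, hone, one_mul] at h2
  · have h0 : ∀ z : ℂ, Real.pi * ‖z‖ ^ 2 = 0 → z = 0 := by
      intro z hz
      rcases mul_eq_zero.1 hz with h | h
      · exact absurd h Real.pi_ne_zero
      · exact norm_eq_zero.1 (pow_eq_zero_iff (two_ne_zero) |>.1 h)
    exact hdisp p (h0 _ h1) (h0 _ h2)

end RotationLoop

/-! ### Restriction to the ideal boundary -/

section IdealRestriction

open Filter Topology

variable {E : Type*} [NormedAddCommGroup E] [NormedSpace ℝ E] [FiniteDimensional ℝ E]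
  {H : Type*} [TopologicalSpace H] {I : ModelWithCorners ℝ E H} [I.Boundaryless]
  {M : Type*} [TopologicalSpace M] [ChartedSpace H M] [IsManifold I ∞ M] [T2Space M]
  {E' : Type*} [NormedAddCommGroup E'] [NormedSpace ℝ E'] [FiniteDimensional ℝ E']
  {H' : Type*} [TopologicalSpace H'] {J : ModelWithCorners ℝ E' H'} [J.Boundaryless]
  {Y : Type*} [TopologicalSpace Y] [ChartedSpace H' Y] [IsManifold J ∞ Y]
  {lam : OneForm I M} {al : OneForm J Y}

namespace ConvexEnd

/-- The end eventually leaves every compact set. -/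
theorem exists_forall_emb_notMem (e : ConvexEnd lam al) {C : Set M} (hC : IsCompact C) :
    ∃ S : ℝ, 0 < S ∧ ∀ y s, S ≤ s → e.emb (y, s) ∉ C := by
  obtain ⟨n, hn⟩ := hC.elim_directed_cover
    (fun n : ℕ => (e.emb '' (univ ×ˢ Ici ((n : ℝ) + 1)))ᶜ)
    (fun n => (e.isClosed_image _ (by positivity)).isOpen_compl) (fun x _ => by
      rw [mem_iUnion]
      by_cases hx : x ∈ e.emb '' (univ ×ˢ Ici 1)
      · obtain ⟨⟨y, s⟩, ⟨-, hs⟩, rfl⟩ := hx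
        have hs' : (1 : ℝ) ≤ s := hs
        obtain ⟨n, hn⟩ := exists_nat_gt s
        refine ⟨n, ?_⟩
        rintro ⟨⟨y', s'⟩, ⟨-, hs2⟩, h⟩
        have hs2' : (n : ℝ) + 1 ≤ s' := hs2
        have h1 := congrArg Prod.snd (e.eq_of_emb_eq (show 0 < s' by linarith)
          (show 0 < s by linarith) h)
        simp only at h1
        linarith
      · exact ⟨0, by simpa using hx⟩)
    (directed_of_isDirected_le fun m n hmn => by
      refine compl_subset_compl.2 (image_mono (prod_mono le_rfl (Ici_subset_Ici.2 ?_)))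
      have : (m : ℝ) ≤ n := by exact_mod_cast hmn
      linarith)
  exact ⟨n + 1, by positivity, fun y s hs h => hn h ⟨(y, s), ⟨mem_univ _, hs⟩, rfl⟩⟩

/-- A smooth family of diffeomorphisms that preserves the Liouville vector field outside of a
compact set `K` acts at infinity by a smooth family of maps of the ideal boundary, together with
translations of the symplectization coordinate. -/
theorem exists_idealRestriction (e : ConvexEnd lam al) (hlam : lam.Smooth)
    (hnd : lam.NondegenerateD) (hal : al.Smooth) {f : ℝ → (M ≃ₘ⟮I, I⟯ M)}
    (hf : ContMDiff (𝓘(ℝ, ℝ).prod I) I ∞ (fun p : ℝ × M => f p.1 p.2)) {K : Set M}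
    (hK : IsCompact K)
    (hfK : ∀ (t : ℝ), ∀ x ∉ K, ∀ z : TangentSpace I x,
      lam.IsLiouvilleVector x z → lam.IsLiouvilleVector (f t x) (mfderiv I I (f t) x z)) :
    ∃ (φ : ℝ → Y → Y) (g : ℝ → Y → ℝ),
      ContMDiff (𝓘(ℝ, ℝ).prod J) J ∞ (fun p : ℝ × Y => φ p.1 p.2) ∧
      ContMDiff (𝓘(ℝ, ℝ).prod J) 𝓘(ℝ, ℝ) ∞ (fun p : ℝ × Y => g p.1 p.2) ∧
      ∃ S₀ : ℝ, 0 < S₀ ∧ (∀ y s, S₀ ≤ s → e.emb (y, s) ∉ K) ∧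
        (∀ t y s, S₀ ≤ s → f t (e.emb (y, s)) ∈ e.emb '' (univ ×ˢ Ioi 0) →
          0 < s + g t y ∧ f t (e.emb (y, s)) = e.emb (φ t y, s + g t y)) ∧
        ∀ t, ∃ S, S₀ ≤ S ∧ ∀ y s, S ≤ s → f t (e.emb (y, s)) ∈ e.emb '' (univ ×ˢ Ioi 0) := by
  obtain ⟨X, Z, hXs', hZ, hX, hZe⟩ := e.exists_liouvilleFlow hlam hnd hal
  obtain ⟨S₁, hS₁, hKe⟩ := e.exists_forall_emb_notMem hK
  have hXs : ContMDiff I I.tangent 1 (fun x => (⟨x, X x⟩ : TangentBundle I M)) :=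
    hXs'.of_le (by simp)
  -- far out, `f t` commutes with the Liouville flow
  have hcomm : ∀ t y s r, S₁ + 1 ≤ s → 0 ≤ r →
      f t (e.emb (y, s + r)) = Z r (f t (e.emb (y, s))) := by
    intro t y s r hs hr
    have h1 : IsMIntegralCurveOn (fun r => f t (e.emb (y, s + r))) X (Ioo (-1) (r + 1)) := by
      intro r' hr'
      have h2 := (e.isMIntegralCurveOn_emb hlam hnd hal hX y s r'
        (show -s < r' by linarith [hr'.1])).hasMFDerivAt
        (Ioi_mem_nhds (show -s < r' by linarith [hr'.1]))
      have h3 := HasMFDerivAt.comp (g := f t) r' ((f t).mdifferentiableAt_apply _).hasMFDerivAt h2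
      refine HasMFDerivAt.hasMFDerivWithinAt (h3.congr_mfderiv ?_)
      have h4 : mfderiv I I (f t) (e.emb (y, s + r')) (X (e.emb (y, s + r')))
          = X (f t (e.emb (y, s + r'))) :=
        hnd.liouvilleVector_unique (hfK t _ (hKe y _ (by linarith [hr'.1])) _ (hX _)) (hX _)
      have key : ∀ (D : E →L[ℝ] E) (a b : E), D a = b →
          D.comp ((1 : ℝ →L[ℝ] ℝ).smulRight a) = (1 : ℝ →L[ℝ] ℝ).smulRight b := by
        rintro D a _ rfl
        ext
        simp
      exact key _ _ _ h4
    have h2 := isMIntegralCurveOn_Ioo_eqOn_of_contMDiff_boundaryless (t₀ := 0)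
      ⟨by norm_num, by linarith⟩ hXs h1
      ((hZ.isMIntegralCurve (f t (e.emb (y, s)))).isMIntegralCurveOn _) (by simp [hZ.zero])
    exact h2 ⟨by linarith, by linarith⟩
  -- far out, `f t` maps the end into the end
  have hend : ∀ t, ∃ S, S₁ + 1 ≤ S ∧
      ∀ y s, S ≤ s → f t (e.emb (y, s)) ∈ e.emb '' (univ ×ˢ Ioi 0) := by
    intro t
    obtain ⟨S, hS, hSe⟩ := e.exists_forall_emb_notMem
      ((e.isCompact_compl 1 one_pos).image (f t).symm.continuous)
    refine ⟨max S (S₁ + 1), le_max_right _ _, fun y s hs => ?_⟩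
    by_contra hn
    refine hSe y s ((le_max_left _ _).trans hs) ⟨f t (e.emb (y, s)), fun h => hn ?_,
      (f t).symm_apply_apply _⟩
    exact image_mono (Set.prod_mono le_rfl (Ioi_subset_Ioi zero_le_one)) h
  choose S hS hSe using hend
  have hex : ∀ t y, ∃ p : Y × ℝ, 0 < p.2 ∧ e.emb p = f t (e.emb (y, S t)) := by
    intro t y
    obtain ⟨p, ⟨-, hp⟩, h⟩ := hSe t y (S t) le_rfl
    exact ⟨p, hp, h⟩
  choose P hP0 hP using hex
  -- by flowing to time `max s (S t)`, the value at `s` is determined by the value at `S t`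
  have hval : ∀ t y s, S₁ + 1 ≤ s → ∀ q : Y × ℝ, 0 < q.2 → e.emb q = f t (e.emb (y, s)) →
      q = ((P t y).1, s + ((P t y).2 - S t)) := by
    rintro t y s hs ⟨y', σ⟩ hσ hq
    have hσ' : 0 < σ := hσ
    let r := max 0 (S t - s)
    have hr : 0 ≤ r := le_max_left _ _
    have hr2 : 0 ≤ s + r - S t := by linarith [le_max_right 0 (S t - s)]
    have h1 := hcomm t y s r hs hr
    rw [← hq, hZe y' σ r hσ' (by linarith)] at h1
    have h2 := hcomm t y (S t) (s + r - S t) (hS t) hr2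
    have hp0 : 0 < (P t y).2 := hP0 t y
    rw [← hP, show P t y = ((P t y).1, (P t y).2) from rfl, hZe _ _ _ hp0 (by linarith),
      add_sub_cancel, h1] at h2
    have h3 := e.eq_of_emb_eq (show 0 < σ + r by linarith)
      (show 0 < (P t y).2 + (s + r - S t) by linarith) h2
    have h4 := congrArg Prod.fst h3
    have h5 := congrArg Prod.snd h3
    simp only at h4 h5
    refine Prod.ext h4 ?_
    change σ = s + ((P t y).2 - S t)
    linarith
  -- near `t₀`, the slice at `S t₀` can be used in place of the slice at `S t`, where `S`
  -- need not be continuous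
  have hsmooth : ContMDiff (𝓘(ℝ, ℝ).prod J) (J.prod 𝓘(ℝ, ℝ)) ∞
      (fun p : ℝ × Y => ((P p.1 p.2).1, (P p.1 p.2).2 - S p.1)) := by
    rintro ⟨t₀, y₀⟩
    let s₁ := S t₀
    have hs₁ : 0 < s₁ := by linarith [hS t₀]
    let F : ℝ × Y → M := fun p => f p.1 (e.emb (p.2, s₁))
    have hF : ContMDiff (𝓘(ℝ, ℝ).prod J) I ∞ F := by
      intro p
      have h1 : ContMDiffAt (𝓘(ℝ, ℝ).prod J) I ∞ (fun p : ℝ × Y => e.emb (p.2, s₁)) p :=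
        ContMDiffAt.comp (I' := J.prod 𝓘(ℝ, ℝ)) (g := e.emb) (f := fun p : ℝ × Y => (p.2, s₁)) p
          (e.contMDiffAt_emb p.2 hs₁) (contMDiffAt_snd.prodMk contMDiffAt_const)
      exact ContMDiffAt.comp (I' := 𝓘(ℝ, ℝ).prod I) (g := fun p : ℝ × M => f p.1 p.2)
        (f := fun p : ℝ × Y => (p.1, e.emb (p.2, s₁))) p hf.contMDiffAt
        (contMDiffAt_fst.prodMk h1)
    obtain ⟨Φ, h1, h2⟩ := e.isLocalDiffeomorphAt (P t₀ y₀).1 (hP0 t₀ y₀)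
    have hF0 : F (t₀, y₀) = Φ (P t₀ y₀) := (hP t₀ y₀).symm.trans (h2 h1)
    have h3 : F (t₀, y₀) ∈ Φ.target := by rw [hF0]; exact Φ.apply_mem_target h1
    have h4 : ContMDiffAt (𝓘(ℝ, ℝ).prod J) (J.prod 𝓘(ℝ, ℝ)) ∞ (fun p => Φ.symm (F p)) (t₀, y₀) :=
      (Φ.contMDiffAt_symm h3).comp (t₀, y₀) hF.contMDiffAt
    have h5 : Φ.symm (F (t₀, y₀)) = P t₀ y₀ := by rw [hF0]; exact Φ.symm_apply_apply h1
    have h6 : ∀ᶠ p in 𝓝 (t₀, y₀), 0 < (Φ.symm (F p)).2 := by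
      refine (continuous_snd.continuousAt.comp h4.continuousAt).eventually (lt_mem_nhds ?_)
      change 0 < (Φ.symm (F (t₀, y₀))).2
      rw [h5]
      exact hP0 t₀ y₀
    have h7 : ContMDiffAt (𝓘(ℝ, ℝ).prod J) (J.prod 𝓘(ℝ, ℝ)) ∞
        (fun p => ((Φ.symm (F p)).1, (Φ.symm (F p)).2 - s₁)) (t₀, y₀) :=
      ((contMDiffAt_fst (I := J) (J := 𝓘(ℝ, ℝ))).comp (t₀, y₀) h4).prodMk
        (((contMDiffAt_snd (I := J) (J := 𝓘(ℝ, ℝ))).comp (t₀, y₀) h4).sub contMDiffAt_const)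
    refine h7.congr_of_eventuallyEq ?_
    filter_upwards [h6, hF.continuous.continuousAt (Φ.open_target.mem_nhds h3)] with p hp hp2
    have h8 := hval p.1 p.2 s₁ (hS t₀) (Φ.symm (F p)) hp
      ((h2 (Φ.symm_apply_mem_source hp2)).trans (Φ.apply_symm_apply hp2))
    rw [h8]
    simp
  refine ⟨fun t y => (P t y).1, fun t y => (P t y).2 - S t,
    ContMDiff.comp (g := Prod.fst)
      (f := fun p : ℝ × Y => ((P p.1 p.2).1, (P p.1 p.2).2 - S p.1)) contMDiff_fst hsmooth,
    ContMDiff.comp (g := Prod.snd)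
      (f := fun p : ℝ × Y => ((P p.1 p.2).1, (P p.1 p.2).2 - S p.1)) contMDiff_snd hsmooth,
    S₁ + 1, by linarith, fun y s hs => hKe y s (by linarith), ?_, fun t => ⟨S t, hS t, hSe t⟩⟩
  rintro t y s hs ⟨q, ⟨-, hq⟩, hqe⟩
  have h1 := hval t y s hs q hq hqe
  have hq' : 0 < q.2 := hq
  refine ⟨?_, ?_⟩
  · rw [h1] at hq'
    exact hq'
  · rw [← hqe]
    exact congrArg e.emb h1

end ConvexEnd

end IdealRestriction

section ExtensibleLoop

open Filter Topology

variable {E : Type*} [NormedAddCommGroup E] [NormedSpace ℝ E] [FiniteDimensional ℝ E]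
  {H : Type*} [TopologicalSpace H] {I : ModelWithCorners ℝ E H} [I.Boundaryless]
  {M : Type*} [TopologicalSpace M] [ChartedSpace H M] [IsManifold I ∞ M]
  {E' : Type*} [NormedAddCommGroup E'] [NormedSpace ℝ E'] [FiniteDimensional ℝ E']
  {H' : Type*} [TopologicalSpace H'] {J : ModelWithCorners ℝ E' H'} [J.Boundaryless]
  {Y : Type*} [TopologicalSpace Y] [ChartedSpace H' Y] [IsManifold J ∞ Y]
  {lam : OneForm I M} {al : OneForm J Y}

namespace OneForm

/-- A symplectic map that preserves the Liouville vector at a point preserves the one-form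
there. -/
theorem PreservesDAt.preservesAt {f : M ≃ₘ⟮I, I⟯ M} {x : M} (hf : lam.PreservesDAt f x)
    {z : TangentSpace I x} (hz : lam.IsLiouvilleVector x z)
    (hz' : lam.IsLiouvilleVector (f x) (mfderiv I I f x z)) : lam.PreservesAt f x := fun v =>
  (hz' _).symm.trans ((hf z v).trans (hz v))

/-- A symplectic map that preserves the one-form at a point preserves the Liouville vector
there. -/
theorem PreservesDAt.isLiouvilleVector {f : M ≃ₘ⟮I, I⟯ M} {x : M} (hf : lam.PreservesDAt f x)
    (hf' : lam.PreservesAt f x) {z : TangentSpace I x} (hz : lam.IsLiouvilleVector x z) :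
    lam.IsLiouvilleVector (f x) (mfderiv I I f x z) := fun w => by
  obtain ⟨v, rfl⟩ := f.surjective_mfderiv x w
  exact (hf z v).trans ((hz v).trans (hf' v).symm)

end OneForm

namespace ConvexEnd

theorem IsIdealRestriction.unique {e : ConvexEnd lam al} {psi : M → M} {phi phi' : Y → Y}
    (h : e.IsIdealRestriction psi phi) (h' : e.IsIdealRestriction psi phi') : phi = phi' := by
  obtain ⟨S, g, -, hg⟩ := h
  obtain ⟨S', g', -, hg'⟩ := h'
  funext y
  let s := max S S' + 1
  have h1 := hg y s (by linarith [le_max_left S S'])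
  have h2 := hg' y s (by linarith [le_max_right S S'])
  exact congrArg Prod.fst (e.eq_of_emb_eq (p := (phi y, s + g y)) (q := (phi' y, s + g' y))
    h1.1 h2.1 (h1.2.symm.trans h2.2))

theorem IsIdealRestriction.leftInverse {e : ConvexEnd lam al} {psi psi' : M → M}
    {phi phi' : Y → Y} (h : e.IsIdealRestriction psi phi) (h' : e.IsIdealRestriction psi' phi')
    (hinv : Function.LeftInverse psi' psi) : Function.LeftInverse phi' phi := by
  obtain ⟨S, g, hS, hg⟩ := h
  obtain ⟨S', g', -, hg'⟩ := h'
  intro y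
  let s := max S (S' - g y) + 1
  have hs : S < s := by linarith [le_max_left S (S' - g y)]
  have h1 := hg y s hs
  have h2 := hg' (phi y) (s + g y) (by linarith [le_max_right S (S' - g y)])
  rw [← h1.2, hinv] at h2
  exact (congrArg Prod.fst (e.eq_of_emb_eq (p := (y, s))
    (q := (phi' (phi y), s + g y + g' (phi y))) (hS.trans_lt hs) h2.1 h2.2)).symm

variable {EN : Type*} [NormedAddCommGroup EN] [NormedSpace ℝ EN]
  {HN : Type*} [TopologicalSpace HN] {IN : ModelWithCorners ℝ EN HN}
  {N : Type*} [TopologicalSpace N] [ChartedSpace HN N]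

/-- The Liouville form on the derivative of a map `z ↦ emb (φ z, σ z)` into the end. -/
theorem apply_mfderiv_of_eventuallyEq (e : ConvexEnd lam al) {F : N → M} {φ : N → Y} {σ : N → ℝ}
    {x : N} (hφ : MDifferentiableAt IN J φ x) (hσ : MDifferentiableAt IN 𝓘(ℝ, ℝ) σ x)
    (h0 : 0 < σ x) (hF : F =ᶠ[𝓝 x] fun z => e.emb (φ z, σ z)) (v : TangentSpace IN x) :
    lam (F x) (mfderiv IN I F x v) = Real.exp (σ x) * al (φ x) (mfderiv IN J φ x v) := by
  have h1 : HasMFDerivAt IN (J.prod 𝓘(ℝ, ℝ)) (fun z => (φ z, σ z)) x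
      ((mfderiv IN J φ x).prod (mfderiv IN 𝓘(ℝ, ℝ) σ x)) :=
    hφ.hasMFDerivAt.prodMk hσ.hasMFDerivAt
  have h2 := HasMFDerivAt.comp (g := e.emb) (f := fun z => (φ z, σ z)) x
    ((e.contMDiffAt_emb (φ x) h0).mdifferentiableAt (by simp)).hasMFDerivAt h1
  have h3 := DFunLike.congr_fun (h2.congr_of_eventuallyEq hF).mfderiv v
  have key : ∀ y, y = e.emb (φ x, σ x) → ∀ a b : E, a = b → lam y a = lam (e.emb (φ x, σ x)) b := by
    rintro _ rfl a _ rfl; rfl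
  exact (key _ hF.eq_of_nhds _ _ h3).trans (e.pullback_emb_apply (φ x) h0 _)

variable [T2Space M]

/-- Off a compact set, a contact-at-infinity Hamiltonian loop preserves the Liouville form, so that
its ideal restriction is a loop of contactomorphisms, which is positive as soon as the velocity of
the loop pairs positively with the Liouville form at infinity. -/
theorem exists_extensible_positiveLoop (e : ConvexEnd lam al) (hlam : lam.Smooth)
    (hnd : lam.NondegenerateD) (hal : al.Smooth) {psi : ℝ → (M ≃ₘ⟮I, I⟯ M)}
    (hpsi : IsContactAtInfinityHamiltonianLoop lam psi) {K : Set M} (hK : IsCompact K)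
    (hpos : ∀ t, ∀ x ∉ K, 0 < lam (psi t x) (isotopyVelocity (I := I) (fun τ => psi τ) t x)) :
    ∃ phi : ℝ → (Y ≃ₘ⟮J, J⟯ Y),
      IsContactLoop al phi ∧ IsPositiveLoop al phi ∧ e.IsExtensible phi := by
  obtain ⟨K₁, hK₁, hequi⟩ := hpsi.equivariant
  have hD : ∀ t x, lam.PreservesDAt (psi t) x := hpsi.symplectic
  obtain ⟨X, -, -, -, hX, -⟩ := e.exists_liouvilleFlow hlam hnd hal
  have hpres : ∀ t, ∀ x ∉ K₁, lam.PreservesAt (psi t) x := fun t x hx =>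
    (hD t x).preservesAt (hX x) (hequi t x hx _ (hX x))
  obtain ⟨φ, g, hφs, hgs, S₀, hS₀, hoff, hval, hend⟩ := e.exists_idealRestriction hlam hnd hal
    hpsi.smooth (hK₁.union hK) fun t x hx => hequi t x fun h => hx (Or.inl h)
  have hφ : ∀ t, e.IsIdealRestriction (psi t) (φ t) := by
    intro t
    obtain ⟨S, hS, hSe⟩ := hend t
    exact ⟨S, g t, hS₀.le.trans hS, fun y s hs => hval t y s (hS.trans hs.le) (hSe y s hs.le)⟩
  -- the inverse of `psi t` has an ideal restriction as well
  have hinv : ∀ t, ∃ φ' : Y → Y, ContMDiff J J ∞ φ' ∧ e.IsIdealRestriction (psi t).symm φ' := by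
    intro t
    obtain ⟨φ', g', hφ's, -, S₁, hS₁, -, hval', hend'⟩ := e.exists_idealRestriction hlam hnd hal
      (f := fun _ => (psi t).symm) ((psi t).symm.contMDiff.comp contMDiff_snd)
      (hK₁.image (psi t).continuous) (fun _ x hx z hz => by
        have hx' : (psi t).symm x ∉ K₁ := fun h => hx ⟨_, h, (psi t).apply_symm_apply x⟩
        have h1 := (hD t ((psi t).symm x)).symm
        have h2 := (hpres t _ hx').symm
        rw [(psi t).apply_symm_apply] at h1 h2
        exact h1.isLiouvilleVector h2 hz)
    obtain ⟨S, hS, hSe⟩ := hend' 0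
    exact ⟨φ' 0, hφ's.comp (contMDiff_const.prodMk contMDiff_id), S, g' 0, hS₁.le.trans hS,
      fun y s hs => hval' 0 y s (hS.trans hs.le) (hSe y s hs.le)⟩
  choose φ' hφ's hφ' using hinv
  have hslice : ∀ t, ContMDiff J J ∞ (φ t) := fun t =>
    hφs.comp (contMDiff_const.prodMk contMDiff_id)
  let phi : ℝ → (Y ≃ₘ⟮J, J⟯ Y) := fun t =>
    { toFun := φ t
      invFun := φ' t
      left_inv := (hφ t).leftInverse (hφ' t) (psi t).symm_apply_apply
      right_inv := (hφ' t).leftInverse (hφ t) (psi t).apply_symm_apply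
      contMDiff_toFun := hslice t
      contMDiff_invFun := hφ's t }
  refine ⟨phi, ⟨⟨hφs, fun t => ?_, ?_⟩, fun t y v => ?_⟩, fun t y => ?_, psi, hpsi, hφ⟩
  · have h1 := hφ (t + 1)
    rw [hpsi.periodic] at h1
    ext y
    exact congrFun (h1.unique (hφ t)) y
  · have h1 := hφ 0
    rw [hpsi.zero] at h1
    have h2 : e.IsIdealRestriction (Diffeomorph.refl I M ∞) id :=
      ⟨0, 0, le_rfl, fun y s hs => by simpa using hs⟩
    ext y
    exact congrFun (h1.unique h2) y
  -- contactomorphisms: compare the Liouville forms along the slice at a large `s`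
  · obtain ⟨s, hs, hse⟩ := hend t
    have hs0 : 0 < s := hS₀.trans_le hs
    have h1 := fun y => hval t y s hs (hse y s le_rfl)
    have hg : MDifferentiableAt J 𝓘(ℝ, ℝ) (fun y => s + g t y) y :=
      (contMDiff_const.add (hgs.comp
        (contMDiff_const.prodMk contMDiff_id))).contMDiffAt.mdifferentiableAt (n := ∞) (by simp)
    have h2 := e.apply_mfderiv_of_eventuallyEq (F := fun y => psi t (e.emb (y, s)))
      ((hslice t).contMDiffAt.mdifferentiableAt (by simp)) hg (h1 y).1
      (Eventually.of_forall fun y => (h1 y).2) v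
    have hemb : MDifferentiableAt J I (fun y => e.emb (y, s)) y :=
      ContMDiffAt.mdifferentiableAt (n := ∞) (ContMDiffAt.comp (I' := J.prod 𝓘(ℝ, ℝ)) (g := e.emb)
        (f := fun y : Y => (y, s)) y (e.contMDiffAt_emb y hs0)
        (contMDiffAt_id.prodMk contMDiffAt_const)) (by simp)
    have h3 := e.apply_mfderiv_of_eventuallyEq (F := fun y => e.emb (y, s)) (φ := id)
      mdifferentiableAt_id (mdifferentiableAt_const (c := s)) hs0 EventuallyEq.rfl v
    have h4 : mfderiv J J (id : Y → Y) y v = v := DFunLike.congr_fun mfderiv_id v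
    have h5 := mfderiv_comp_apply y (f := fun y => e.emb (y, s)) (g := psi t)
      ((psi t).mdifferentiableAt_apply _) hemb v
    have h6 := hpres t (e.emb (y, s)) (fun h => hoff y s hs (Or.inl h))
      (mfderiv J I (fun y => e.emb (y, s)) y v)
    have h7 : Real.exp (s + g t y) * al (φ t y) (mfderiv J J (φ t) y v)
        = Real.exp s * al y v :=
      h2.symm.trans ((congrArg (lam (psi t (e.emb (y, s)))) h5).trans (h6.trans
        (h3.trans (congrArg (fun w => Real.exp s * al y w) h4))))
    have h8 : al (phi t y) (mfderiv J J (phi t) y v) = 0 ↔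
        Real.exp (s + g t y) * al (φ t y) (mfderiv J J (φ t) y v) = 0 :=
      (mul_eq_zero_iff_left (Real.exp_pos _).ne').symm
    rw [h8, h7]
    exact mul_eq_zero_iff_left (Real.exp_pos _).ne'
  -- positivity: differentiate the restriction identity in time, at a fixed large `s`
  · obtain ⟨s, hs, hse⟩ := hend t
    have hpath : ContMDiff 𝓘(ℝ, ℝ) I ∞ (fun τ => psi τ (e.emb (y, s))) :=
      hpsi.smooth.comp (contMDiff_id.prodMk contMDiff_const)
    have hnhds : e.emb '' (univ ×ˢ Ioi 0) ∈ 𝓝 (psi t (e.emb (y, s))) :=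
      (e.isOpen_image (isOpen_univ.prod isOpen_Ioi) fun p hp => hp.2).mem_nhds (hse y s le_rfl)
    have h2 := e.apply_mfderiv_of_eventuallyEq (F := fun τ => psi τ (e.emb (y, s)))
      (φ := fun τ => φ τ y) (σ := fun τ => s + g τ y) (x := t)
      ((hφs.comp (contMDiff_id.prodMk contMDiff_const)).contMDiffAt.mdifferentiableAt (by simp))
      ((contMDiff_const.add (hgs.comp
        (contMDiff_id.prodMk contMDiff_const))).contMDiffAt.mdifferentiableAt (n := ∞) (by simp))
      (hval t y s hs (hse y s le_rfl)).1
      (by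
        filter_upwards [hpath.continuous.continuousAt hnhds] with τ hτ
        exact (hval τ y s hs hτ).2) (1 : ℝ)
    have h3 := hpos t (e.emb (y, s)) fun h => hoff y s hs (Or.inr h)
    have h4 : 0 < Real.exp (s + g t y)
        * al (phi t y) (isotopyVelocity (I := J) (fun τ => phi τ) t y) := h3.trans_eq h2
    exact (pos_iff_pos_of_mul_pos h4).1 (Real.exp_pos _)

end ConvexEnd

end ExtensibleLoop

theorem proposition1p3 {n : ℕ} {W : Type*} [TopologicalSpace W] [T2Space W]
    [ChartedSpace (EuclideanSpace ℝ (Fin n)) W] [IsManifold (𝓡 n) ∞ W]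
    (lam : OneForm (𝓡 n) W) (hlam : IsLiouvilleManifold lam) :
    IsLiouvilleManifold lam.stabilization ∧
    ∀ (m : ℕ) (Y : Type*) [TopologicalSpace Y] [T2Space Y] [CompactSpace Y]
      [ChartedSpace (EuclideanSpace ℝ (Fin m)) Y] [IsManifold (𝓡 m) ∞ Y]
      (al : OneForm (𝓡 m) Y), al.IsContact →
      ∀ e : ConvexEnd lam.stabilization al,
        ∃ phi : ℝ → (Y ≃ₘ⟮𝓡 m, 𝓡 m⟯ Y),
          IsContactLoop al phi ∧ IsPositiveLoop al phi ∧ e.IsExtensible phi := by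
  refine ⟨hlam.stabilization, fun m Y _ _ _ _ _ al hal e => ?_⟩
  obtain ⟨m₀, Y₀, _, _, _, _, _, al₀, hal₀, ⟨e₀⟩⟩ := hlam.convex
  obtain ⟨psi, hpsi, K, hK, hpos⟩ := exists_positive_hamiltonianLoop_stabilization hlam.smooth
    hal₀ e₀
  exact e.exists_extensible_positiveLoop hlam.smooth.stabilization
    (hlam.nondegenerate.stabilization hlam.smooth) hal.smooth hpsi hK hpos
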